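/- **Setting.** The input is a binary min-heap: an infinite binary tree whose nodes (items) carry keys from a totally ordered set, the key of each node being at most the keys of its left and right children. (A non-existent child is represented by a dummy item with key $+\infty$; equal keys are allowed.) Algorithms are programs of a unit-cost machine whose registers hold natural numbers, references to items, or pairs (immutable cons cells). The elementary instructions, one step each, are: copying a register, setting it to zero, forming and taking apart pairs, successor, predecessor and comparison of natural numbers, following the left- or right-child pointer of an item, comparing the keys of two items, tests, loop tests, and (recursive) procedure calls. **Soft heaps.** A *soft heap* with error parameter $\varepsilon$ is a data structure that stores items $e$, each with its original key $e.\mathrm{key}$ and a current key $e.\mathrm{key}'\ge e.\mathrm{key}$; an item is *corrupt* if $e.\mathrm{key}<e.\mathrm{key}'$. Its operations are: creation of an empty soft heap; $\mathtt{insert}(Q,e)$, which inserts $e$ with current key $e.\mathrm{key}$ and changes no other current key; and $\mathtt{extract\text{-}min}(Q)$, which removes an item $e$ whose current key is smallest at the beginning of the operation, after which current keys of remaining items may increase, and which returns $e$, a bit saying whether $e$ is corrupt, and the list $C$ of the items that were not corrupt before the operation but are corrupt after it. At all times the number of corrupt items in the heap is at most $\varepsilon I$, where $I$ is the number of insertions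 performed so far. The heap has amortized time $a$ per operation if there is a non-negative integer potential $\Phi$ such that creation satisfies $t+\Phi_{\mathrm{after}}\le a$ and every later operation satisfies $t+\Phi_{\mathrm{after}}\le a+\Phi_{\mathrm{before}}$, where $t$ is its number of steps. A *linear-time selection procedure* with constant $a$ finds $k$ smallest items of any list of $n$ items, $1\le k\le n$, in at most $an$ steps. **Algorithm $\mathtt{Soft\text{-}Select}(r)$**, for the root $r$ of the heap and $k\ge1$, given a soft heap with $\varepsilon=\frac14$ and a selection procedure $\mathtt{select}$: Create an empty soft heap $Q$, insert $r$ into $Q$ and put $r$ on a list $S$. Repeat $k-1$ times: let $(e,C)\gets\mathtt{extract\text{-}min}(Q)$; if $e$ is not corrupt, add $e$ to $C$; for each item of $C$, insert its two children into $Q$ and put them on $S$. Finally return $\mathtt{select}(S,k)$. **Theorem.** Soft-Select selects the $k$ smallest items of a binary min-heap in $O(k)$ time. Precisely: 1. There are a soft heap with error parameter $\frac14$ and constant amortized time per operation, and a linear-time selection procedure (both working for items with keys from an arbitrary totally ordered set), and a constant $c$, such that for every binary min-heap and every $k\ge 1$, Soft-Select run with them returns a list of $k$ distinct items, none of them with key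 larger than the key of an item not on the list, after at most $ck$ steps, at most $ck$ of which are key comparisons. 2. More generally, for every $a$ there is a constant $c$, depending only on $a$, such that the same conclusion holds for Soft-Select run with any soft heap with error parameter $\frac14$ and amortized time at most $a$ per operation and any linear-time selection procedure with constant $a$. -/

import Mathlib

universe u v

/-! ## The machine model

Programs work on immutable cells.  A value is a natural number, a reference to an item, or a
pair of values; `num 0` also serves as "false" and as the empty list.  Items are opaque: a
program can only ask for the left or right child of an item, or compare the keys of two items.
Every elementary instruction takes one step. -/

/-- Values that a register can hold; `V` is the type of items. -/
inductive Val (V : Type*) where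
  | num (n : ℕ)
  | item (v : V)
  | pair (a b : Val V)

namespace Val

variable {V : Type*}

/-- `num 0` is false; every other value is true. -/
def truthy : Val V → Bool
  | num 0 => false
  | _ => true

/-- The list `[v₁, …, vₙ]` of items, stored as `(v₁, (v₂, … (vₙ, 0)))`. -/
def ofList : List V → Val V
  | [] => num 0
  | v :: l => pair (item v) (ofList l)

end Val

/-- Items with keys from `α`, and the two child pointers of every item. -/
structure Items (V α : Type*) where
  key : V → α
  left : V → V
  right : V → V

/-- Right-hand sides of assignments; the arguments are registers. -/
inductive Rhs where
  | copy (y : ℕ)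
  | zero
  | succ (y : ℕ)
  | pred (y : ℕ)
  | lt (y z : ℕ)
  | pair (y z : ℕ)
  | head (y : ℕ)
  | tail (y : ℕ)
  | left (y : ℕ)
  | right (y : ℕ)
  | compare (y z : ℕ)

/-- Programs.  A program is also a procedure: it receives its argument in register `0`, all other
registers being `num 0`, and its result is the final content of register `0`. -/
inductive Prog where
  /-- Do nothing. -/
  | skip
  /-- `x := e` -/
  | assign (x : ℕ) (e : Rhs)
  | seq (p q : Prog)
  /-- If register `x` is true, run `p`, otherwise run `q`. -/
  | cond (x : ℕ) (p q : Prog)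
  /-- While register `x` is true, run `p`. -/
  | loop (x : ℕ) (p : Prog)
  /-- `x := f(y)`, a call of the procedure `f` with its own fresh registers. -/
  | call (x : ℕ) (f : Prog) (y : ℕ)
  /-- `x := f(y)` where `f` is the procedure being executed (a recursive call). -/
  | recur (x : ℕ) (y : ℕ)

/-- Run the programs of a list one after the other. -/
def Prog.block : List Prog → Prog
  | [] => .skip
  | p :: l => .seq p (Prog.block l)

/-- The value of a right-hand side, given the contents `σ` of the registers.  Operations applied
to values of the wrong kind give `num 0`.  The instruction `compare y z` tests whether the key of
the item in `y` is at most the key of the item in `z`. -/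
def Rhs.eval {V α : Type*} [LinearOrder α] (W : Items V α) (σ : ℕ → Val V) : Rhs → Val V
  | copy y => σ y
  | zero => .num 0
  | succ y => match σ y with
    | .num n => .num (n + 1)
    | _ => .num 0
  | pred y => match σ y with
    | .num n => .num (n - 1)
    | _ => .num 0
  | lt y z => match σ y, σ z with
    | .num m, .num n => if m < n then .num 1 else .num 0
    | _, _ => .num 0
  | pair y z => .pair (σ y) (σ z)
  | head y => match σ y with
    | .pair a _ => a
    | _ => .num 0
  | tail y => match σ y with
    | .pair _ b => b
    | _ => .num 0
  | left y => match σ y with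
    | .item v => .item (W.left v)
    | _ => .num 0
  | right y => match σ y with
    | .item v => .item (W.right v)
    | _ => .num 0
  | compare y z => match σ y, σ z with
    | .item u, .item v => if W.key u ≤ W.key v then .num 1 else .num 0
    | _, _ => .num 0

/-- The number of key comparisons made by an assignment. -/
def Rhs.comparisons : Rhs → ℕ
  | compare _ _ => 1
  | _ => 0

/-- The registers at the start of a procedure with argument `a`. -/
def initRegs {V : Type*} (a : Val V) : ℕ → Val V
  | 0 => a
  | _ + 1 => .num 0

/-- `Exec W f p σ σ' t m`: inside the procedure `f`, program `p` started with registers `σ` halts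
with registers `σ'` after `t` steps, `m` of which are key comparisons. -/
inductive Exec {V α : Type*} [LinearOrder α] (W : Items V α) :
    Prog → Prog → (ℕ → Val V) → (ℕ → Val V) → ℕ → ℕ → Prop where
  | skip (f : Prog) (σ : ℕ → Val V) : Exec W f .skip σ σ 1 0
  | assign (f : Prog) (σ : ℕ → Val V) (x : ℕ) (e : Rhs) :
      Exec W f (.assign x e) σ (Function.update σ x (e.eval W σ)) 1 e.comparisons
  | seq {f p q : Prog} {σ₁ σ₂ σ₃ : ℕ → Val V} {t₁ t₂ m₁ m₂ : ℕ} :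
      Exec W f p σ₁ σ₂ t₁ m₁ → Exec W f q σ₂ σ₃ t₂ m₂ →
      Exec W f (.seq p q) σ₁ σ₃ (t₁ + t₂) (m₁ + m₂)
  | cond_true {f p q : Prog} {x : ℕ} {σ σ' : ℕ → Val V} {t m : ℕ} :
      (σ x).truthy = true → Exec W f p σ σ' t m → Exec W f (.cond x p q) σ σ' (t + 1) m
  | cond_false {f p q : Prog} {x : ℕ} {σ σ' : ℕ → Val V} {t m : ℕ} :
      (σ x).truthy = false → Exec W f q σ σ' t m → Exec W f (.cond x p q) σ σ' (t + 1) m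
  | loop_done {f p : Prog} {x : ℕ} {σ : ℕ → Val V} :
      (σ x).truthy = false → Exec W f (.loop x p) σ σ 1 0
  | loop_step {f p : Prog} {x : ℕ} {σ₁ σ₂ σ₃ : ℕ → Val V} {t₁ t₂ m₁ m₂ : ℕ} :
      (σ₁ x).truthy = true → Exec W f p σ₁ σ₂ t₁ m₁ → Exec W f (.loop x p) σ₂ σ₃ t₂ m₂ →
      Exec W f (.loop x p) σ₁ σ₃ (t₁ + t₂ + 1) (m₁ + m₂)
  | call {f g : Prog} {x y : ℕ} {σ τ : ℕ → Val V} {t m : ℕ} :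
      Exec W g g (initRegs (σ y)) τ t m →
      Exec W f (.call x g y) σ (Function.update σ x (τ 0)) (t + 1) m
  | recur {f : Prog} {x y : ℕ} {σ τ : ℕ → Val V} {t m : ℕ} :
      Exec W f f (initRegs (σ y)) τ t m →
      Exec W f (.recur x y) σ (Function.update σ x (τ 0)) (t + 1) m

/-- The procedure `f`, called with argument `a`, returns `b` after `t` steps, `m` of which are key
comparisons. -/
def Returns {V α : Type*} [LinearOrder α] (W : Items V α) (f : Prog) (a b : Val V) (t m : ℕ) :
    Prop :=
  ∃ σ : ℕ → Val V, Exec W f f (initRegs a) σ t m ∧ σ 0 = b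

/-! ## Soft heaps -/

/-- The procedures of a soft heap (for one fixed error parameter):
`create 0` returns an empty heap, `insert (q, e)` returns the heap after the insertion,
`extractMin q` returns `(e, (b, (C, q')))`, where `e` is the extracted item, `b` its corruption
bit, `C` the list of newly corrupt items and `q'` the heap after the extraction. -/
structure SoftHeapProgs where
  create : Prog
  insert : Prog
  extractMin : Prog

/-- The mathematical content of a soft heap: the items in it, their current keys, and the number
of insertions performed so far. -/
structure SoftHeapState (V α : Type*) where
  items : Finset V
  curKey : V → α
  insertions : ℕ

/-- An item of the heap is corrupt if its current key exceeds its original key. -/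
def SoftHeapState.Corrupt {V α : Type*} [LinearOrder α] (W : Items V α) (s : SoftHeapState V α)
    (v : V) : Prop :=
  v ∈ s.items ∧ W.key v < s.curKey v

/-- Effect of inserting `v`: the new item gets its original key, and no current key changes. -/
def SoftHeapState.InsertStep {V α : Type*} (W : Items V α) (s : SoftHeapState V α) (v : V)
    (s' : SoftHeapState V α) : Prop :=
  (∀ u, u ∈ s'.items ↔ u = v ∨ u ∈ s.items) ∧
  s'.curKey v = W.key v ∧
  (∀ u ∈ s.items, s'.curKey u = s.curKey u) ∧
  s'.insertions = s.insertions + 1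

/-- Effect of extract-min: an item `e` whose current key is smallest at the beginning of the
operation is removed; afterwards current keys of remaining items may increase; `C` lists the items
that were not corrupt before the operation but are corrupt after it. -/
def SoftHeapState.ExtractStep {V α : Type*} [LinearOrder α] (W : Items V α)
    (s : SoftHeapState V α) (e : V) (C : List V) (s' : SoftHeapState V α) : Prop :=
  e ∈ s.items ∧
  (∀ u ∈ s.items, s.curKey e ≤ s.curKey u) ∧
  (∀ u, u ∈ s'.items ↔ u ∈ s.items ∧ u ≠ e) ∧
  (∀ u ∈ s'.items, s.curKey u ≤ s'.curKey u) ∧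
  s'.insertions = s.insertions ∧
  C.Nodup ∧
  (∀ u, u ∈ C ↔ s'.Corrupt W u ∧ ¬ s.Corrupt W u)

/-- The procedures `H` implement a soft heap with error parameter `ε` in which every operation
takes amortized time at most `a`.  `Rep q s` says that the value `q` represents the state `s`, and
`Φ` is the potential witnessing the amortized bound. -/
def IsSoftHeap {V α : Type*} [LinearOrder α] (W : Items V α) (H : SoftHeapProgs) (ε : ℚ) (a : ℕ) :
    Prop :=
  ∃ (Rep : Val V → SoftHeapState V α → Prop) (Φ : Val V → SoftHeapState V α → ℕ),
    (∀ q s, Rep q s →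
      (∀ v ∈ s.items, W.key v ≤ s.curKey v) ∧
      ({v | s.Corrupt W v}.ncard : ℚ) ≤ ε * s.insertions) ∧
    (∃ q s t m, Returns W H.create (.num 0) q t m ∧ Rep q s ∧
      s.items = ∅ ∧ s.insertions = 0 ∧ t + Φ q s ≤ a) ∧
    (∀ q s v, Rep q s → v ∉ s.items →
      ∃ q' s' t m, Returns W H.insert (.pair q (.item v)) q' t m ∧ Rep q' s' ∧
        s.InsertStep W v s' ∧ t + Φ q' s' ≤ a + Φ q s) ∧
    (∀ q s, Rep q s → s.items.Nonempty →
      ∃ q' s' e b C t m,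
        Returns W H.extractMin q (.pair (.item e) (.pair b (.pair (Val.ofList C) q'))) t m ∧
        Rep q' s' ∧ s.ExtractStep W e C s' ∧ (b.truthy = true ↔ s.Corrupt W e) ∧
        t + Φ q' s' ≤ a + Φ q s)

/-! ## Selection -/

/-- The procedure `f` is a linear-time selection algorithm: given a list of `n` items and
`1 ≤ k ≤ n` it returns `k` smallest items of the list (in any order) in at most `a * n` steps. -/
def IsLinearTimeSelection {V α : Type*} [LinearOrder α] (W : Items V α) (f : Prog) (a : ℕ) :
    Prop :=
  ∀ (l : List V) (k : ℕ), 1 ≤ k → k ≤ l.length →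
    ∃ (out rest : List V) (t m : ℕ),
      Returns W f (.pair (Val.ofList l) (.num k)) (Val.ofList out) t m ∧
      (out ++ rest).Perm l ∧ out.length = k ∧
      (∀ x ∈ out, ∀ y ∈ rest, W.key x ≤ W.key y) ∧ t ≤ a * l.length

/-! ## Algorithm Soft-Select -/

namespace SoftSelect

/-! Registers: `arg` is the argument `(r, k)` and the result; `i` counts the remaining iterations;
`e`, `b`, `C` receive the results of extract-min; `tmp` holds arguments and results of calls. -/

abbrev arg : ℕ := 0
abbrev r : ℕ := 1
abbrev k : ℕ := 2
abbrev S : ℕ := 3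
abbrev Q : ℕ := 4
abbrev i : ℕ := 5
abbrev e : ℕ := 6
abbrev b : ℕ := 7
abbrev C : ℕ := 8
abbrev x : ℕ := 9
abbrev y : ℕ := 10
abbrev tmp : ℕ := 11

/-- For each item `e` in the list `C`, insert both children of `e` into `Q` and put them on `S`. -/
def insertChildren (H : SoftHeapProgs) : Prog :=
  .loop C (.block [
    .assign e (.head C), .assign C (.tail C),
    .assign x (.left e), .assign y (.right e),
    .assign tmp (.pair Q x), .call Q H.insert tmp,
    .assign tmp (.pair Q y), .call Q H.insert tmp,
    .assign S (.pair x S),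
    .assign S (.pair y S)])

/-- One iteration: `(e, C) := extract-min(Q)`; if `e` is not corrupt, add it to `C`; then insert
the children of the items in `C`. -/
def iteration (H : SoftHeapProgs) : Prog :=
  .block [
    .call tmp H.extractMin Q,
    .assign e (.head tmp), .assign tmp (.tail tmp),
    .assign b (.head tmp), .assign tmp (.tail tmp),
    .assign C (.head tmp), .assign Q (.tail tmp),
    .cond b .skip (.assign C (.pair e C)),
    insertChildren H]

/-- Algorithm Soft-Select, using the soft heap `H` and the selection procedure `select`. -/
def program (H : SoftHeapProgs) (select : Prog) : Prog :=
  .block [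
    .assign r (.head arg), .assign k (.tail arg),
    .assign S .zero,
    .assign tmp .zero, .call Q H.create tmp,
    .assign tmp (.pair Q r), .call Q H.insert tmp,
    .assign S (.pair r S),
    .assign i (.pred k),
    .loop i (.block [iteration H, .assign i (.pred i)]),
    .assign tmp (.pair S k), .call arg select tmp]

end SoftSelect

/-! ## Binary min-heaps -/

/-- The nodes of the infinite binary tree: the root is `[]`, the left and right children of `v`
are `false :: v` and `true :: v`. -/
abbrev Node : Type := List Bool

/-- The items of a binary heap whose node `v` has key `key v`. -/
def heapItems {α : Type*} (key : Node → α) : Items Node α where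
  key := key
  left v := false :: v
  right v := true :: v

/-- Heap order: no item is larger than its children. -/
def IsMinHeap {α : Type*} [LinearOrder α] (key : Node → α) : Prop :=
  ∀ v : Node, key v ≤ key (false :: v) ∧ key v ≤ key (true :: v)

/-- On the binary heap with keys `key`, Soft-Select with parameter `k` returns a list of `k`
distinct items, none of them larger than an item not on the list, after at most `c * k` steps and
at most `c * k` comparisons. -/
def SoftSelectsWithin {α : Type*} [LinearOrder α] (key : Node → α) (H : SoftHeapProgs)
    (select : Prog) (k c : ℕ) : Prop :=
  ∃ (out : List Node) (t m : ℕ),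
    Returns (heapItems key) (SoftSelect.program H select)
      (.pair (.item []) (.num k)) (Val.ofList out) t m ∧
    out.Nodup ∧ out.length = k ∧ (∀ v ∈ out, ∀ w ∉ out, key v ≤ key w) ∧
    t ≤ c * k ∧ m ≤ c * k

/-! Selection from the binary heap. Let `X` be the set of extracted items. The children of an item
are inserted when it becomes corrupt, or when it is extracted without being corrupt; so `S` consists
of the root and the children of all items that are extracted or corrupt. At most |S|/4 items are
corrupt, hence |S| ≤ 1 + 2(|X| + |S|/4), that is |S| ≤ 4|X| + 2 (`Inv.length_le`), which makes the
time linear. If `w` is not on `S`, its parent is neither extracted nor corrupt; going upwards one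
meets an item `u` on `S` that is neither extracted nor corrupt, with key at most that of `w`
(`Inv.exists_le`). Keys of extracted items never exceed current keys in the soft heap, so `X`
together with `u` gives k items of `S` that are no larger than `w`, and the k smallest items of `S`
are no larger than `w` either (`Inv.select`).

The soft heap. It keeps sequences of nodes sorted by key. A sequence of rank r accounts for 2^r
insertions, and two sequences of equal rank are merged as in binary addition. On reaching a rank
divisible by 5, about every second node is deleted and its items move to the next node, into the bag
`K` of items smaller than their node. Such an item need not become corrupt at once: it is also
entered in the bag `W` of the node before the deleted one, its witness. The key of the witness is at
most that of the item, so while the witness lives the item may keep its own key without undercutting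
the head of the sequence. When the witness dies, the item is reported as newly corrupt and its
current key is raised to the key of its node. Hence the corrupt items are among those of `K` without
a living witness. Pruning adds at most two bags to their number (`Dle.prune`), and bags only triple
while the insertions multiply by 32, so a sequence of rank r has fewer than 2^r/4 corrupt items
(`corBound_le`).

Five ranks multiply the length of a sequence by about 16 but the insertions by 32. The cost of a
merge at rank r, divided by 2^r, is therefore summable (`summable_mergeCost`), and a constant charge
per insertion prepays all merges (`two_mul_reserve`). Each node also carries a multiple of rank + 1
for the reordering that its death causes.

The selection procedure is quickselect with a pivot from the same soft heap: insert n items, extract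
⌈n/4⌉ of them, and take the largest extracted original key. Few items are larger because of the
extracted ones; an item that is smaller was extracted or is corrupt (`pivotP_spec`).

Comparisons are steps, so it suffices to bound time (`Exec.comparisons_le`). -/

/-! ## Running programs -/

/-- Inside the procedure `f`, program `p` started with registers `σ` halts with registers and a
number of steps that satisfy `Q`. -/
def Tri {V α : Type*} [LinearOrder α] (W : Items V α) (f p : Prog) (σ : ℕ → Val V)
    (Q : (ℕ → Val V) → ℕ → Prop) : Prop :=
  ∃ σ' t m, Exec W f p σ σ' t m ∧ Q σ' t

/-- The procedure `f` called with argument `a` halts with a result and a number of steps that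
satisfy `R`. -/
def RetQ {V α : Type*} [LinearOrder α] (W : Items V α) (f : Prog) (a : Val V)
    (R : Val V → ℕ → Prop) : Prop :=
  ∃ b t m, Returns W f a b t m ∧ R b t

/-- `R b t`, in a form that the simplifier does not open. -/
def Post {V : Type*} (R : Val V → ℕ → Prop) (b : Val V) (t : ℕ) : Prop := R b t

section Logic

variable {V α : Type*} [LinearOrder α] {W : Items V α} {f p q : Prog} {σ : ℕ → Val V}
  {Q Q' : (ℕ → Val V) → ℕ → Prop} {a : Val V} {R R' : Val V → ℕ → Prop}

theorem RetQ.mono (h : RetQ W f a R) (hR : ∀ b t, R b t → R' b t) : RetQ W f a R' := by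
  obtain ⟨b, t, m, h, hr⟩ := h
  exact ⟨b, t, m, h, hR _ _ hr⟩

theorem Post.intro {b : Val V} {t : ℕ} (h : R b t) : Post R b t := h

-- With `Tri.congr_regs` and `RetQ.congr_arg`, this confines the simplifier to the current
-- registers, arguments, results and times; code and postconditions not yet reached stay untouched.
@[congr] theorem Post.congr_args {b b' : Val V} {t t' : ℕ} (hb : b = b') (ht : t = t') :
    Post R b t = Post R b' t' := by
  rw [hb, ht]

/-- Separating the body `p` from the name `f` allows the body to be opened once while recursive
calls still refer to `f`. -/
theorem RetQ.of_body (hf : f = p) (h : Tri W f p (initRegs a) fun σ t => Post R (σ 0) t) :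
    RetQ W f a R := by
  subst hf
  obtain ⟨σ', t, m, h, hr⟩ := h
  exact ⟨σ' 0, t, m, ⟨σ', h, rfl⟩, hr⟩

/-- This and the following equivalences compute weakest preconditions; as simplification rules they
execute straight-line code symbolically. -/
theorem tri_skip : Tri W f .skip σ Q ↔ Q σ 1 := by
  constructor
  · rintro ⟨σ', t, m, h, hq⟩
    cases h
    exact hq
  · intro h
    exact ⟨_, _, _, .skip _ _, h⟩

theorem tri_assign {x : ℕ} {e : Rhs} :
    Tri W f (.assign x e) σ Q ↔ Q (Function.update σ x (e.eval W σ)) 1 := by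
  constructor
  · rintro ⟨σ', t, m, h, hq⟩
    cases h
    exact hq
  · intro h
    exact ⟨_, _, _, .assign _ _ _ _, h⟩

theorem tri_seq :
    Tri W f (.seq p q) σ Q ↔ Tri W f p σ fun σ₁ t₁ => Tri W f q σ₁ fun σ₂ t₂ => Q σ₂ (t₁ + t₂) := by
  constructor
  · rintro ⟨σ', t, m, h, hq⟩
    cases h with
    | seq h₁ h₂ => exact ⟨_, _, _, h₁, _, _, _, h₂, hq⟩
  · rintro ⟨σ₁, t₁, m₁, h₁, σ₂, t₂, m₂, h₂, hq⟩
    exact ⟨_, _, _, .seq h₁ h₂, hq⟩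

theorem tri_cond_true {x : ℕ} (hx : (σ x).truthy = true) :
    Tri W f (.cond x p q) σ Q ↔ Tri W f p σ fun σ' t => Q σ' (t + 1) := by
  constructor
  · rintro ⟨σ', t, m, h, hq⟩
    cases h with
    | cond_true _ h => exact ⟨_, _, _, h, hq⟩
    | cond_false h' _ => simp [hx] at h'
  · rintro ⟨σ', t, m, h, hq⟩
    exact ⟨_, _, _, .cond_true hx h, hq⟩

theorem tri_cond_false {x : ℕ} (hx : (σ x).truthy = false) :
    Tri W f (.cond x p q) σ Q ↔ Tri W f q σ fun σ' t => Q σ' (t + 1) := by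
  constructor
  · rintro ⟨σ', t, m, h, hq⟩
    cases h with
    | cond_true h' _ => simp [hx] at h'
    | cond_false _ h => exact ⟨_, _, _, h, hq⟩
  · rintro ⟨σ', t, m, h, hq⟩
    exact ⟨_, _, _, .cond_false hx h, hq⟩

theorem tri_nil : Tri W f (Prog.block []) σ Q ↔ Q σ 1 := tri_skip

theorem tri_cons {l : List Prog} :
    Tri W f (Prog.block (p :: l)) σ Q ↔
      Tri W f p σ fun σ₁ t₁ => Tri W f (Prog.block l) σ₁ fun σ₂ t₂ => Q σ₂ (t₁ + t₂) :=
  tri_seq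

theorem tri_call {x y : ℕ} {g : Prog} :
    Tri W f (.call x g y) σ Q ↔
      RetQ W g (σ y) fun b t => Q (Function.update σ x b) (t + 1) := by
  constructor
  · rintro ⟨σ', t, m, h, hq⟩
    cases h with
    | call h => exact ⟨_, _, _, ⟨_, h, rfl⟩, hq⟩
  · rintro ⟨b, t, m, ⟨τ, h, rfl⟩, hq⟩
    exact ⟨_, _, _, .call h, hq⟩

theorem tri_recur {x y : ℕ} :
    Tri W f (.recur x y) σ Q ↔
      RetQ W f (σ y) fun b t => Q (Function.update σ x b) (t + 1) := by
  constructor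
  · rintro ⟨σ', t, m, h, hq⟩
    cases h with
    | recur h => exact ⟨_, _, _, ⟨_, h, rfl⟩, hq⟩
  · rintro ⟨b, t, m, ⟨τ, h, rfl⟩, hq⟩
    exact ⟨_, _, _, .recur h, hq⟩

theorem Tri.loop_done {x : ℕ} (hx : (σ x).truthy = false) (hq : Q σ 1) :
    Tri W f (.loop x p) σ Q :=
  ⟨_, _, _, .loop_done hx, hq⟩

theorem Tri.loop_step {x : ℕ} (hx : (σ x).truthy = true)
    (h : Tri W f p σ fun σ₁ t₁ => Tri W f (.loop x p) σ₁ fun σ₂ t₂ => Q σ₂ (t₁ + t₂ + 1)) :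
    Tri W f (.loop x p) σ Q := by
  obtain ⟨σ₁, t₁, m₁, h₁, σ₂, t₂, m₂, h₂, hq⟩ := h
  exact ⟨_, _, _, .loop_step hx h₁ h₂, hq⟩

theorem Exec.comparisons_le {σ' : ℕ → Val V} {t m : ℕ} (h : Exec W f p σ σ' t m) : m ≤ t := by
  induction h with
  | skip => exact Nat.zero_le _
  | assign f σ x e => cases e <;> simp [Rhs.comparisons]
  | seq _ _ h₁ h₂ => omega
  | cond_true _ _ h => omega
  | cond_false _ _ h => omega
  | loop_done => exact Nat.zero_le _
  | loop_step _ _ _ h₁ h₂ => omega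
  | call _ h => omega
  | recur _ h => omega

theorem initRegs_apply (a : Val V) (n : ℕ) : initRegs a n = if n = 0 then a else .num 0 := by
  cases n <;> simp [initRegs]

@[congr] theorem Tri.congr_regs {τ : ℕ → Val V} (h : σ = τ) : Tri W f p σ Q = Tri W f p τ Q := by
  rw [h]

@[congr] theorem RetQ.congr_arg {b : Val V} (h : a = b) : RetQ W f a R = RetQ W f b R := by
  rw [h]

attribute [simp] tri_skip tri_assign tri_seq tri_cond_true tri_cond_false tri_call tri_recur
  tri_nil tri_cons initRegs_apply Rhs.eval Val.ofList

@[simp] theorem Val.truthy_zero : (Val.num 0 : Val V).truthy = false := rfl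
@[simp] theorem Val.truthy_succ (n : ℕ) : (Val.num (n + 1) : Val V).truthy = true := rfl
@[simp] theorem Val.truthy_one : (Val.num 1 : Val V).truthy = true := rfl
@[simp] theorem Val.truthy_item (v : V) : (Val.item v).truthy = true := rfl
@[simp] theorem Val.truthy_pair (x y : Val V) : (Val.pair x y).truthy = true := rfl

end Logic

/-! ## Bags -/

/-- Catenable multisets of items. -/
inductive Bag (V : Type*) where
  | nil
  | cons (v : V) (b : Bag V)
  | join (a b : Bag V)

namespace Bag

variable {V : Type*}

-- Two of the constructors become pairs. They are told apart by the first component, which is an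
-- item only for `cons`.
@[simp] def enc : Bag V → Val V
  | nil => .num 0
  | cons v b => .pair (.item v) (enc b)
  | join a b => .pair (enc a) (enc b)

/-- The items in a bag. -/
def ms : Bag V → Multiset V
  | nil => 0
  | cons v b => v ::ₘ ms b
  | join a b => ms a + ms b

/-- The number of cells of a bag. -/
def sz : Bag V → ℕ
  | nil => 1
  | cons _ b => 1 + sz b
  | join a b => 1 + sz a + sz b

/-- The number of cells that have to be visited to bring all items to the spine of a bag. -/
def pot : Bag V → ℕ
  | nil => 0
  | cons _ b => pot b
  | join a b => sz a + pot b

theorem pot_le_sz (b : Bag V) : b.pot ≤ b.sz := by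
  induction b with
  | nil => simp [pot, sz]
  | cons v b ih => simp only [pot, sz]; omega
  | join a b _ ih => simp only [pot, sz]; omega

theorem card_ms_le_sz (b : Bag V) : Multiset.card b.ms ≤ b.sz := by
  induction b with
  | nil => simp [ms, sz]
  | cons v b ih => simp only [ms, sz, Multiset.card_cons]; omega
  | join a b iha ihb => simp only [ms, sz, Multiset.card_add]; omega

end Bag

/-! ### Rotating and flattening bags -/

namespace SoftSeq

/-- Rotates a bag until its first item is at the front. -/
def normP : Prog :=
  .cond 0 (.block [
    .assign 1 (.head 0), .assign 2 (.compare 1 1),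
    .cond 2 .skip (.seq
      (.cond 1
        (.block [.assign 3 (.tail 0), .assign 4 (.head 1), .assign 5 (.tail 1),
          .assign 5 (.pair 5 3), .assign 0 (.pair 4 5)])
        (.assign 0 (.tail 0)))
      (.recur 0 0))]) .skip

/-- Puts the items of a bag in front of a list. -/
def flatP : Prog :=
  .block [.assign 1 (.head 0), .assign 0 (.tail 0),
    .cond 1
      (.block [.assign 2 (.head 1), .assign 1 (.tail 1), .assign 3 (.compare 2 2),
        .cond 3 (.assign 0 (.pair 2 0)) (.seq (.assign 2 (.pair 2 0)) (.recur 0 2)),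
        .assign 1 (.pair 1 0), .recur 0 1])
      .skip]

section

variable {V α : Type*} [LinearOrder α] (W : Items V α)

/-- Comparing a value with itself gives 1 exactly for items, which distinguishes `cons` from `join`.
Each recursive call lowers `pot` by one, and this pays for it. -/
theorem normP_spec (b : Bag V) :
    RetQ W normP b.enc fun r t => ∃ b' : Bag V, r = b'.enc ∧ b'.ms = b.ms ∧ b'.sz ≤ b.sz ∧
      (b' = .nil ∨ ∃ v c, b' = .cons v c) ∧ t + 20 * b'.pot ≤ 20 + 20 * b.pot := by
  induction hn : b.pot using Nat.strong_induction_on generalizing b with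
  | _ n ih =>
  refine RetQ.of_body normP.eq_1 ?_
  match b with
  | .nil =>
    simp
    exact Post.intro ⟨.nil, by simp [Bag.ms, Bag.pot]; omega⟩
  | .cons v b =>
    simp
    exact Post.intro ⟨.cons v b, by simp [Bag.enc]; omega⟩
  | .join .nil b =>
    simp
    refine (ih b.pot (by simp [Bag.pot, Bag.sz] at hn; omega) b rfl).mono ?_
    rintro r t ⟨b', rfl, h1, h2, h3, h4⟩
    refine Post.intro ⟨b', rfl, by simp [h1, Bag.ms], by simp [Bag.sz]; omega, h3, ?_⟩
    simp [Bag.pot, Bag.sz] at hn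
    omega
  | .join (.cons v a) b =>
    simp
    refine (ih (Bag.cons v (.join a b)).pot (by simp [Bag.pot, Bag.sz] at hn ⊢; omega)
      (.cons v (.join a b)) rfl).mono ?_
    rintro r t ⟨b', rfl, h1, h2, h3, h4⟩
    refine Post.intro ⟨b', rfl, by simp [h1, Bag.ms], by simp [Bag.sz] at h2 ⊢; omega, h3, ?_⟩
    simp [Bag.pot, Bag.sz] at hn h4
    omega
  | .join (.join a₁ a₂) b =>
    simp
    refine (ih (Bag.join a₁ (.join a₂ b)).pot (by simp [Bag.pot, Bag.sz] at hn ⊢; omega)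
      (.join a₁ (.join a₂ b)) rfl).mono ?_
    rintro r t ⟨b', rfl, h1, h2, h3, h4⟩
    refine Post.intro ⟨b', rfl, by simp [h1, Bag.ms, add_assoc],
      by simp [Bag.sz] at h2 ⊢; omega, h3, ?_⟩
    simp [Bag.pot, Bag.sz] at hn h4
    omega

theorem flatP_spec (b : Bag V) (l : List V) :
    RetQ W flatP (.pair b.enc (.ofList l)) fun r t => ∃ l' : List V, r = .ofList (l' ++ l) ∧
      (l' : Multiset V) = b.ms ∧ t ≤ 20 * b.sz := by
  induction b generalizing l with
  | nil =>
    refine RetQ.of_body flatP.eq_1 ?_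
    simp
    exact Post.intro ⟨[], by simp [Bag.ms, Bag.sz]⟩
  | cons v b ih =>
    refine RetQ.of_body flatP.eq_1 ?_
    simp
    refine (ih (v :: l)).mono ?_
    rintro r t ⟨l', rfl, h1, h2⟩
    refine Post.intro ⟨l' ++ [v], by simp, ?_, by simp [Bag.sz]; omega⟩
    rw [← Multiset.coe_add, h1, Bag.ms, add_comm]
    rfl
  | join a b iha ihb =>
    refine RetQ.of_body flatP.eq_1 ?_
    -- The first component of a join encodes a bag, never an item, so the self-comparison fails.
    have hc : Rhs.eval W (fun _ => a.enc) (.compare 2 2) = .num 0 := by cases a <;> rfl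
    simp [Rhs.eval] at hc
    simp [hc]
    refine (iha l).mono ?_
    rintro r t ⟨l₁, rfl, h1, h2⟩
    refine (ihb (l₁ ++ l)).mono ?_
    rintro r t ⟨l₂, rfl, h3, h4⟩
    refine Post.intro ⟨l₂ ++ l₁, by simp, ?_, by simp [Bag.sz]; omega⟩
    rw [← Multiset.coe_add, h1, h3, Bag.ms, add_comm]

end

/-! ## Sequences of nodes -/

/-- An element of a sequence.  The key of the item `c` bounds the keys of the items in `T` and `K`;
the items in `T` have exactly this key.  The items in `W` become corrupt when the node dies. -/
structure Nd (V : Type*) where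
  c : V
  T : Bag V
  K : Bag V
  W : Bag V

section

variable {V α : Type*}

def Nd.enc (n : Nd V) : Val V :=
  .pair (.item n.c) (.pair n.T.enc (.pair n.K.enc n.W.enc))

/-- The encoding of a list, given an encoding of its entries. -/
@[simp] def encList {β : Type*} (enc : β → Val V) : List β → Val V
  | [] => .num 0
  | b :: l => .pair (enc b) (encList enc l)

variable [LinearOrder α]

def mergeSeq (key : V → α) : List (Nd V) → List (Nd V) → List (Nd V)
  | [], l => l
  | a :: l, [] => a :: l
  | a :: l, b :: m =>
    if key a.c ≤ key b.c then a :: mergeSeq key l (b :: m) else b :: mergeSeq key (a :: l) m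
  termination_by l m => l.length + m.length

/-- Removes about every second node; its items go to the next node, and those of them whose
current key will have to be raised become witnessed by the previous node. -/
def prune (key : V → α) : List (Nd V) → List (Nd V)
  | n₁ :: n₂ :: n₃ :: l =>
    if key n₃.c ≤ key n₂.c then
      { n₁ with W := .join n₁.W n₂.W } ::
        prune key ({ n₃ with T := .join n₂.T n₃.T, K := .join n₂.K n₃.K } :: l)
    else
      { n₁ with W := .join n₁.W (.join n₂.W n₂.T) } ::
        prune key ({ n₃ with K := .join n₂.T (.join n₂.K n₃.K) } :: l)
  | l => l
  termination_by l => l.length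

end

/-! ### Programs for merging and pruning -/

def mergeP : Prog :=
  .block [.assign 1 (.head 0), .assign 2 (.tail 0),
    .cond 1
      (.cond 2
        (.block [.assign 3 (.head 1), .assign 4 (.head 2), .assign 5 (.head 3), .assign 6 (.head 4),
          .assign 7 (.compare 5 6),
          .cond 7
            (.block [.assign 1 (.tail 1), .assign 1 (.pair 1 2), .recur 1 1, .assign 0 (.pair 3 1)])
            (.block [.assign 2 (.tail 2), .assign 1 (.pair 1 2), .recur 1 1,
              .assign 0 (.pair 4 1)])])
        (.assign 0 (.copy 1)))
      (.assign 0 (.copy 2))]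

def pruneP : Prog :=
  .block [.assign 1 (.tail 0), .assign 2 (.tail 1),
    .cond 2
      (.block [.assign 0 (.head 0), .assign 1 (.head 1), .assign 3 (.head 2), .assign 2 (.tail 2),
        .assign 4 (.head 1), .assign 1 (.tail 1), .assign 5 (.head 1), .assign 1 (.tail 1),
        .assign 6 (.head 1), .assign 7 (.tail 1),
        .assign 8 (.head 3), .assign 3 (.tail 3), .assign 9 (.head 3), .assign 3 (.tail 3),
        .assign 10 (.head 3), .assign 11 (.tail 3),
        .assign 12 (.head 0), .assign 0 (.tail 0), .assign 13 (.head 0), .assign 0 (.tail 0),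
        .assign 14 (.head 0), .assign 15 (.tail 0),
        .assign 10 (.pair 6 10), .assign 16 (.compare 8 4),
        .cond 16
          (.seq (.assign 9 (.pair 5 9)) (.assign 15 (.pair 15 7)))
          (.block [.assign 10 (.pair 5 10), .assign 7 (.pair 7 5), .assign 15 (.pair 15 7)]),
        .assign 10 (.pair 10 11), .assign 9 (.pair 9 10), .assign 8 (.pair 8 9),
        .assign 2 (.pair 8 2), .recur 2 2,
        .assign 14 (.pair 14 15), .assign 13 (.pair 13 14), .assign 12 (.pair 12 13),
        .assign 0 (.pair 12 2)])
      .skip]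

section

variable {V α : Type*} [LinearOrder α] (W : Items V α)

theorem mergeP_spec (l m : List (Nd V)) :
    RetQ W mergeP (.pair (encList Nd.enc l) (encList Nd.enc m)) fun r t =>
      r = encList Nd.enc (mergeSeq W.key l m) ∧ t ≤ 30 * (l.length + m.length + 1) := by
  induction l, m using mergeSeq.induct W.key with
  | case1 m =>
    refine RetQ.of_body mergeP.eq_1 ?_
    simp
    exact Post.intro ⟨by simp [mergeSeq], by omega⟩
  | case2 a l =>
    refine RetQ.of_body mergeP.eq_1 ?_
    simp
    exact Post.intro ⟨by simp [mergeSeq], by omega⟩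
  | case3 a l b m h ih =>
    refine RetQ.of_body mergeP.eq_1 ?_
    simp [Nd.enc, h]
    refine ih.mono ?_
    rintro r t ⟨rfl, ht⟩
    refine Post.intro ⟨by rw [mergeSeq, if_pos h]; rfl, ?_⟩
    simp at ht ⊢
    omega
  | case4 a l b m h ih =>
    refine RetQ.of_body mergeP.eq_1 ?_
    simp [Nd.enc, h]
    refine ih.mono ?_
    rintro r t ⟨rfl, ht⟩
    refine Post.intro ⟨by rw [mergeSeq, if_neg h]; rfl, ?_⟩
    simp at ht ⊢
    omega

set_option maxHeartbeats 1000000 in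
theorem pruneP_spec (l : List (Nd V)) :
    RetQ W pruneP (encList Nd.enc l) fun r t =>
      r = encList Nd.enc (prune W.key l) ∧ t ≤ 60 * (l.length + 1) := by
  induction l using prune.induct W.key with
  | case1 n₁ n₂ n₃ l h ih =>
    refine RetQ.of_body pruneP.eq_1 ?_
    simp [Nd.enc, h]
    refine ih.mono ?_
    rintro r t ⟨rfl, ht⟩
    refine Post.intro ⟨by rw [prune, if_pos h]; rfl, ?_⟩
    simp at ht ⊢
    omega
  | case2 n₁ n₂ n₃ l h ih =>
    refine RetQ.of_body pruneP.eq_1 ?_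
    simp [Nd.enc, h]
    refine ih.mono ?_
    rintro r t ⟨rfl, ht⟩
    refine Post.intro ⟨by rw [prune, if_neg h]; rfl, ?_⟩
    simp at ht ⊢
    omega
  | case3 l h =>
    match l with
    | [] | [_] | [_, _] =>
      refine RetQ.of_body pruneP.eq_1 ?_
      simp
      exact Post.intro ⟨by simp [prune], by simp⟩
    | n₁ :: n₂ :: n₃ :: l => exact (h n₁ n₂ n₃ l rfl).elim

end

/-! ## Invariants of sequences -/

section

variable {V α : Type*}

def ttot (l : List (Nd V)) : Multiset V := (l.map fun n => n.T.ms).sum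
def ktot (l : List (Nd V)) : Multiset V := (l.map fun n => n.K.ms).sum
def wtot (l : List (Nd V)) : Multiset V := (l.map fun n => n.W.ms).sum

@[simp] theorem ttot_nil : ttot ([] : List (Nd V)) = 0 := rfl
@[simp] theorem ktot_nil : ktot ([] : List (Nd V)) = 0 := rfl
@[simp] theorem wtot_nil : wtot ([] : List (Nd V)) = 0 := rfl
@[simp] theorem ttot_cons (n : Nd V) (l : List (Nd V)) : ttot (n :: l) = n.T.ms + ttot l := by
  simp [ttot]
@[simp] theorem ktot_cons (n : Nd V) (l : List (Nd V)) : ktot (n :: l) = n.K.ms + ktot l := by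
  simp [ktot]
@[simp] theorem wtot_cons (n : Nd V) (l : List (Nd V)) : wtot (n :: l) = n.W.ms + wtot l := by
  simp [wtot]
@[simp] theorem ttot_append (l m : List (Nd V)) : ttot (l ++ m) = ttot l + ttot m := by
  simp [ttot]
@[simp] theorem ktot_append (l m : List (Nd V)) : ktot (l ++ m) = ktot l + ktot m := by
  simp [ktot]
@[simp] theorem wtot_append (l m : List (Nd V)) : wtot (l ++ m) = wtot l + wtot m := by
  simp [wtot]

theorem ttot_perm {l m : List (Nd V)} (h : l.Perm m) : ttot l = ttot m := (h.map _).sum_eq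
theorem ktot_perm {l m : List (Nd V)} (h : l.Perm m) : ktot l = ktot m := (h.map _).sum_eq
theorem wtot_perm {l m : List (Nd V)} (h : l.Perm m) : wtot l = wtot m := (h.map _).sum_eq

theorem mem_ktot {l : List (Nd V)} {x : V} : x ∈ ktot l ↔ ∃ n ∈ l, x ∈ n.K.ms := by
  induction l with
  | nil => simp
  | cons n l ih => simp [ih]

theorem mem_wtot {l : List (Nd V)} {x : V} : x ∈ wtot l ↔ ∃ n ∈ l, x ∈ n.W.ms := by
  induction l with
  | nil => simp
  | cons n l ih => simp [ih]

theorem mem_ttot {l : List (Nd V)} {x : V} : x ∈ ttot l ↔ ∃ n ∈ l, x ∈ n.T.ms := by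
  induction l with
  | nil => simp
  | cons n l ih => simp [ih]

/-- The items in `K` satisfy `P` or are witnessed by an earlier node. -/
def Adm (P : V → Prop) : List (Nd V) → Prop
  | [] => True
  | n :: l => (∀ x ∈ n.K.ms, P x) ∧ Adm (fun x => P x ∨ x ∈ n.W.ms) l

theorem Adm.mono {P Q : V → Prop} {l : List (Nd V)} (h : Adm P l)
    (hPQ : ∀ x ∈ ktot l, P x → Q x) : Adm Q l := by
  induction l generalizing P Q with
  | nil => trivial
  | cons n l ih =>
    refine ⟨fun x hx => hPQ x (by simp [hx]) (h.1 x hx), ih h.2 ?_⟩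
    rintro x hx (hp | hw)
    · exact .inl (hPQ x (by simp [hx]) hp)
    · exact .inr hw

/-- In every suffix of the sequence, at most `M` items of `K` have no witness in this suffix. -/
def Dle (M : ℕ) : List (Nd V) → Prop
  | [] => True
  | n :: l => Multiset.card (ktot (n :: l)) ≤ M + Multiset.card (wtot (n :: l)) ∧ Dle M l

theorem Dle.mono {M N : ℕ} (hMN : M ≤ N) {l : List (Nd V)} (h : Dle M l) : Dle N l := by
  induction l with
  | nil => trivial
  | cons n l ih => exact ⟨h.1.trans (by omega), ih h.2⟩

theorem Dle.card_le {M : ℕ} {l : List (Nd V)} (h : Dle M l) :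
    Multiset.card (ktot l) ≤ M + Multiset.card (wtot l) := by
  cases l with
  | nil => simp
  | cons n l => exact h.1

variable [LinearOrder α] {key cur : V → α}

/-- Items of `T` are never corrupt. Items of `K` lie strictly below the node key, so raising them to
it makes them corrupt. With `lo` the key of the head of the sequence, `K_lo` is what makes the items
of the head minimal, and `W_key` is what preserves `K_lo` for witnessed items when heads die. -/
structure NdInv (key cur : V → α) (lo : α) (n : Nd V) : Prop where
  le_key : lo ≤ key n.c
  T_ne : n.T.ms ≠ 0
  T_key : ∀ x ∈ n.T.ms, key x = key n.c
  T_cur : ∀ x ∈ n.T.ms, cur x = key n.c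
  K_lt : ∀ x ∈ n.K.ms, key x < key n.c
  K_le : ∀ x ∈ n.K.ms, key x ≤ cur x
  K_lo : ∀ x ∈ n.K.ms, lo ≤ cur x
  K_cur : ∀ x ∈ n.K.ms, cur x ≤ key n.c
  W_key : ∀ x ∈ n.W.ms, key n.c ≤ key x
  W_cur : ∀ x ∈ n.W.ms, cur x = key x

theorem NdInv.mono {lo lo' : α} {n : Nd V} (h : NdInv key cur lo n) (hl : lo' ≤ lo) :
    NdInv key cur lo' n :=
  { h with le_key := hl.trans h.le_key, K_lo := fun x hx => hl.trans (h.K_lo x hx) }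

def SzLe (w : ℕ) (n : Nd V) : Prop := n.T.sz ≤ w ∧ n.K.sz ≤ w ∧ n.W.sz ≤ w

/-- As items of a heap are distinct, `wit` also says that no item has two witnesses. By `adm` an
item of `K` is corrupt or has its witness strictly earlier in the sequence. -/
structure SeqInv (key cur : V → α) (w M len : ℕ) (lo : α) (l : List (Nd V)) : Prop where
  sorted : l.Pairwise fun a b => key a.c ≤ key b.c
  node : ∀ n ∈ l, NdInv key cur lo n
  size : ∀ n ∈ l, SzLe w n
  length_le : l.length ≤ len
  dle : Dle M l
  wit : wtot l ≤ ktot l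
  adm : Adm (fun x => key x < cur x) l

/-! ### Merging -/

theorem mergeSeq_perm (l m : List (Nd V)) : (mergeSeq key l m).Perm (l ++ m) := by
  induction l, m using mergeSeq.induct key with
  | case1 m => simp [mergeSeq]
  | case2 a l => simp [mergeSeq]
  | case3 a l b m h ih =>
    rw [mergeSeq, if_pos h]
    exact ih.cons a
  | case4 a l b m h ih =>
    rw [mergeSeq, if_neg h]
    exact (ih.cons b).trans (List.perm_middle.symm)

theorem mergeSeq_sorted (l m : List (Nd V)) (hl : l.Pairwise fun a b => key a.c ≤ key b.c)
    (hm : m.Pairwise fun a b => key a.c ≤ key b.c) :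
    (mergeSeq key l m).Pairwise fun a b => key a.c ≤ key b.c := by
  induction l, m using mergeSeq.induct key with
  | case1 m => simpa [mergeSeq] using hm
  | case2 a l => simpa [mergeSeq] using hl
  | case3 a l b m h ih =>
    rw [mergeSeq, if_pos h]
    refine List.pairwise_cons.2 ⟨fun x hx => ?_, ih hl.of_cons hm⟩
    rw [(mergeSeq_perm _ _).mem_iff, List.mem_append, List.mem_cons] at hx
    rcases hx with hx | rfl | hx
    · exact List.rel_of_pairwise_cons hl hx
    · exact h
    · exact h.trans (List.rel_of_pairwise_cons hm hx)
  | case4 a l b m h ih =>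
    rw [mergeSeq, if_neg h]
    have h' := (not_le.1 h).le
    refine List.pairwise_cons.2 ⟨fun x hx => ?_, ih hl hm.of_cons⟩
    rw [(mergeSeq_perm _ _).mem_iff, List.mem_append, List.mem_cons] at hx
    rcases hx with (rfl | hx) | hx
    · exact h'
    · exact h'.trans (List.rel_of_pairwise_cons hl hx)
    · exact List.rel_of_pairwise_cons hm hx

/-- Merging preserves the order within each list, so witnesses still precede their items. -/
theorem Adm.mergeSeq {P Q : V → Prop} {l m : List (Nd V)} (hl : Adm P l) (hm : Adm Q m) :
    Adm (fun x => P x ∨ Q x) (mergeSeq key l m) := by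
  induction l, m using mergeSeq.induct key generalizing P Q with
  | case1 m =>
    rw [SoftSeq.mergeSeq]
    exact hm.mono fun x _ h => .inr h
  | case2 a l =>
    rw [SoftSeq.mergeSeq]
    exact hl.mono fun x _ h => .inl h
  | case3 a l b m h ih =>
    rw [SoftSeq.mergeSeq, if_pos h]
    exact ⟨fun x hx => .inl (hl.1 x hx), (ih hl.2 hm).mono fun x _ h => by tauto⟩
  | case4 a l b m h ih =>
    rw [SoftSeq.mergeSeq, if_neg h]
    exact ⟨fun x hx => .inr (hm.1 x hx), (ih hl hm.2).mono fun x _ h => by tauto⟩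

/-- A suffix of the merged list is a merge of two suffixes, so the two bounds add up. -/
theorem Dle.mergeSeq {M N : ℕ} {l m : List (Nd V)} (hl : Dle M l) (hm : Dle N m) :
    Dle (M + N) (mergeSeq key l m) := by
  induction l, m using mergeSeq.induct key with
  | case1 m =>
    rw [SoftSeq.mergeSeq]
    exact hm.mono (by omega)
  | case2 a l =>
    rw [SoftSeq.mergeSeq]
    exact hl.mono (by omega)
  | case3 a l b m h ih =>
    rw [SoftSeq.mergeSeq, if_pos h]
    refine ⟨?_, ih hl.2 hm⟩
    have h1 := hl.1
    have h2 := hm.1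
    simp only [ktot_cons, wtot_cons, ktot_perm (mergeSeq_perm _ _), wtot_perm (mergeSeq_perm _ _),
      ktot_append, wtot_append, Multiset.card_add] at h1 h2 ⊢
    omega
  | case4 a l b m h ih =>
    rw [SoftSeq.mergeSeq, if_neg h]
    refine ⟨?_, ih hl hm.2⟩
    have h1 := hl.1
    have h2 := hm.1
    simp only [ktot_cons, wtot_cons, ktot_perm (mergeSeq_perm _ _), wtot_perm (mergeSeq_perm _ _),
      ktot_append, wtot_append, Multiset.card_add] at h1 h2 ⊢
    omega

theorem SeqInv.mergeSeq {w M len : ℕ} {lo : α} {l m : List (Nd V)}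
    (hl : SeqInv key cur w M len lo l) (hm : SeqInv key cur w M len lo m) :
    SeqInv key cur w (2 * M) (2 * len) lo (mergeSeq key l m) where
  sorted := mergeSeq_sorted l m hl.sorted hm.sorted
  node n hn := by
    rw [(mergeSeq_perm _ _).mem_iff, List.mem_append] at hn
    exact hn.elim (hl.node n) (hm.node n)
  size n hn := by
    rw [(mergeSeq_perm _ _).mem_iff, List.mem_append] at hn
    exact hn.elim (hl.size n) (hm.size n)
  length_le := by
    rw [(mergeSeq_perm l m).length_eq, List.length_append]
    have := hl.length_le
    have := hm.length_le
    omega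
  dle := two_mul M ▸ hl.dle.mergeSeq hm.dle
  wit := by
    simp only [ktot_perm (mergeSeq_perm _ _), wtot_perm (mergeSeq_perm _ _), ktot_append,
      wtot_append]
    exact add_le_add hl.wit hm.wit
  adm := (hl.adm.mergeSeq hm.adm).mono fun x _ h => h.elim id id

/-! ### Pruning -/

theorem prune_items (l : List (Nd V)) :
    ttot (prune key l) + ktot (prune key l) = ttot l + ktot l := by
  induction l using prune.induct key with
  | case1 n₁ n₂ n₃ l h ih =>
    rw [prune, if_pos h]
    simp only [ttot_cons, ktot_cons, Bag.ms] at ih ⊢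
    calc _ = n₁.T.ms + n₁.K.ms + (ttot (prune key _) + ktot (prune key _)) := by abel
      _ = _ := by rw [ih]; abel
  | case2 n₁ n₂ n₃ l h ih =>
    rw [prune, if_neg h]
    simp only [ttot_cons, ktot_cons, Bag.ms] at ih ⊢
    calc _ = n₁.T.ms + n₁.K.ms + (ttot (prune key _) + ktot (prune key _)) := by abel
      _ = _ := by rw [ih]; abel
  | case3 l h => rw [prune]; exact h

/-- `X` collects the items that go from a `T` to a `K`: exactly these get a new witness. So the
excess of `K` over `W` in the whole list does not change. -/
theorem prune_wit (l : List (Nd V)) :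
    ∃ X, wtot (prune key l) = wtot l + X ∧ ktot (prune key l) = ktot l + X := by
  induction l using prune.induct key with
  | case1 n₁ n₂ n₃ l h ih =>
    obtain ⟨X, h1, h2⟩ := ih
    refine ⟨X, ?_, ?_⟩
    · rw [prune, if_pos h, wtot_cons, h1]
      simp only [wtot_cons, Bag.ms]
      abel
    · rw [prune, if_pos h, ktot_cons, h2]
      simp only [ktot_cons, Bag.ms]
      abel
  | case2 n₁ n₂ n₃ l h ih =>
    obtain ⟨X, h1, h2⟩ := ih
    refine ⟨X + n₂.T.ms, ?_, ?_⟩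
    · rw [prune, if_neg h, wtot_cons, h1]
      simp only [wtot_cons, Bag.ms]
      abel
    · rw [prune, if_neg h, ktot_cons, h2]
      simp only [ktot_cons, Bag.ms]
      abel
  | case3 l h => 
    have hp : prune key l = l := by rw [prune]; exact h
    exact ⟨0, by simp [hp], by simp [hp]⟩

theorem length_prune (l : List (Nd V)) : 2 * (prune key l).length ≤ l.length + 2 := by
  induction l using prune.induct key with
  | case1 n₁ n₂ n₃ l h ih =>
    rw [prune, if_pos h]
    simp only [List.length_cons] at ih ⊢
    omega
  | case2 n₁ n₂ n₃ l h ih =>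
    rw [prune, if_neg h]
    simp only [List.length_cons] at ih ⊢
    omega
  | case3 l h =>
    match l with
    | [] | [_] | [_, _] => simp [prune]
    | n₁ :: n₂ :: n₃ :: l => exact (h n₁ n₂ n₃ l rfl).elim

theorem prune_map_sublist (l : List (Nd V)) :
    ((prune key l).map Nd.c).Sublist (l.map Nd.c) := by
  induction l using prune.induct key with
  | case1 n₁ n₂ n₃ l h ih =>
    rw [prune, if_pos h]
    exact (ih.cons _).cons_cons _
  | case2 n₁ n₂ n₃ l h ih =>
    rw [prune, if_neg h]
    exact (ih.cons _).cons_cons _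
  | case3 l h => rw [prune]; exact h

theorem prune_sorted {l : List (Nd V)} (hl : l.Pairwise fun a b => key a.c ≤ key b.c) :
    (prune key l).Pairwise fun a b => key a.c ≤ key b.c := by
  have h : (l.map Nd.c).Pairwise fun a b => key a ≤ key b := List.pairwise_map.2 hl
  have h' : ((prune key l).map Nd.c).Pairwise fun a b => key a ≤ key b :=
    h.sublist (prune_map_sublist l)
  exact (List.pairwise_map (R := fun a b => key a ≤ key b)).1 h'

/-- Witnesses are handed to `n₁`, which still precedes the node `n₃` that receives the items. -/
theorem Adm.prune {P : V → Prop} {l : List (Nd V)} (hl : Adm P l) : Adm P (prune key l) := by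
  induction l using prune.induct key generalizing P with
  | case1 n₁ n₂ n₃ l h ih =>
    rw [SoftSeq.prune, if_pos h]
    obtain ⟨h1, h2, h3, h4⟩ := hl
    refine ⟨h1, ih ⟨fun x hx => ?_, h4.mono fun x _ h => ?_⟩⟩
    · simp only [Bag.ms, Multiset.mem_add] at hx ⊢
      rcases hx with hx | hx
      · have := h2 x hx; tauto
      · have := h3 x hx; tauto
    · simp only [Bag.ms, Multiset.mem_add] at h ⊢
      tauto
  | case2 n₁ n₂ n₃ l h ih =>
    rw [SoftSeq.prune, if_neg h]
    obtain ⟨h1, h2, h3, h4⟩ := hl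
    refine ⟨h1, ih ⟨fun x hx => ?_, h4.mono fun x _ h => ?_⟩⟩
    · simp only [Bag.ms, Multiset.mem_add] at hx ⊢
      rcases hx with hx | hx | hx
      · tauto
      · have := h2 x hx; tauto
      · have := h3 x hx; tauto
    · simp only [Bag.ms, Multiset.mem_add] at h ⊢
      tauto
  | case3 l h => rw [SoftSeq.prune]; exact hl; exact h

theorem NdInv.prune {lo : α} {l : List (Nd V)} (hs : l.Pairwise fun a b => key a.c ≤ key b.c)
    (hl : ∀ n ∈ l, NdInv key cur lo n) : ∀ n ∈ prune key l, NdInv key cur lo n := by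
  induction l using prune.induct key with
  | case1 n₁ n₂ n₃ l h ih =>
    rw [SoftSeq.prune, if_pos h]
    simp only [List.pairwise_cons, List.forall_mem_cons] at hs hl
    obtain ⟨⟨h12, -, -⟩, ⟨h23, -⟩, h3, hs⟩ := hs
    obtain ⟨H1, H2, H3, Hl⟩ := hl
    -- Sortedness forces equal keys in this branch, so the items of `n₂.T` may join `n₃.T` without
    -- ever becoming corrupt.
    have e := le_antisymm h23 h
    refine List.forall_mem_cons.2 ⟨{ H1 with W_key := ?_, W_cur := ?_ }, ih ?_ ?_⟩
    · simp only [Bag.ms, Multiset.mem_add]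
      exact fun x hx => hx.elim (H1.W_key x) fun hx => h12.trans (H2.W_key x hx)
    · simp only [Bag.ms, Multiset.mem_add]
      exact fun x hx => hx.elim (H1.W_cur x) (H2.W_cur x)
    · exact List.pairwise_cons.2 ⟨h3, hs⟩
    · refine List.forall_mem_cons.2 ⟨{ H3 with
          T_ne := ?_, T_key := ?_, T_cur := ?_, K_lt := ?_, K_le := ?_, K_lo := ?_, K_cur := ?_ },
        Hl⟩ <;> simp only [Bag.ms, Multiset.mem_add, ne_eq, add_eq_zero, not_and_or]
      · exact .inl H2.T_ne
      · exact fun x hx => hx.elim (fun hx => (H2.T_key x hx).trans e) (H3.T_key x)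
      · exact fun x hx => hx.elim (fun hx => (H2.T_cur x hx).trans e) (H3.T_cur x)
      · exact fun x hx => hx.elim (fun hx => (H2.K_lt x hx).trans_le h23) (H3.K_lt x)
      · exact fun x hx => hx.elim (H2.K_le x) (H3.K_le x)
      · exact fun x hx => hx.elim (H2.K_lo x) (H3.K_lo x)
      · exact fun x hx => hx.elim (fun hx => (H2.K_cur x hx).trans h23) (H3.K_cur x)
  | case2 n₁ n₂ n₃ l h ih =>
    rw [SoftSeq.prune, if_neg h]
    simp only [List.pairwise_cons, List.forall_mem_cons] at hs hl
    obtain ⟨⟨h12, -, -⟩, ⟨h23, -⟩, h3, hs⟩ := hs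
    obtain ⟨H1, H2, H3, Hl⟩ := hl
    rw [not_le] at h
    refine List.forall_mem_cons.2 ⟨{ H1 with W_key := ?_, W_cur := ?_ }, ih ?_ ?_⟩
    · simp only [Bag.ms, Multiset.mem_add]
      rintro x (hx | hx | hx)
      exacts [H1.W_key x hx, h12.trans (H2.W_key x hx), h12.trans (H2.T_key x hx).ge]
    · simp only [Bag.ms, Multiset.mem_add]
      rintro x (hx | hx | hx)
      exacts [H1.W_cur x hx, H2.W_cur x hx, (H2.T_cur x hx).trans (H2.T_key x hx).symm]
    · exact List.pairwise_cons.2 ⟨h3, hs⟩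
    · refine List.forall_mem_cons.2 ⟨{ H3 with K_lt := ?_, K_le := ?_, K_lo := ?_, K_cur := ?_ },
        Hl⟩ <;> simp only [Bag.ms, Multiset.mem_add]
      · rintro x (hx | hx | hx)
        exacts [(H2.T_key x hx).trans_lt h, (H2.K_lt x hx).trans_le h23, H3.K_lt x hx]
      · rintro x (hx | hx | hx)
        exacts [((H2.T_key x hx).trans (H2.T_cur x hx).symm).le, H2.K_le x hx, H3.K_le x hx]
      · rintro x (hx | hx | hx)
        exacts [H2.le_key.trans (H2.T_cur x hx).ge, H2.K_lo x hx, H3.K_lo x hx]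
      · rintro x (hx | hx | hx)
        exacts [(H2.T_cur x hx).le.trans h23, (H2.K_cur x hx).trans h23, H3.K_cur x hx]
  | case3 l h => rw [SoftSeq.prune]; exact hl; exact h

/-- The head may already have absorbed the `T` and `K` of a deleted node, while its `W` is still
original; hence the separate bounds for head and tail. -/
theorem SzLe.prune {w : ℕ} {l : List (Nd V)}
    (hhd : ∀ n ∈ l.head?, n.T.sz ≤ 3 * w + 2 ∧ n.K.sz ≤ 3 * w + 2 ∧ n.W.sz ≤ w)
    (htl : ∀ n ∈ l.tail, SzLe w n) : ∀ n ∈ prune key l, SzLe (3 * w + 2) n := by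
  induction l using prune.induct key with
  | case1 n₁ n₂ n₃ l h ih =>
    rw [SoftSeq.prune, if_pos h]
    simp only [List.head?_cons, Option.mem_def, Option.some.injEq, forall_eq', List.tail_cons,
      List.forall_mem_cons, SzLe] at hhd htl ih
    refine List.forall_mem_cons.2 ⟨?_, ih ?_ htl.2.2⟩ <;> simp only [SzLe, Bag.sz] <;> omega
  | case2 n₁ n₂ n₃ l h ih =>
    rw [SoftSeq.prune, if_neg h]
    simp only [List.head?_cons, Option.mem_def, Option.some.injEq, forall_eq', List.tail_cons,
      List.forall_mem_cons, SzLe] at hhd htl ih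
    refine List.forall_mem_cons.2 ⟨?_, ih ?_ htl.2.2⟩ <;> simp only [SzLe, Bag.sz] <;> omega
  | case3 l h =>
    rw [SoftSeq.prune]
    · intro n hn
      cases l with
      | nil => simp at hn
      | cons a l =>
        rcases List.mem_cons.1 hn with rfl | hn
        · have := hhd n (by simp)
          simp only [SzLe]
          omega
        · have := htl n hn
          simp only [SzLe] at this ⊢
          omega
    · exact h

/-- For the suffix that begins with the enlarged `n₃`, compare with the old suffix at `n₂`: it can
gain the items of `n₂.T` and lose the witnesses in `n₂.W`, at most two bags. The comparison is
always with the old list, so the losses do not accumulate. -/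
theorem Dle.prune {w M N : ℕ} {l : List (Nd V)} (hMN : M + 2 * w ≤ N)
    (hhd : Multiset.card (ktot l) ≤ N + Multiset.card (wtot l)) (htl : Dle M l.tail)
    (hw : ∀ n ∈ l.tail, SzLe w n) : Dle N (prune key l) := by
  induction l using prune.induct key with
  | case1 n₁ n₂ n₃ l h ih =>
    obtain ⟨X, h1, h2⟩ := prune_wit (key := key) (n₁ :: n₂ :: n₃ :: l)
    have hd := congrArg Multiset.card h1
    have hk := congrArg Multiset.card h2
    rw [SoftSeq.prune, if_pos h] at hd hk ⊢
    obtain ⟨h3, h4, h5⟩ := htl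
    simp only [List.tail_cons, List.forall_mem_cons, SzLe] at hw ih
    refine ⟨?_, ih ?_ h5 hw.2.2⟩
    · rw [hd, hk, Multiset.card_add, Multiset.card_add]
      omega
    · have := n₂.W.card_ms_le_sz
      simp only [ktot_cons, wtot_cons, Multiset.card_add, Bag.ms] at h3 h4 ⊢
      omega
  | case2 n₁ n₂ n₃ l h ih =>
    obtain ⟨X, h1, h2⟩ := prune_wit (key := key) (n₁ :: n₂ :: n₃ :: l)
    have hd := congrArg Multiset.card h1
    have hk := congrArg Multiset.card h2
    rw [SoftSeq.prune, if_neg h] at hd hk ⊢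
    obtain ⟨h3, h4, h5⟩ := htl
    simp only [List.tail_cons, List.forall_mem_cons, SzLe] at hw ih
    refine ⟨?_, ih ?_ h5 hw.2.2⟩
    · rw [hd, hk, Multiset.card_add, Multiset.card_add]
      omega
    · have := n₂.W.card_ms_le_sz
      have := n₂.T.card_ms_le_sz
      simp only [ktot_cons, wtot_cons, Multiset.card_add, Bag.ms] at h3 h4 ⊢
      omega
  | case3 l h =>
    rw [SoftSeq.prune]
    · cases l with
      | nil => trivial
      | cons a l => exact ⟨hhd, htl.mono (by omega)⟩
    · exact h

theorem SeqInv.prune {w M len : ℕ} {lo : α} {l : List (Nd V)}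
    (hl : SeqInv key cur w M (2 * len) lo l) :
    SeqInv key cur (3 * w + 2) (M + 2 * w) (len + 1) lo (prune key l) where
  sorted := prune_sorted hl.sorted
  node := NdInv.prune hl.sorted hl.node
  size := by
    refine SzLe.prune (fun n hn => ?_) fun n hn => hl.size n (List.mem_of_mem_tail hn)
    have := hl.size n (List.mem_of_mem_head? hn)
    simp only [SzLe] at this
    omega
  length_le := by
    have := length_prune (key := key) l
    have := hl.length_le
    omega
  dle := by
    refine Dle.prune le_rfl (hl.dle.card_le.trans (by omega)) ?_ fun n hn =>
      hl.size n (List.mem_of_mem_tail hn)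
    have := hl.dle
    cases l with
    | nil => trivial
    | cons a l => exact this.2
  wit := by
    obtain ⟨X, h1, h2⟩ := prune_wit (key := key) l
    rw [h1, h2]
    exact add_le_add_left hl.wit X
  adm := hl.adm.prune

/-! ### Cells to be visited -/

/-- `T` counts twice because a deleted node's `T` can be used twice, in the `K` of the next node and
in the `W` of the previous one; pruning then only adds the new `join` cells. -/
def fpot (l : List (Nd V)) : ℕ := (l.map fun n => n.K.sz + 2 * n.T.sz + n.W.sz).sum

@[simp] theorem fpot_nil : fpot ([] : List (Nd V)) = 0 := rfl
@[simp] theorem fpot_cons (n : Nd V) (l : List (Nd V)) :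
    fpot (n :: l) = n.K.sz + 2 * n.T.sz + n.W.sz + fpot l := by
  simp [fpot]

theorem fpot_mergeSeq (l m : List (Nd V)) : fpot (mergeSeq key l m) = fpot l + fpot m := by
  rw [fpot, ((mergeSeq_perm l m).map _).sum_eq, List.map_append, List.sum_append, fpot, fpot]

theorem fpot_prune (l : List (Nd V)) : fpot (prune key l) ≤ fpot l + 4 * l.length := by
  induction l using prune.induct key with
  | case1 n₁ n₂ n₃ l h ih =>
    rw [prune, if_pos h]
    simp only [fpot_cons, List.length_cons, Bag.sz] at ih ⊢
    omega
  | case2 n₁ n₂ n₃ l h ih =>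
    rw [prune, if_neg h]
    simp only [fpot_cons, List.length_cons, Bag.sz] at ih ⊢
    omega
  | case3 l h => rw [prune]; omega; exact h

end

/-! ## Parameters of a sequence of rank `r` -/

/-- Bound for the sizes of the bags. -/
def bagBound (r : ℕ) : ℕ := 3 ^ (r / 5 + 1) - 1

/-- Bound for the length. -/
def lenBound : ℕ → ℕ
  | 0 => 1
  | r + 1 => if (r + 1) % 5 = 0 then lenBound r + 1 else 2 * lenBound r

/-- Bound for the number of corrupt items. -/
def corBound : ℕ → ℕ
  | 0 => 0
  | r + 1 => if (r + 1) % 5 = 0 then 2 * corBound r + 2 * bagBound r else 2 * corBound r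

theorem bagBound_succ (r : ℕ) :
    bagBound (r + 1) = if (r + 1) % 5 = 0 then 3 * bagBound r + 2 else bagBound r := by
  unfold bagBound
  split_ifs with h
  · rw [show (r + 1) / 5 = r / 5 + 1 by omega, pow_succ 3 (r / 5 + 1)]
    have := Nat.one_le_pow (r / 5 + 1) 3 (by omega)
    omega
  · rw [show (r + 1) / 5 = r / 5 by omega]

theorem two_pow_eq (r : ℕ) : 2 ^ r = 2 ^ (r % 5) * 32 ^ (r / 5) := by
  rw [show (32 : ℕ) = 2 ^ 5 by norm_num, ← pow_mul, ← pow_add, Nat.mod_add_div]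

/-- With q = r / 5, five ranks turn the bound C into 32 C + 2 (3^(q+1) - 1). Without the -1 the
solution is 6 (32^q - 3^q) / 29, where 29 = 32 - 3. The period 5 is good enough since 6/29 < 1/4. -/
theorem corBound_le_aux (r : ℕ) :
    29 * corBound r + 6 * (2 ^ (r % 5) * 3 ^ (r / 5)) ≤ 6 * (2 ^ (r % 5) * 32 ^ (r / 5)) := by
  induction r with
  | zero => simp [corBound]
  | succ r ih =>
    rw [corBound]
    split_ifs with h
    · rw [show r % 5 = 4 by omega] at ih
      rw [show (r + 1) / 5 = r / 5 + 1 by omega, h, bagBound]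
      simp only [pow_succ, pow_zero] at ih ⊢
      omega
    · rw [show (r + 1) / 5 = r / 5 by omega, show (r + 1) % 5 = r % 5 + 1 by omega,
        pow_succ 2 (r % 5)]
      linarith

theorem corBound_le (r : ℕ) : 4 * corBound r ≤ 2 ^ r := by
  have := corBound_le_aux r
  rw [two_pow_eq r]
  omega

/-- Five ranks multiply the length by 16 and add one; the extra term on the left absorbs the
additions. -/
theorem lenBound_le_aux (r : ℕ) :
    lenBound r + 2 ^ (r % 5) ≤ 2 * (2 ^ (r % 5) * 16 ^ (r / 5)) := by
  induction r with
  | zero => simp [lenBound]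
  | succ r ih =>
    rw [lenBound]
    split_ifs with h
    · rw [show r % 5 = 4 by omega] at ih
      rw [show (r + 1) / 5 = r / 5 + 1 by omega, h]
      simp only [pow_succ, pow_zero] at ih ⊢
      omega
    · rw [show (r + 1) / 5 = r / 5 by omega, show (r + 1) % 5 = r % 5 + 1 by omega,
        pow_succ 2 (r % 5), mul_right_comm (2 ^ (r % 5))]
      omega

theorem lenBound_mul_le (r : ℕ) : lenBound r * 2 ^ (r / 5) ≤ 2 * 2 ^ r := by
  have := lenBound_le_aux r
  calc lenBound r * 2 ^ (r / 5) ≤ 2 * (2 ^ (r % 5) * 16 ^ (r / 5)) * 2 ^ (r / 5) := by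
        gcongr; exact (Nat.le_add_right _ _).trans this
    _ = 2 * (2 ^ (r % 5) * (16 * 2) ^ (r / 5)) := by rw [mul_pow]; ring
    _ = 2 * 2 ^ r := by rw [two_pow_eq r]

theorem bagBound_mul_le (r : ℕ) : bagBound r * 2 ^ (r / 5) ≤ 3 * 2 ^ r := by
  calc bagBound r * 2 ^ (r / 5) ≤ 3 ^ (r / 5 + 1) * 2 ^ (r / 5) := by
        gcongr; exact Nat.sub_le _ _
    _ = 3 * (1 * (3 * 2) ^ (r / 5)) := by rw [mul_pow]; ring
    _ ≤ 3 * (2 ^ (r % 5) * 32 ^ (r / 5)) := by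
        gcongr
        · exact Nat.one_le_two_pow
        · norm_num
    _ = 3 * 2 ^ r := by rw [two_pow_eq r]

theorem one_le_lenBound (r : ℕ) : 1 ≤ lenBound r := by
  induction r with
  | zero => simp [lenBound]
  | succ r ih => rw [lenBound]; split_ifs <;> omega

/-! ### The potential of a sequence -/

/-- What combining two sequences of rank `r` costs. -/
def mergeCost (r : ℕ) : ℕ :=
  1000 * lenBound r + 100 * (r + 2) * lenBound (r + 1) + 160 * bagBound r

theorem mergeCost_mul_le (r : ℕ) : mergeCost r * 2 ^ (r / 5) ≤ 2000 * (r + 2) * 2 ^ r := by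
  have h1 := lenBound_mul_le r
  have h2 := bagBound_mul_le r
  have h3 : lenBound (r + 1) * 2 ^ (r / 5) ≤ 4 * 2 ^ r := by
    calc lenBound (r + 1) * 2 ^ (r / 5) ≤ lenBound (r + 1) * 2 ^ ((r + 1) / 5) := by
          gcongr <;> omega
      _ ≤ 2 * 2 ^ (r + 1) := lenBound_mul_le _
      _ = 4 * 2 ^ r := by ring
  calc mergeCost r * 2 ^ (r / 5)
      = 1000 * (lenBound r * 2 ^ (r / 5)) + 100 * (r + 2) * (lenBound (r + 1) * 2 ^ (r / 5))
        + 160 * (bagBound r * 2 ^ (r / 5)) := by unfold mergeCost; ring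
    _ ≤ 1000 * (2 * 2 ^ r) + 100 * (r + 2) * (4 * 2 ^ r) + 160 * (3 * 2 ^ r) := by gcongr
    _ ≤ 2000 * (r + 2) * 2 ^ r := by
        generalize 2 ^ r = p
        nlinarith [Nat.zero_le (r * p), Nat.zero_le p]

/-- Since (8/7)^5 < 2, the factor 2^(r/5) saved by pruning becomes a saving that is geometric in r.
-/
theorem pow_le_two_pow_div (r : ℕ) : (8 / 7 : ℝ) ^ r ≤ 2 * 2 ^ (r / 5) := by
  have h1 : (8 / 7 : ℝ) ^ (5 * (r / 5)) ≤ 2 ^ (r / 5) := by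
    rw [pow_mul]
    gcongr
    norm_num
  have h2 : (8 / 7 : ℝ) ^ (r % 5) ≤ 2 :=
    (pow_le_pow_right₀ (by norm_num) (show r % 5 ≤ 4 by omega)).trans (by norm_num)
  calc (8 / 7 : ℝ) ^ r = (8 / 7 : ℝ) ^ (r % 5) * (8 / 7 : ℝ) ^ (5 * (r / 5)) := by
        rw [← pow_add, Nat.mod_add_div]
    _ ≤ _ := by gcongr

theorem summable_mergeCost : Summable fun r => (mergeCost r : ℝ) / 2 ^ (r + 1) := by
  have hs : Summable fun r : ℕ => 2000 * (((r : ℝ) ^ 1 * (7 / 8) ^ r) + 2 * (7 / 8) ^ r) :=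
    ((summable_pow_mul_geometric_of_norm_lt_one 1 (by norm_num)).add
      ((summable_geometric_of_lt_one (by norm_num) (by norm_num)).mul_left 2)).mul_left 2000
  refine hs.of_nonneg_of_le (fun r => by positivity) fun r => ?_
  have h1 : (mergeCost r : ℝ) * 2 ^ (r / 5) ≤ 2000 * (r + 2) * 2 ^ r := by
    exact_mod_cast mergeCost_mul_le r
  have h2 := pow_le_two_pow_div r
  have h3 : (mergeCost r : ℝ) * (8 / 7) ^ r ≤ 2000 * (r + 2) * 2 ^ (r + 1) := by
    calc (mergeCost r : ℝ) * (8 / 7) ^ r ≤ mergeCost r * (2 * 2 ^ (r / 5)) := by gcongr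
      _ = 2 * (mergeCost r * 2 ^ (r / 5)) := by ring
      _ ≤ 2 * (2000 * (r + 2) * 2 ^ r) := by gcongr
      _ = _ := by ring
  have h4 : (7 / 8 : ℝ) ^ r * (8 / 7) ^ r = 1 := by rw [← mul_pow]; norm_num
  rw [div_le_iff₀ (by positivity)]
  calc (mergeCost r : ℝ) = (7 / 8) ^ r * (mergeCost r * (8 / 7) ^ r) := by
        rw [mul_left_comm, h4, mul_one]
    _ ≤ (7 / 8) ^ r * (2000 * (r + 2) * 2 ^ (r + 1)) := by gcongr
    _ = _ := by ring

/-- The potential that pays for combining sequences. -/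
noncomputable def reserve (r : ℕ) : ℝ := 2 ^ r * ∑' i, (mergeCost (i + r) : ℝ) / 2 ^ (i + r + 1)

theorem reserve_nonneg (r : ℕ) : 0 ≤ reserve r := by
  unfold reserve
  have : 0 ≤ ∑' i, (mergeCost (i + r) : ℝ) / 2 ^ (i + r + 1) := tsum_nonneg fun i => by positivity
  positivity

/-- The reserve is 2^r times a tail of the series of merge costs: two reserves of rank r leave one
of rank r + 1 and release the first term of the tail. -/
theorem two_mul_reserve (r : ℕ) : 2 * reserve r = reserve (r + 1) + mergeCost r := by
  have h := (summable_nat_add_iff r).2 summable_mergeCost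
  unfold reserve
  rw [h.tsum_eq_zero_add]
  have : ∀ i, i + 1 + r = i + (r + 1) := fun i => by omega
  simp only [zero_add, this]
  field_simp
  ring

/-! ## Cells -/

/-- A nonempty sequence `hd :: tl` of rank `rank`. -/
structure Cell (V : Type*) where
  rank : ℕ
  hd : Nd V
  tl : List (Nd V)

section

variable {V α : Type*}

def Cell.seq (c : Cell V) : List (Nd V) := c.hd :: c.tl

/-- The second number counts down to the next pruning, which replaces arithmetic modulo 5. -/
def encSeq (r : ℕ) (l : List (Nd V)) : Val V :=
  .pair (.num r) (.pair (.num (5 - r % 5)) (encList Nd.enc l))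

def Cell.enc (c : Cell V) : Val V := encSeq c.rank c.seq

def Cell.items (c : Cell V) : Multiset V := ttot c.seq + ktot c.seq

/-- The potential of a sequence, except for the reserve. -/
noncomputable def Cell.pot (c : Cell V) : ℝ :=
  reserve c.rank + 100 * (c.rank + 1) * c.seq.length +
    20 * (c.hd.K.pot + c.hd.T.pot + c.hd.W.sz + fpot c.tl)

theorem Cell.pot_nonneg (c : Cell V) : 0 ≤ c.pot := by
  have := reserve_nonneg c.rank
  unfold Cell.pot
  positivity

variable [LinearOrder α]

structure CellInv (key cur : V → α) (c : Cell V) : Prop extends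
  SeqInv key cur (bagBound c.rank) (corBound c.rank) (lenBound c.rank) (key c.hd.c) c.seq

def combineSeq (key : V → α) (r : ℕ) (l m : List (Nd V)) : List (Nd V) :=
  if (r + 1) % 5 = 0 then prune key (mergeSeq key l m) else mergeSeq key l m

theorem head?_prune (key : V → α) (l : List (Nd V)) :
    (prune key l).head?.map Nd.c = l.head?.map Nd.c := by
  match l with
  | [] | [_] | [_, _] => simp [prune]
  | n₁ :: n₂ :: n₃ :: l =>
    rw [prune]
    split_ifs <;> simp

theorem key_head_combineSeq {key : V → α} {r : ℕ} {f g : Cell V} {n : Nd V} {l : List (Nd V)}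
    (h : combineSeq key r f.seq g.seq = n :: l) : key n.c = min (key f.hd.c) (key g.hd.c) := by
  have h1 : (combineSeq key r f.seq g.seq).head?.map Nd.c =
      (mergeSeq key f.seq g.seq).head?.map Nd.c := by
    rw [combineSeq]
    split_ifs
    · exact head?_prune key _
    · rfl
  rw [h, Cell.seq, Cell.seq, mergeSeq] at h1
  split_ifs at h1 with hk <;> simp at h1
  · rw [h1, min_eq_left hk]
  · rw [h1, min_eq_right (not_le.1 hk).le]

/-- The released `mergeCost` pays for the running time, for the node charges at the higher rank, for
the cells created by pruning, and for the bags of the old heads. -/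
theorem combineSeq_spec {key cur : V → α} {f g : Cell V} (hr : f.rank = g.rank)
    (hf : CellInv key cur f) (hg : CellInv key cur g) :
    ∃ c : Cell V, c.rank = f.rank + 1 ∧ c.seq = combineSeq key f.rank f.seq g.seq ∧
      CellInv key cur c ∧ c.items = f.items + g.items ∧
      (300 * lenBound f.rank + 300 + c.pot ≤ f.pot + g.pot) := by
  have hf' : SeqInv key cur (bagBound f.rank) (corBound f.rank) (lenBound f.rank)
      (min (key f.hd.c) (key g.hd.c)) f.seq :=
    { hf.toSeqInv with node := fun n hn => (hf.node n hn).mono (min_le_left _ _) }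
  have hg' : SeqInv key cur (bagBound f.rank) (corBound f.rank) (lenBound f.rank)
      (min (key f.hd.c) (key g.hd.c)) g.seq :=
    hr ▸ { hg.toSeqInv with node := fun n hn => (hg.node n hn).mono (min_le_right _ _) }
  have hm := hf'.mergeSeq hg'
  have hc : SeqInv key cur (bagBound (f.rank + 1)) (corBound (f.rank + 1)) (lenBound (f.rank + 1))
      (min (key f.hd.c) (key g.hd.c)) (combineSeq key f.rank f.seq g.seq) := by
    rw [bagBound_succ, corBound, lenBound, combineSeq]
    split_ifs with h
    · exact hm.prune
    · exact hm
  have hit : ttot (combineSeq key f.rank f.seq g.seq) + ktot (combineSeq key f.rank f.seq g.seq) =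
      f.items + g.items := by
    have : ttot (mergeSeq key f.seq g.seq) + ktot (mergeSeq key f.seq g.seq) =
        f.items + g.items := by
      rw [ttot_perm (mergeSeq_perm _ _), ktot_perm (mergeSeq_perm _ _), ttot_append, ktot_append,
        Cell.items, Cell.items]
      abel
    rw [combineSeq]
    split_ifs
    · rw [prune_items, this]
    · exact this
  have hpot : fpot (combineSeq key f.rank f.seq g.seq) ≤
      fpot f.seq + fpot g.seq + 8 * lenBound f.rank := by
    have h1 := hm.length_le
    rw [combineSeq, ← fpot_mergeSeq (key := key)]
    split_ifs
    · exact (fpot_prune _).trans (by omega)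
    · omega
  have hne : combineSeq key f.rank f.seq g.seq ≠ [] := by
    intro h
    have h1 := (hf.node f.hd (by simp [Cell.seq])).T_ne
    obtain ⟨x, hx⟩ := Multiset.exists_mem_of_ne_zero h1
    rw [h] at hit
    have : x ∈ f.items + g.items := by simp [Cell.items, Cell.seq, hx]
    rw [← hit] at this
    simp at this
  obtain ⟨n, l, hnl⟩ := List.exists_cons_of_ne_nil hne
  refine ⟨⟨f.rank + 1, n, l⟩, rfl, hnl.symm, ⟨?_⟩, ?_, ?_⟩
  · rw [hnl] at hc
    refine { hc with node := fun m hm => ?_ }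
    rw [key_head_combineSeq hnl]
    exact hc.node m hm
  · rw [← hit, hnl]; rfl
  · have h1 := hc.length_le
    rw [hnl] at h1 hpot
    have h2 := n.K.pot_le_sz
    have h3 := n.T.pot_le_sz
    have h4 := hf.size f.hd (by simp [Cell.seq])
    have h5 := hg.size g.hd (by simp [Cell.seq])
    rw [← hr] at h5
    have h6 := one_le_lenBound f.rank
    simp only [SzLe, Cell.seq, fpot_cons] at h4 h5 hpot
    -- The bags `K` and `T` of the two old heads were charged only for `pot`; charging them as in
    -- `fpot` costs at most three bag bounds per head.
    have h7 : n.K.pot + n.T.pot + n.W.sz + fpot l ≤ 6 * bagBound f.rank + 8 * lenBound f.rank +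
        (f.hd.W.sz + fpot f.tl) + (g.hd.W.sz + fpot g.tl) := by omega
    have h8 := two_mul_reserve f.rank
    have h9 : 100 * ((f.rank + 1 : ℕ) + 1 : ℝ) * (n :: l).length ≤
        100 * (f.rank + 2) * lenBound (f.rank + 1) := by
      push_cast
      rw [add_assoc (f.rank : ℝ), one_add_one_eq_two]
      gcongr
    have h10 : (0 : ℝ) ≤ 100 * (f.rank + 1) * f.seq.length := by positivity
    have h11 : (0 : ℝ) ≤ 100 * (f.rank + 1) * g.seq.length := by positivity
    rify at h6 h7
    simp only [Cell.pot, ← hr, Cell.seq, mergeCost] at h8 h10 h11 ⊢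
    push_cast at h8 h9 ⊢
    linarith [Nat.cast_nonneg (α := ℝ) f.hd.K.pot, Nat.cast_nonneg (α := ℝ) f.hd.T.pot,
      Nat.cast_nonneg (α := ℝ) g.hd.K.pot, Nat.cast_nonneg (α := ℝ) g.hd.T.pot,
      Nat.cast_nonneg (α := ℝ) (bagBound f.rank)]

end

/-! ## Lists of cells -/

/-- `x := 5` -/
def five (x : ℕ) : Prog :=
  .block [.assign x .zero, .assign x (.succ x), .assign x (.succ x), .assign x (.succ x),
    .assign x (.succ x), .assign x (.succ x)]

def combineP : Prog :=
  .block [.assign 1 (.head 0), .assign 2 (.tail 0), .assign 3 (.head 1), .assign 3 (.succ 3),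
    .assign 1 (.tail 1), .assign 4 (.head 1), .assign 4 (.pred 4), .assign 1 (.tail 1),
    .assign 2 (.tail 2), .assign 2 (.tail 2), .assign 1 (.pair 1 2), .call 1 mergeP 1,
    .cond 4 .skip (.seq (.call 1 pruneP 1) (five 4)),
    .assign 4 (.pair 4 1), .assign 0 (.pair 3 4)]

/-- Puts a cell at the first or second place of a list. -/
def keyInsP : Prog :=
  .block [.assign 1 (.head 0), .assign 2 (.tail 0),
    .cond 2
      (.block [.assign 3 (.head 2),
        .assign 4 (.tail 1), .assign 4 (.tail 4), .assign 4 (.head 4), .assign 4 (.head 4),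
        .assign 5 (.tail 3), .assign 5 (.tail 5), .assign 5 (.head 5), .assign 5 (.head 5),
        .assign 6 (.compare 4 5),
        .cond 6 (.assign 0 (.pair 1 2))
          (.block [.assign 2 (.tail 2), .assign 2 (.pair 1 2), .assign 0 (.pair 3 2)])])
      (.assign 0 (.pair 1 2))]

/-- Restores the order of a list of cells after a change of the first sequence. -/
def fixP : Prog :=
  .block [.assign 1 (.head 0), .assign 2 (.tail 0), .assign 7 (.tail 1), .assign 7 (.tail 7),
    .cond 2 (.block [.assign 3 (.head 2), .assign 4 (.head 3), .assign 5 (.head 1),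
      .assign 6 (.lt 4 5)]) .skip,
    .cond 6
      (.block [.assign 2 (.tail 2), .assign 2 (.pair 1 2), .recur 2 2, .assign 3 (.pair 3 2),
        .call 0 keyInsP 3])
      (.cond 7 (.call 0 keyInsP 0) (.assign 0 (.copy 2)))]

/-- Inserts a cell, whose rank is at most the other ranks, into a list. -/
def carryP : Prog :=
  .block [.assign 1 (.head 0), .assign 2 (.tail 0),
    .cond 2
      (.block [.assign 3 (.head 2), .assign 4 (.tail 2),
        .cond 4
          (.block [.assign 5 (.head 4), .assign 6 (.head 5), .assign 7 (.head 3),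
            .assign 8 (.lt 6 7),
            .cond 8 (.block [.assign 6 (.tail 4), .assign 4 (.pair 3 6), .assign 3 (.copy 5)])
              .skip])
          .skip,
        .assign 5 (.head 1), .assign 6 (.head 3), .assign 7 (.lt 5 6),
        .cond 7 (.call 0 keyInsP 0)
          (.block [.assign 1 (.pair 1 3), .call 1 combineP 1, .assign 1 (.pair 1 4),
            .recur 0 1])])
      .skip]

theorem cast_aux {n b : ℕ} {x y : ℝ} (h : n + 100 ≤ 300 * b + 300)
    (hxy : 300 * b + 300 + x ≤ y) : (n : ℝ) + 100 + x ≤ y := by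
  have : ((n + 100 : ℕ) : ℝ) ≤ ((300 * b + 300 : ℕ) : ℝ) := by exact_mod_cast h
  push_cast at this
  linarith

section

variable {V α : Type*} [LinearOrder α]

/-- The order of the cells in a list. -/
inductive Findable (key : V → α) : List (Cell V) → Prop
  | nil : Findable key []
  | cons {f : Cell V} {l : List (Cell V)} (h : Findable key l) (hr : ∀ g ∈ l, f.rank < g.rank)
      (hk : ∀ g ∈ l, key f.hd.c ≤ key g.hd.c) : Findable key (f :: l)
  | swap {f g : Cell V} {l : List (Cell V)} (h : Findable key (g :: l))
      (hr : ∀ c ∈ g :: l, f.rank < c.rank) (hk : key g.hd.c ≤ key f.hd.c) :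
      Findable key (g :: f :: l)

/-- A findable list arises by inserting cells in order of decreasing rank, each just before or just
behind the current head, so that the smallest key stays in front. The cell of least rank is then
first or second. -/
theorem Findable.head_le {key : V → α} {f : Cell V} {l : List (Cell V)}
    (h : Findable key (f :: l)) : ∀ g ∈ l, key f.hd.c ≤ key g.hd.c := by
  generalize hL : f :: l = L at h
  induction h generalizing f l with
  | nil => simp at hL
  | cons h hr hk ih => cases hL; exact hk
  | swap h hr hk ih => 
    cases hL
    exact List.forall_mem_cons.2 ⟨hk, ih rfl⟩

/-- The result of `keyInsP`. -/
def keyIns (key : V → α) (f : Cell V) : List (Cell V) → List (Cell V)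
  | [] => [f]
  | g :: l => if key f.hd.c ≤ key g.hd.c then f :: g :: l else g :: f :: l

theorem keyIns_perm (key : V → α) (f : Cell V) (l : List (Cell V)) :
    (keyIns key f l).Perm (f :: l) := by
  cases l with
  | nil => exact .refl _
  | cons g l =>
    rw [keyIns]
    split_ifs
    · exact .refl _
    · exact .swap _ _ _

theorem Findable.keyIns {key : V → α} {f : Cell V} {l : List (Cell V)} (h : Findable key l)
    (hr : ∀ g ∈ l, f.rank < g.rank) : Findable key (keyIns key f l) := by
  cases l with
  | nil => exact .cons h hr (by simp)
  | cons g l =>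
    rw [SoftSeq.keyIns]
    split_ifs with hk
    · exact .cons h hr (List.forall_mem_cons.2 ⟨hk, fun c hc => hk.trans (h.head_le c hc)⟩)
    · exact .swap h hr (not_le.1 hk).le

variable (W : Items V α)

theorem combineP_spec {cur : V → α} {f g : Cell V} (hr : f.rank = g.rank)
    (hf : CellInv W.key cur f) (hg : CellInv W.key cur g) :
    RetQ W combineP (.pair f.enc g.enc) fun r t => ∃ c : Cell V, r = c.enc ∧
      c.rank = f.rank + 1 ∧ CellInv W.key cur c ∧ c.items = f.items + g.items ∧
      (t + 100 + c.pot : ℝ) ≤ f.pot + g.pot := by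
  obtain ⟨c, h1, h2, h3, h4, h5⟩ := combineSeq_spec hr hf hg
  have hlen : (mergeSeq W.key f.seq g.seq).length ≤ 2 * lenBound f.rank := by
    rw [(mergeSeq_perm _ _).length_eq, List.length_append]
    have := hf.length_le
    have := hg.length_le
    rw [← hr] at this
    omega
  have hlen' := (mergeSeq_perm (key := W.key) f.seq g.seq).length_eq
  rw [List.length_append] at hlen'
  have h6 := one_le_lenBound f.rank
  refine RetQ.of_body combineP.eq_1 ?_
  simp [Cell.enc, encSeq]
  refine (mergeP_spec W f.seq g.seq).mono ?_
  rintro r t ⟨rfl, ht⟩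
  by_cases h : (f.rank + 1) % 5 = 0
  · rw [combineSeq, if_pos h] at h2
    -- The decremented counter vanishes exactly when the new rank is a multiple of 5.
    have : 5 - f.rank % 5 - 1 = 0 := by omega
    simp [this]
    refine (pruneP_spec W _).mono ?_
    rintro r t' ⟨rfl, ht'⟩
    simp [five]
    refine Post.intro ⟨c, ?_, h1, h3, h4, ?_⟩
    · rw [h1, h2, h]
    · exact cast_aux (by omega) h5
  · rw [combineSeq, if_neg h] at h2
    obtain ⟨d, hd⟩ : ∃ d, 5 - f.rank % 5 - 1 = d + 1 := ⟨3 - f.rank % 5, by omega⟩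
    simp [hd]
    refine Post.intro ⟨c, ?_, h1, h3, h4, ?_⟩
    · rw [h1, h2, show 5 - (f.rank + 1) % 5 = d + 1 by omega]
    · exact cast_aux (by omega) h5

theorem keyInsP_spec (f : Cell V) (l : List (Cell V)) :
    RetQ W keyInsP (.pair f.enc (encList Cell.enc l)) fun r t =>
      r = encList Cell.enc (keyIns W.key f l) ∧ t ≤ 40 := by
  refine RetQ.of_body keyInsP.eq_1 ?_
  cases l with
  | nil =>
    simp
    exact Post.intro ⟨rfl, by omega⟩
  | cons g l =>
    by_cases h : W.key f.hd.c ≤ W.key g.hd.c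
    · simp [Cell.enc, encSeq, Cell.seq, Nd.enc, h]
      exact Post.intro ⟨by rw [keyIns, if_pos h]; rfl, by omega⟩
    · simp [Cell.enc, encSeq, Cell.seq, Nd.enc, h]
      exact Post.intro ⟨by rw [keyIns, if_neg h]; rfl, by omega⟩

/-- The list of cells with the single sequence `s` of rank `r`, or without any if `s` is empty. -/
def cellsOf (r : ℕ) : List (Nd V) → List (Cell V)
  | [] => []
  | n :: s => [⟨r, n, s⟩]

/-- The changed sequence stands in front, and each cell of smaller rank in its way is set aside and
reinserted after the recursive call. Their ranks increase strictly along the recursion, with `i` as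
a lower bound, so at most `f.rank` cells are passed. -/
theorem fixP_spec {f : Cell V} {l : List (Cell V)} (h : Findable W.key (f :: l)) (s : List (Nd V))
    (i : ℕ) (hi : ∀ g ∈ f :: l, i ≤ g.rank) :
    RetQ W fixP (.pair (encSeq f.rank s) (encList Cell.enc l)) fun r t =>
      ∃ L : List (Cell V), r = encList Cell.enc L ∧ Findable W.key L ∧
        L.Perm (cellsOf f.rank s ++ l) ∧ t + 90 * i ≤ 90 * (f.rank + 1) := by
  induction l generalizing i with
  | nil =>
    have := hi f (by simp)
    refine RetQ.of_body fixP.eq_1 ?_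
    cases s with
    | nil =>
      simp [encSeq]
      exact Post.intro ⟨[], by simp, .nil, .refl _, by omega⟩
    | cons n s =>
      simp [encSeq]
      refine (keyInsP_spec W ⟨f.rank, n, s⟩ []).mono ?_
      rintro r t ⟨rfl, ht⟩
      exact Post.intro ⟨_, rfl, Findable.keyIns .nil (by simp), .refl _, by omega⟩
  | cons g l ih =>
    have hif := hi f (by simp)
    refine RetQ.of_body fixP.eq_1 ?_
    cases h with
    | cons h hr hk =>
      have hgf : ¬ g.rank < f.rank := (hr g (by simp)).le.not_gt
      cases s with
      | nil =>
        simp [encSeq, Cell.enc, hgf]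
        exact Post.intro ⟨g :: l, rfl, h, .refl _, by omega⟩
      | cons n s =>
        simp [encSeq, Cell.enc, hgf]
        refine (keyInsP_spec W ⟨f.rank, n, s⟩ (g :: l)).mono ?_
        rintro r t ⟨rfl, ht⟩
        exact Post.intro ⟨_, rfl, Findable.keyIns h hr, keyIns_perm _ _ _, by omega⟩
    | swap h hr hk =>
      have hgf : g.rank < f.rank := hr f (by simp)
      have hig := hi g (by simp)
      simp [encSeq, Cell.enc, hgf]
      refine (ih h (i + 1) fun c hc => ?_).mono ?_
      · have := hr c hc
        omega
      · rintro r t ⟨L, rfl, h1, h2, h3⟩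
        refine (keyInsP_spec W g L).mono ?_
        rintro r t' ⟨rfl, ht'⟩
        refine Post.intro ⟨_, rfl, Findable.keyIns h1 fun c hc => ?_, ?_, by omega⟩
        · rw [h2.mem_iff, List.mem_append] at hc
          rcases hc with hc | hc
          · cases s with
            | nil => simp [cellsOf] at hc
            | cons n s =>
              simp only [cellsOf, List.mem_singleton] at hc
              rw [hc]
              exact hgf
          · exact hr c (by simp [hc])
        · exact (keyIns_perm _ _ _).trans ((h2.cons g).trans List.perm_middle.symm)

theorem Findable.exists_min {key : V → α} {g : Cell V} {l : List (Cell V)}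
    (h : Findable key (g :: l)) : ∃ s F, Findable key F ∧ (∀ c ∈ F, s.rank < c.rank) ∧
      (g :: l).Perm (s :: F) ∧ (s = g ∧ F = l ∧ (∀ c ∈ l, g.rank < c.rank) ∨
        ∃ l', l = s :: l' ∧ F = g :: l') := by
  cases h with
  | cons h hr hk => exact ⟨g, l, h, hr, .refl _, .inl ⟨rfl, rfl, hr⟩⟩
  | swap h hr hk => exact ⟨_, _, h, hr, .swap _ _ _, .inr ⟨_, rfl, rfl⟩⟩

/-- This is a binary addition, which conserves the sum of the 2^rank. Each combination releases 100
units beyond its own cost, enough for one round of the recursion, so the amortized cost is constant.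
-/
theorem carryP_spec {cur : V → α} {f : Cell V} {l : List (Cell V)} (h : Findable W.key l)
    (hf : CellInv W.key cur f) (hl : ∀ g ∈ l, CellInv W.key cur g)
    (hr : ∀ g ∈ l, f.rank ≤ g.rank) :
    RetQ W carryP (.pair f.enc (encList Cell.enc l)) fun r t =>
      ∃ L : List (Cell V), r = encList Cell.enc L ∧ Findable W.key L ∧
        (∀ g ∈ L, CellInv W.key cur g) ∧
        (L.map Cell.items).sum = f.items + (l.map Cell.items).sum ∧
        (L.map fun c => 2 ^ c.rank).sum = 2 ^ f.rank + (l.map fun c => 2 ^ c.rank).sum ∧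
        t + (L.map Cell.pot).sum ≤ 100 + f.pot + (l.map Cell.pot).sum := by
  induction hn : l.length generalizing f l with
  | zero =>
    obtain rfl := List.length_eq_zero_iff.1 hn
    refine RetQ.of_body carryP.eq_1 ?_
    simp
    refine Post.intro ⟨[f], rfl, .cons .nil (by simp) (by simp), by simpa using hf, by simp,
      by simp, ?_⟩
    simp
    norm_num
  | succ n ih =>
    obtain ⟨g, l, rfl⟩ := List.exists_cons_of_length_eq_add_one hn
    obtain ⟨s, F, hF, hsF, hperm, hcase⟩ := h.exists_min
    have hlen : F.length = n := by
      have := hperm.length_eq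
      simp only [List.length_cons] at this hn
      omega
    have hs := hl s (hperm.mem_iff.2 (by simp))
    have hlF : ∀ c ∈ F, CellInv W.key cur c := fun c hc => hl c (hperm.mem_iff.2 (by simp [hc]))
    have hitems := (hperm.map Cell.items).sum_eq
    have hrank := (hperm.map fun c => 2 ^ c.rank).sum_eq
    have hpot := (hperm.map Cell.pot).sum_eq
    refine RetQ.of_body carryP.eq_1 ?_
    set R : Val V → ℕ → Prop := fun r t =>
      ∃ L : List (Cell V), r = encList Cell.enc L ∧ Findable W.key L ∧
        (∀ g ∈ L, CellInv W.key cur g) ∧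
        (L.map Cell.items).sum = f.items + ((g :: l).map Cell.items).sum ∧
        (L.map fun c => 2 ^ c.rank).sum = 2 ^ f.rank + ((g :: l).map fun c => 2 ^ c.rank).sum ∧
        t + (L.map Cell.pot).sum ≤ 100 + f.pot + ((g :: l).map Cell.pot).sum with hR
    by_cases hfs : f.rank < s.rank
    -- The number of steps around the call depends on where the cell of least rank was found; 60
    -- covers all cases.
    · have hA : RetQ W keyInsP (.pair f.enc (encList Cell.enc (g :: l))) fun r t =>
          ∀ m, m ≤ t + 60 → R r m := by
        refine (keyInsP_spec W f (g :: l)).mono ?_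
        rintro r t ⟨rfl, ht⟩ m hm
        have hp := keyIns_perm W.key f (g :: l)
        refine ⟨_, rfl, h.keyIns fun c hc => ?_, fun c hc => ?_, (hp.map _).sum_eq.trans (by simp),
          (hp.map _).sum_eq.trans (by simp), ?_⟩
        · rcases List.mem_cons.1 (hperm.mem_iff.1 hc) with rfl | hc
          exacts [hfs, hfs.trans (hsF c hc)]
        · rcases List.mem_cons.1 (hp.mem_iff.1 hc) with rfl | hc
          exacts [hf, hl c hc]
        · rw [(hp.map _).sum_eq, List.map_cons, List.sum_cons]
          have : (m : ℝ) ≤ 100 := by exact_mod_cast (by omega : m ≤ 100)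
          linarith
      -- An opaque `R` keeps the simplifier out of the postcondition.
      clear_value R
      rcases hcase with ⟨rfl, rfl, hgl⟩ | ⟨l', rfl, rfl⟩
      · cases F with
        | nil =>
          simp [Cell.enc, encSeq, hfs] at hA ⊢
          exact hA.mono fun r t h => Post.intro (h _ (by omega))
        | cons a F =>
          have : ¬ a.rank < s.rank := (hgl a (by simp)).le.not_gt
          simp [Cell.enc, encSeq, hfs, this] at hA ⊢
          exact hA.mono fun r t h => Post.intro (h _ (by omega))
      · have := hsF g (by simp)
        simp [Cell.enc, encSeq, hfs, this] at hA ⊢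
        exact hA.mono fun r t h => Post.intro (h _ (by omega))
    · have hfs' : f.rank = s.rank := le_antisymm (hr s (hperm.mem_iff.2 (by simp))) (not_lt.1 hfs)
      have hA : RetQ W combineP (.pair f.enc s.enc) fun b t =>
          RetQ W carryP (.pair b (encList Cell.enc F)) fun r t' =>
          ∀ m, m ≤ t + t' + 60 → R r m := by
        refine (combineP_spec W hfs' hf hs).mono ?_
        rintro r t ⟨c, rfl, h1, h2, h3, h4⟩
        refine (ih hF h2 hlF (fun a ha => ?_) hlen).mono ?_
        · have := hsF a ha
          omega
        · rintro r t' ⟨L, rfl, h5, h6, h7, h8, h9⟩ m hm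
          refine ⟨L, rfl, h5, h6, ?_, ?_, ?_⟩
          · rw [h7, h3, hitems, List.map_cons, List.sum_cons, add_assoc]
          · rw [h8, hrank, h1, List.map_cons, List.sum_cons, ← hfs', pow_succ]
            omega
          · rw [hpot, List.map_cons, List.sum_cons]
            have : (m : ℝ) ≤ t + t' + 60 := by exact_mod_cast hm
            linarith
      clear_value R
      rcases hcase with ⟨rfl, rfl, hgl⟩ | ⟨l', rfl, rfl⟩
      · cases F with
        | nil =>
          simp [Cell.enc, encSeq, hfs] at hA ⊢
          exact hA.mono fun r t h =>
            h.mono fun r t h => Post.intro (h _ (by omega))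
        | cons a F =>
          have : ¬ a.rank < s.rank := (hgl a (by simp)).le.not_gt
          simp [Cell.enc, encSeq, hfs, this] at hA ⊢
          exact hA.mono fun r t h =>
            h.mono fun r t h => Post.intro (h _ (by omega))
      · have := hsF g (by simp)
        simp [Cell.enc, encSeq, hfs, this] at hA ⊢
        exact hA.mono fun r t h =>
          h.mono fun r t h => Post.intro (h _ (by omega))

end

/-! ## The operations of the soft heap -/

/-- Register 3 is never assigned; its 0 serves as rank, empty bag and empty list. -/
def insertP : Prog :=
  .block [.assign 1 (.head 0), .assign 2 (.tail 0), .assign 4 (.pair 2 3), .assign 5 (.pair 3 3),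
    .assign 4 (.pair 4 5), .assign 4 (.pair 2 4), .assign 4 (.pair 4 3), five 5,
    .assign 5 (.pair 5 4), .assign 5 (.pair 3 5), .assign 5 (.pair 5 1), .call 0 carryP 5]

/-- Removes an item from a node. -/
def popP : Prog :=
  .block [.assign 1 (.head 0), .assign 2 (.tail 0), .assign 3 (.head 2), .assign 2 (.tail 2),
    .assign 4 (.head 2), .assign 5 (.tail 2), .call 4 normP 4,
    .cond 4
      (.block [.assign 6 (.head 4), .assign 4 (.tail 4), .assign 7 (.succ 7)])
      (.block [.call 3 normP 3, .assign 6 (.head 3), .assign 3 (.tail 3), .call 3 normP 3]),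
    .assign 4 (.pair 4 5), .assign 3 (.pair 3 4), .assign 1 (.pair 1 3), .assign 1 (.pair 7 1),
    .assign 0 (.pair 6 1)]

/-- Registers 11 and 12 start as empty lists: the former is the list of newly corrupt items if the
node survives, the latter the accumulator for `flatP`. -/
def extractP : Prog :=
  .block [.assign 1 (.head 0), .assign 2 (.tail 0), .assign 3 (.head 1), .assign 1 (.tail 1),
    .assign 4 (.head 1), .assign 5 (.tail 1), .assign 6 (.head 5), .assign 5 (.tail 5),
    .call 6 popP 6,
    .assign 7 (.head 6), .assign 6 (.tail 6), .assign 8 (.head 6), .assign 6 (.tail 6),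
    .assign 9 (.tail 6), .assign 10 (.head 9),
    .cond 10
      (.block [.assign 5 (.pair 6 5), .assign 4 (.pair 4 5), .assign 3 (.pair 3 4),
        .assign 0 (.pair 3 2)])
      (.block [.assign 9 (.tail 9), .assign 11 (.tail 9), .assign 11 (.pair 11 12),
        .call 11 flatP 11, .assign 4 (.pair 4 5), .assign 3 (.pair 3 4), .assign 3 (.pair 3 2),
        .call 0 fixP 3]),
    .assign 11 (.pair 11 0), .assign 8 (.pair 8 11), .assign 0 (.pair 7 8)]

def softHeap : SoftHeapProgs := ⟨.skip, insertP, extractP⟩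

section

variable {V α : Type*} [LinearOrder α]

/-- The node `n'` results from `n` by the removal of `x`. -/
structure Popped (n : Nd V) (x : V) (b : Val V) (n' : Nd V) : Prop where
  c_eq : n'.c = n.c
  W_eq : n'.W = n.W
  K_sz : n'.K.sz ≤ n.K.sz
  T_sz : n'.T.sz ≤ n.T.sz
  T_nil : n'.T = .nil ∨ n'.T.ms ≠ 0
  cases : (b.truthy = true ∧ n.K.ms = x ::ₘ n'.K.ms ∧ n'.T = n.T) ∨
    (b.truthy = false ∧ n.K.ms = 0 ∧ n'.K.ms = 0 ∧ n.T.ms = x ::ₘ n'.T.ms)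

variable (W : Items V α)

/-- The bag `K` is emptied first. When `T` is used, it is normalized again after the removal, so
that an empty rest is represented by 0 and can be recognized at once. -/
theorem popP_spec (n : Nd V) (hn : n.T.ms ≠ 0) :
    RetQ W popP n.enc fun r t => ∃ x b n', r = .pair (.item x) (.pair b n'.enc) ∧
      Popped n x b n' ∧ t + 20 * (n'.K.pot + n'.T.pot) ≤ 150 + 20 * (n.K.pot + n.T.pot) := by
  refine RetQ.of_body popP.eq_1 ?_
  simp [Nd.enc]
  refine (normP_spec W n.K).mono ?_
  rintro r t ⟨K', rfl, h1, h2, rfl | ⟨x, K', rfl⟩, h4⟩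
  · simp
    refine (normP_spec W n.T).mono ?_
    rintro r t' ⟨T', rfl, h5, h6, rfl | ⟨x, T', rfl⟩, h8⟩
    · exact absurd h5.symm hn
    simp
    refine (normP_spec W T').mono ?_
    rintro r t'' ⟨T'', rfl, h9, h10, h11, h12⟩
    simp only [Bag.ms, Bag.sz, Bag.pot] at h1 h2 h4 h5 h6 h8
    refine Post.intro ⟨x, .num 0, ⟨n.c, T'', .nil, n.W⟩, rfl,
      ⟨rfl, rfl, by simpa [Bag.sz] using h2, by simp only; omega, ?_,
        .inr ⟨rfl, h1.symm, rfl, by rw [← h5, h9]⟩⟩, ?_⟩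
    · rcases h11 with rfl | ⟨y, c, rfl⟩
      · exact .inl rfl
      · exact .inr (by simp [Bag.ms])
    · simp only [Bag.pot]
      omega
  · simp
    simp only [Bag.ms, Bag.sz, Bag.pot] at h1 h2 h4
    exact Post.intro ⟨x, .num 1, ⟨n.c, n.T, K', n.W⟩, rfl,
      ⟨rfl, rfl, by simp only; omega, le_rfl, .inr hn, .inl ⟨rfl, h1.symm, rfl⟩⟩,
      by simp only; omega⟩

variable {W}

theorem Findable.congr_head {key : V → α} {f f' : Cell V} {l : List (Cell V)}
    (h : Findable key (f :: l)) (hr : f'.rank = f.rank) (hk : f'.hd.c = f.hd.c) :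
    Findable key (f' :: l) := by
  generalize hL : f :: l = L at h
  induction h generalizing l with
  | nil => simp at hL
  | cons h hr' hk' ih =>
    cases hL
    exact .cons h (hr ▸ hr') (hk ▸ hk')
  | swap h hr' hk' ih =>
    cases hL
    refine .swap (ih rfl) ?_ (hk ▸ hk')
    rw [List.forall_mem_cons] at hr' ⊢
    exact ⟨hr ▸ hr'.1, hr'.2⟩

variable (W)

set_option maxHeartbeats 1000000 in
theorem extractP_spec {f : Cell V} {l : List (Cell V)} (hf : Findable W.key (f :: l))
    (hT : f.hd.T.ms ≠ 0) :
    RetQ W extractP (encList Cell.enc (f :: l)) fun r t => ∃ x b n' C L,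
      r = .pair (.item x) (.pair b (.pair (.ofList C) (encList Cell.enc L))) ∧
      Popped f.hd x b n' ∧ Findable W.key L ∧
      ((n'.T.ms ≠ 0 ∧ C = [] ∧ L = ⟨f.rank, n', f.tl⟩ :: l ∧
        t + 20 * (n'.K.pot + n'.T.pot) ≤ 300 + 20 * (f.hd.K.pot + f.hd.T.pot)) ∨
      (n'.T.ms = 0 ∧ (C : Multiset V) = f.hd.W.ms ∧ L.Perm (cellsOf f.rank f.tl ++ l) ∧
        t ≤ 300 + 20 * (f.hd.K.pot + f.hd.T.pot) + 20 * f.hd.W.sz + 90 * (f.rank + 1))) := by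
  refine RetQ.of_body extractP.eq_1 ?_
  simp [Cell.enc, encSeq, Cell.seq]
  refine (popP_spec W f.hd hT).mono ?_
  rintro r t ⟨x, b, n', rfl, hp, ht⟩
  rcases hp.T_nil with hn | hn
  · simp [Nd.enc, hn]
    rw [hp.W_eq]
    refine (flatP_spec W f.hd.W []).mono ?_
    rintro r t' ⟨C, rfl, h1, h2⟩
    simp
    refine (fixP_spec W hf f.tl 0 fun _ _ => Nat.zero_le _).mono ?_
    rintro r t'' ⟨L, rfl, h3, h4, h5⟩
    exact Post.intro ⟨x, b, n', C, L, by simp, hp, h3,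
      .inr ⟨by simp [hn, Bag.ms], h1, h4, by omega⟩⟩
  · have hn' : (n'.T.enc).truthy = true := by
      cases h : n'.T with
      | nil => simp [h, Bag.ms] at hn
      | cons v c => rfl
      | join c d => rfl
    simp [Nd.enc, hn']
    have hL : Findable W.key (⟨f.rank, n', f.tl⟩ :: l) := hf.congr_head rfl hp.c_eq
    refine Post.intro ⟨x, b, n', [], ⟨f.rank, n', f.tl⟩ :: l, ?_, hp, hL, .inl ⟨hn, rfl, rfl, ?_⟩⟩
    · simp [Nd.enc, Cell.enc, encSeq, Cell.seq]
    · omega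

end

/-- Distinctness puts each item in the `K` of only one node, so the raised key is well defined. -/
theorem exists_raise {V α : Type*} (key cur : V → α) (P : V → Prop) (l : List (Nd V))
    (hl : (ktot l).Nodup) :
    ∃ cur' : V → α, (∀ n ∈ l, ∀ x ∈ n.K.ms, P x → cur' x = key n.c) ∧
      ∀ x, (P x → x ∉ ktot l) → cur' x = cur x := by
  classical
  induction l with
  | nil => exact ⟨cur, by simp, fun _ _ => rfl⟩
  | cons n l ih =>
    rw [ktot_cons, Multiset.nodup_add] at hl
    obtain ⟨cur', h1, h2⟩ := ih hl.2.1
    refine ⟨fun x => if P x ∧ x ∈ n.K.ms then key n.c else cur' x, ?_, fun x hx => ?_⟩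
    · refine List.forall_mem_cons.2 ⟨fun x hx hP => if_pos ⟨hP, hx⟩, fun m hm x hx hP => ?_⟩
      have : x ∉ n.K.ms := fun hx' =>
        Multiset.disjoint_left.1 hl.2.2 hx' (mem_ktot.2 ⟨m, hm, hx⟩)
      simp only [this, and_false, if_false]
      exact h1 m hm x hx hP
    · simp only [ktot_cons, Multiset.mem_add, not_or] at hx
      have : ¬ (P x ∧ x ∈ n.K.ms) := fun h => (hx h.1).1 h.2
      simp only [this, if_false]
      exact h2 x fun hP => (hx hP).2

section

variable {V α : Type*} [LinearOrder α] {key cur cur' : V → α}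

/-! ## Changes of current keys -/

theorem CellInv.le_cur {c : Cell V} (h : CellInv key cur c) {x : V} (hx : x ∈ c.items) :
    key c.hd.c ≤ cur x ∧ key x ≤ cur x := by
  rw [Cell.items, Multiset.mem_add, mem_ttot, mem_ktot] at hx
  rcases hx with ⟨n, hn, hx⟩ | ⟨n, hn, hx⟩
  · have hn := h.node n hn
    rw [hn.T_cur x hx]
    exact ⟨hn.le_key, (hn.T_key x hx).le⟩
  · have hn := h.node n hn
    exact ⟨hn.K_lo x hx, hn.K_le x hx⟩

theorem NdInv.congr {lo : α} {n : Nd V} (h : NdInv key cur lo n)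
    (hT : ∀ x ∈ n.T.ms, cur' x = cur x) (hK : ∀ x ∈ n.K.ms, cur' x = cur x)
    (hW : ∀ x ∈ n.W.ms, cur' x = cur x) : NdInv key cur' lo n :=
  { h with
    T_cur := fun x hx => (hT x hx).trans (h.T_cur x hx)
    K_le := fun x hx => (h.K_le x hx).trans (hK x hx).ge
    K_lo := fun x hx => (h.K_lo x hx).trans (hK x hx).ge
    K_cur := fun x hx => (hK x hx).le.trans (h.K_cur x hx)
    W_cur := fun x hx => (hW x hx).trans (h.W_cur x hx) }

theorem CellInv.congr {c : Cell V} (h : CellInv key cur c) (hc : ∀ x ∈ c.items, cur' x = cur x) :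
    CellInv key cur' c where
  toSeqInv := { h.toSeqInv with
    node := fun n hn => (h.node n hn).congr
      (fun x hx => hc x (Multiset.mem_add.2 (.inl (mem_ttot.2 ⟨n, hn, hx⟩))))
      (fun x hx => hc x (Multiset.mem_add.2 (.inr (mem_ktot.2 ⟨n, hn, hx⟩))))
      (fun x hx => hc x (Multiset.mem_add.2 (.inr
        (Multiset.mem_of_le h.wit (mem_wtot.2 ⟨n, hn, hx⟩)))))
    adm := h.adm.mono fun x hx hlt => by
      rwa [hc x (Multiset.mem_add.2 (.inr hx))] }

theorem SeqInv.wtot_cur {w M len : ℕ} {lo : α} {l : List (Nd V)}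
    (h : SeqInv key cur w M len lo l) {x : V} (hx : x ∈ wtot l) : cur x = key x := by
  obtain ⟨n, hn, hx⟩ := mem_wtot.1 hx
  exact (h.node n hn).W_cur x hx

-- Items of `T` are not corrupt, and the witnessed items are uncorrupted members of `K`; what
-- remains is the excess bounded by `Dle`.
open Classical in
theorem CellInv.card_corrupt_le {c : Cell V} (h : CellInv key cur c) :
    Multiset.card (c.items.filter fun x => key x < cur x) ≤ corBound c.rank := by
  have h1 : (ttot c.seq).filter (fun x => key x < cur x) = 0 := by
    refine Multiset.filter_eq_nil.2 fun x hx => ?_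
    obtain ⟨n, hn, hx⟩ := mem_ttot.1 hx
    rw [(h.node n hn).T_cur x hx, (h.node n hn).T_key x hx]
    exact lt_irrefl _
  have h2 : wtot c.seq ≤ (ktot c.seq).filter (fun x => ¬ key x < cur x) :=
    Multiset.le_filter.2 ⟨h.wit, fun x hx => by rw [h.wtot_cur hx]; exact lt_irrefl _⟩
  have h3 := Multiset.card_le_card h2
  have h4 := congrArg Multiset.card
    (Multiset.filter_add_not (fun x => key x < cur x) (ktot c.seq))
  have h5 := h.dle.card_le
  rw [Multiset.card_add] at h4
  rw [Cell.items, Multiset.filter_add, h1, zero_add]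
  omega

theorem CellInv.shrink {f : Cell V} (h : CellInv key cur f) {n : Nd V} (hc : n.c = f.hd.c)
    (hW : n.W = f.hd.W) (hT : n.T.ms ≤ f.hd.T.ms) (hK : n.K.ms ≤ f.hd.K.ms)
    (hTs : n.T.sz ≤ f.hd.T.sz) (hKs : n.K.sz ≤ f.hd.K.sz) (hT0 : n.T.ms ≠ 0) :
    CellInv key cur ⟨f.rank, n, f.tl⟩ := by
  have hs := h.sorted
  have hn := h.node f.hd (by simp [Cell.seq])
  have hz := h.size f.hd (by simp [Cell.seq])
  have ha := h.adm
  have hd := h.dle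
  have hl := h.length_le
  rw [Cell.seq] at hs hd ha hl
  refine ⟨?_, ?_, ?_, hl, ?_, ?_, ?_⟩
  · exact List.pairwise_cons.2 ⟨hc ▸ (List.pairwise_cons.1 hs).1, hs.of_cons⟩
  · refine List.forall_mem_cons.2 ⟨?_, fun m hm => ?_⟩
    · exact
      { le_key := le_rfl
        T_ne := hT0
        T_key := fun x hx => hc ▸ hn.T_key x (Multiset.mem_of_le hT hx)
        T_cur := fun x hx => hc ▸ hn.T_cur x (Multiset.mem_of_le hT hx)
        K_lt := fun x hx => hc ▸ hn.K_lt x (Multiset.mem_of_le hK hx)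
        K_le := fun x hx => hn.K_le x (Multiset.mem_of_le hK hx)
        K_lo := fun x hx => hc ▸ hn.K_lo x (Multiset.mem_of_le hK hx)
        K_cur := fun x hx => hc ▸ hn.K_cur x (Multiset.mem_of_le hK hx)
        W_key := fun x hx => hc ▸ hn.W_key x (hW ▸ hx)
        W_cur := fun x hx => hn.W_cur x (hW ▸ hx) }
    · simp only [hc]
      exact h.node m (List.mem_cons_of_mem _ hm)
  · refine List.forall_mem_cons.2 ⟨?_, fun m hm => h.size m (List.mem_cons_of_mem _ hm)⟩
    simp only [SzLe] at hz ⊢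
    rw [hW]
    omega
  · refine ⟨?_, hd.2⟩
    have h1 := hd.1
    have h2 := Multiset.card_le_card hK
    simp only [ktot_cons, wtot_cons, Multiset.card_add, hW] at h1 ⊢
    omega
  · classical
    -- No node precedes the head, so all items of its `K` are corrupt, whereas witnessed items are
    -- not. Removals from this `K` thus leave `wit` intact.
    have h1 : wtot f.seq ≤ (ktot f.seq).filter (fun x => ¬ key x < cur x) :=
      Multiset.le_filter.2 ⟨h.wit, fun x hx => by rw [h.wtot_cur hx]; exact lt_irrefl _⟩
    rw [Cell.seq, ktot_cons, Multiset.filter_add, Multiset.filter_eq_nil.2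
      (fun x hx => not_not.2 (ha.1 x hx)), zero_add, wtot_cons] at h1
    simp only [Cell.seq, wtot_cons, ktot_cons, hW]
    exact (h1.trans (Multiset.filter_le _ _)).trans (Multiset.le_add_left _ _)
  · exact ⟨fun x hx => ha.1 x (Multiset.mem_of_le hK hx), hW ▸ ha.2⟩

theorem Adm.exists_witness {P : V → Prop} {l : List (Nd V)} (h : Adm P l) {x : V}
    (hx : x ∈ ktot l) : P x ∨ x ∈ wtot l := by
  induction l generalizing P with
  | nil => simp at hx
  | cons n l ih =>
    rw [ktot_cons, Multiset.mem_add] at hx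
    rw [wtot_cons, Multiset.mem_add]
    rcases hx with hx | hx
    · exact .inl (h.1 x hx)
    · rcases ih h.2 hx with (h | h) | h <;> tauto

/-- When the head dies, the items it witnessed are raised to the key of their node. Items already
corrupt are raised too, since their current keys might lie below the key of the new head. -/
theorem CellInv.pop {f : Cell V} (h : CellInv key cur f) (hnd : f.items.Nodup)
    (hK : f.hd.K.ms = 0) :
    ∃ cur' : V → α, (∀ c ∈ cellsOf f.rank f.tl, CellInv key cur' c) ∧
      (∀ x, x ∉ ktot f.tl → cur' x = cur x) ∧ (∀ x ∈ ktot f.tl, cur x ≤ cur' x) ∧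
      (∀ x ∈ f.hd.W.ms, x ∈ ktot f.tl ∧ cur x = key x ∧ key x < cur' x) ∧
      ∀ x ∈ ktot f.tl, key x < cur' x → key x < cur x ∨ x ∈ f.hd.W.ms := by
  have hs := h.sorted
  have ha := h.adm
  have hd := h.dle
  have hl := h.length_le
  have hw := h.wit
  rw [Cell.seq] at hs hd ha hl hw
  rw [Cell.items, Cell.seq, ttot_cons, ktot_cons, hK, zero_add, Multiset.nodup_add,
    Multiset.disjoint_left] at hnd
  rw [wtot_cons, ktot_cons, hK, zero_add] at hw
  have hkn := hnd.2.1
  have hwn := Multiset.nodup_of_le hw hkn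
  rw [Multiset.nodup_add, Multiset.disjoint_left] at hwn
  have hnode : ∀ n ∈ f.tl, NdInv key cur (key f.hd.c) n := fun n hn =>
    h.node n (List.mem_cons_of_mem _ hn)
  have hWk : ∀ x ∈ f.hd.W.ms, x ∈ ktot f.tl := fun x hx =>
    Multiset.mem_of_le hw (Multiset.mem_add.2 (.inl hx))
  obtain ⟨cur', h1, h2⟩ := exists_raise key cur (fun x => key x < cur x ∨ x ∈ f.hd.W.ms) f.tl hkn
  have hcur : ∀ n ∈ f.tl, ∀ x ∈ n.K.ms, cur x ≤ cur' x := by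
    intro n hn x hx
    by_cases hP : key x < cur x ∨ x ∈ f.hd.W.ms
    · rw [h1 n hn x hx hP]
      exact (hnode n hn).K_cur x hx
    · exact (h2 x fun h => absurd h hP).ge
  have hlt : ∀ n ∈ f.tl, ∀ x ∈ n.K.ms, (key x < cur x ∨ x ∈ f.hd.W.ms) → key x < cur' x := by
    intro n hn x hx hP
    rw [h1 n hn x hx hP]
    exact (hnode n hn).K_lt x hx
  refine ⟨cur', fun c hc => ?_, fun x hx => h2 x fun _ => hx, fun x hx => ?_, fun x hx => ?_,
    fun x hx hlt => ?_⟩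
  · cases htl : f.tl with
    | nil => simp [htl, cellsOf] at hc
    | cons m l =>
      rw [htl, cellsOf, List.mem_singleton] at hc
      subst hc
      rw [htl] at hs hd ha hl hnode h1 h2 hnd hwn hlt hcur hw
      have hsm : ∀ n ∈ m :: l, key m.c ≤ key n.c :=
        List.forall_mem_cons.2 ⟨le_rfl, (List.pairwise_cons.1 hs.of_cons).1⟩
      refine ⟨hs.of_cons, fun n hn => ?_, fun n hn => h.size n ?_, ?_, hd.2,
        (Multiset.le_add_left _ _).trans hw, ?_⟩
      · have hn' := hnode n hn
        refine { hn' with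
          le_key := hsm n hn, T_cur := ?_, K_le := ?_, K_lo := ?_, K_cur := ?_, W_cur := ?_ }
        · intro x hx
          -- Items are distinct, so an item of `T` lies in no `K` and keeps its current key.
          rw [h2 x fun _ hx' => hnd.2.2 (Multiset.mem_add.2 (.inr (mem_ttot.2 ⟨n, hn, hx⟩))) hx']
          exact hn'.T_cur x hx
        · exact fun x hx => (hn'.K_le x hx).trans (hcur n hn x hx)
        · intro x hx
          by_cases hP : key x < cur x ∨ x ∈ f.hd.W.ms
          · rw [h1 n hn x hx hP]
            exact hsm n hn
          · rw [h2 x fun h => absurd h hP]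
            -- An item that is not raised still has a witness, whose key lies between the key of the
            -- new head and that of the item.
            rcases ha.2.exists_witness (mem_ktot.2 ⟨n, hn, hx⟩) with h | h
            · exact absurd h hP
            · obtain ⟨e, he, hxe⟩ := mem_wtot.1 h
              rw [(hnode e he).W_cur x hxe]
              exact (hsm e he).trans ((hnode e he).W_key x hxe)
        · intro x hx
          by_cases hP : key x < cur x ∨ x ∈ f.hd.W.ms
          · rw [h1 n hn x hx hP]
          · rw [h2 x fun h => absurd h hP]
            exact hn'.K_cur x hx
        · intro x hx
          have hxw := mem_wtot.2 ⟨n, hn, hx⟩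
          -- A witnessed item is not corrupt and has no second witness in the dead node, so it is
          -- not raised.
          rw [h2 x, hn'.W_cur x hx]
          rintro (h | h)
          · rw [hn'.W_cur x hx] at h
            exact absurd h (lt_irrefl _)
          · exact absurd hxw (hwn.2.2 h)
      · rw [Cell.seq, htl]
        exact List.mem_cons_of_mem _ hn
      · simp only [Cell.seq, List.length_cons] at hl ⊢
        omega
      · refine ha.2.mono fun x hx hP => ?_
        obtain ⟨n, hn, hx⟩ := mem_ktot.1 hx
        exact hlt n hn x hx hP
  · obtain ⟨n, hn, hx⟩ := mem_ktot.1 hx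
    exact hcur n hn x hx
  · obtain ⟨n, hn, hxn⟩ := mem_ktot.1 (hWk x hx)
    exact ⟨hWk x hx, (h.node f.hd (by simp [Cell.seq])).W_cur x hx, hlt n hn x hxn (.inr hx)⟩
  · by_contra hP
    rw [h2 x fun h => absurd h hP] at hlt
    exact hP (.inl hlt)

end

section

variable {V : Type*}

/-! ## The soft heap -/

def totItems (L : List (Cell V)) : Multiset V := (L.map Cell.items).sum

@[simp] theorem totItems_nil : totItems ([] : List (Cell V)) = 0 := rfl
@[simp] theorem totItems_cons (c : Cell V) (L : List (Cell V)) :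
    totItems (c :: L) = c.items + totItems L := by
  simp [totItems]

theorem mem_totItems {L : List (Cell V)} {x : V} : x ∈ totItems L ↔ ∃ c ∈ L, x ∈ c.items := by
  induction L with
  | nil => simp
  | cons c L ih => simp [ih]

theorem totItems_cellsOf {r : ℕ} {l : List (Nd V)} :
    totItems (cellsOf r l) = ttot l + ktot l := by
  cases l with
  | nil => rfl
  | cons n l => simp [cellsOf, Cell.items, Cell.seq]

end

section

variable {V α : Type*} [LinearOrder α]

/-- In `ins` there is only an inequality, because emptied sequences disappear while insertions
continue to count. -/
structure HeapInv (key : V → α) (L : List (Cell V)) (s : SoftHeapState V α) : Prop where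
  find : Findable key L
  cell : ∀ c ∈ L, CellInv key s.curKey c
  items : s.items.val = totItems L
  ins : (L.map fun c => 2 ^ c.rank).sum ≤ s.insertions

theorem HeapInv.mem_items {key : V → α} {L : List (Cell V)} {s : SoftHeapState V α}
    (h : HeapInv key L s) {x : V} : x ∈ s.items ↔ x ∈ totItems L := by
  rw [← Finset.mem_val, h.items]

theorem HeapInv.key_le {key : V → α} {L : List (Cell V)} {s : SoftHeapState V α}
    (h : HeapInv key L s) {x : V} (hx : x ∈ s.items) : key x ≤ s.curKey x := by
  obtain ⟨c, hc, hx⟩ := mem_totItems.1 (h.mem_items.1 hx)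
  exact ((h.cell c hc).le_cur hx).2

open Classical in
theorem card_corrupt_le {key cur : V → α} {L : List (Cell V)}
    (h : ∀ c ∈ L, CellInv key cur c) :
    4 * Multiset.card ((totItems L).filter fun x => key x < cur x) ≤
      (L.map fun c => 2 ^ c.rank).sum := by
  induction L with
  | nil => simp
  | cons c L ih =>
    rw [List.forall_mem_cons] at h
    have h1 := ih h.2
    have h2 := h.1.card_corrupt_le
    have h3 := corBound_le c.rank
    rw [totItems_cons, Multiset.filter_add, Multiset.card_add, List.map_cons, List.sum_cons]
    omega

theorem HeapInv.corrupt_le {W : Items V α} {L : List (Cell V)} {s : SoftHeapState V α}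
    (h : HeapInv W.key L s) :
    ({v | s.Corrupt W v}.ncard : ℚ) ≤ 1 / 4 * s.insertions := by
  classical
  have h1 := card_corrupt_le h.cell
  have h2 : {v | s.Corrupt W v} = ↑(s.items.filter fun x => W.key x < s.curKey x) := by
    ext v
    simp [SoftHeapState.Corrupt]
  rw [h2, Set.ncard_coe_finset, Finset.card_def, Finset.filter_val, h.items]
  have h3 := h1.trans h.ins
  rify at h3
  have h4 : ((4 * Multiset.card ((totItems L).filter fun x => W.key x < s.curKey x) : ℕ) : ℚ) ≤
      s.insertions := by exact_mod_cast h1.trans h.ins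
  push_cast at h4
  linarith

noncomputable def totPot (L : List (Cell V)) : ℝ := (L.map Cell.pot).sum

theorem totPot_cons (c : Cell V) (L : List (Cell V)) : totPot (c :: L) = c.pot + totPot L := by
  simp [totPot]

/-! ### Correctness and amortized cost of the operations -/

theorem insert_spec {W : Items V α} {L : List (Cell V)} {s : SoftHeapState V α}
    (h : HeapInv W.key L s) {v : V} (hv : v ∉ s.items) :
    RetQ W insertP (.pair (encList Cell.enc L) (.item v)) fun r t => ∃ L',
      r = encList Cell.enc L' ∧ ∃ s', HeapInv W.key L' s' ∧ s.InsertStep W v s' ∧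
        t + totPot L' ≤ 300 + reserve 0 + totPot L := by
  classical
  set c : Cell V := ⟨0, ⟨v, .cons v .nil, .nil, .nil⟩, []⟩ with hc
  set cur : V → α := fun u => if u = v then W.key v else s.curKey u with hcur
  have hci : c.items = {v} := by simp [hc, Cell.items, Cell.seq, Bag.ms]
  have hv' : v ∉ totItems L := fun hv' => hv (h.mem_items.2 hv')
  have hcv : cur v = W.key v := if_pos rfl
  have hcu : ∀ u, u ≠ v → cur u = s.curKey u := fun u hu => if_neg hu
  have hcinv : CellInv W.key cur c := by
    refine ⟨List.pairwise_singleton _ _, ?_, ?_, ?_, ?_, ?_, ?_⟩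
    · refine List.forall_mem_singleton.2 ?_
      constructor <;> simp [hc, Bag.ms, hcv]
    · refine List.forall_mem_singleton.2 ?_
      simp [hc, SzLe, Bag.sz, bagBound]
    · simp [hc, Cell.seq, lenBound]
    · simp [hc, Cell.seq, Dle, Bag.ms]
    · simp [hc, Cell.seq, Bag.ms]
    · simp [hc, Cell.seq, Adm, Bag.ms]
  have hL : ∀ g ∈ L, CellInv W.key cur g := fun g hg => (h.cell g hg).congr fun x hx =>
    hcu x fun hxv => hv' (mem_totItems.2 ⟨g, hg, hxv ▸ hx⟩)
  -- The single node contributes 100, the one cell of its empty bag `W` contributes 20.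
  have hpot : c.pot = reserve 0 + 120 := by
    simp [hc, Cell.pot, Cell.seq, Bag.pot, Bag.sz]
    norm_num [add_assoc]
  refine RetQ.of_body insertP.eq_1 ?_
  simp [five]
  refine (carryP_spec W h.find hcinv hL fun _ _ => Nat.zero_le _).mono ?_
  rintro r t ⟨L', rfl, h1, h2, h3, h4, h5⟩
  have h3' : totItems L' = v ::ₘ totItems L := by
    rw [totItems, h3, hci, Multiset.singleton_add, totItems]
  have hnd : (totItems L').Nodup := by
    rw [h3', Multiset.nodup_cons, ← h.items]
    exact ⟨fun hv' => hv hv', s.items.nodup⟩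
  refine Post.intro ⟨L', rfl, ⟨⟨totItems L', hnd⟩, cur, s.insertions + 1⟩,
    ⟨h1, h2, rfl, ?_⟩, ⟨fun u => ?_, hcv, fun u hu => hcu u fun h => hv (h ▸ hu), rfl⟩, ?_⟩
  · rw [h4]
    have := h.ins
    simp only [hc, pow_zero]
    omega
  · rw [Finset.mem_mk, h3', Multiset.mem_cons, h.mem_items]
  · rw [hpot] at h5
    simp only [totPot]
    push_cast
    linarith

theorem totItems_perm {L M : List (Cell V)} (h : L.Perm M) : totItems L = totItems M :=
  (h.map _).sum_eq

theorem HeapInv.nodup {key : V → α} {L : List (Cell V)} {s : SoftHeapState V α}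
    (h : HeapInv key L s) : (totItems L).Nodup :=
  h.items ▸ s.items.nodup

/-- The current key of an item in the first node of a heap is smallest. -/
theorem HeapInv.cur_le {key : V → α} {f : Cell V} {L : List (Cell V)} {s : SoftHeapState V α}
    (h : HeapInv key (f :: L) s) {x : V} (hx : x ∈ f.hd.T.ms ∨ x ∈ f.hd.K.ms) :
    x ∈ s.items ∧ ∀ u ∈ s.items, s.curKey x ≤ s.curKey u := by
  have hn := (h.cell f (by simp)).node f.hd (by simp [Cell.seq])
  have h1 : s.curKey x ≤ key f.hd.c :=
    hx.elim (fun hx => (hn.T_cur x hx).le) (fun hx => hn.K_cur x hx)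
  refine ⟨h.mem_items.2 ?_, fun u hu => h1.trans ?_⟩
  · simp only [totItems_cons, Cell.items, Cell.seq, ttot_cons, ktot_cons, Multiset.mem_add]
    tauto
  · obtain ⟨c, hc, hu⟩ := mem_totItems.1 (h.mem_items.1 hu)
    refine le_trans ?_ ((h.cell c hc).le_cur hu).1
    rcases List.mem_cons.1 hc with rfl | hc
    · exact le_rfl
    · exact h.find.head_le c hc

theorem HeapInv.popped_corrupt {W : Items V α} {f : Cell V} {L : List (Cell V)}
    {s : SoftHeapState V α} (h : HeapInv W.key (f :: L) s) {x : V} {b : Val V} {n : Nd V}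
    (hp : Popped f.hd x b n) :
    x ∈ s.items ∧ (∀ u ∈ s.items, s.curKey x ≤ s.curKey u) ∧
      (b.truthy = true ↔ s.Corrupt W x) := by
  have hc := h.cell f (by simp)
  have hn := hc.node f.hd (by simp [Cell.seq])
  rcases hp.cases with ⟨hb, hK, -⟩ | ⟨hb, -, -, hT⟩
  · have hx : x ∈ f.hd.K.ms := by simp [hK]
    have h1 := h.cur_le (.inr hx)
    exact ⟨h1.1, h1.2, by simp [hb, SoftHeapState.Corrupt, h1.1, hc.adm.1 x hx]⟩
  · have hx : x ∈ f.hd.T.ms := by simp [hT]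
    have h1 := h.cur_le (.inl hx)
    exact ⟨h1.1, h1.2, by simp [hb, SoftHeapState.Corrupt, hn.T_cur x hx, hn.T_key x hx]⟩

theorem Popped.items {f : Cell V} {x : V} {b : Val V} {n : Nd V} (hp : Popped f.hd x b n) :
    f.items = x ::ₘ Cell.items ⟨f.rank, n, f.tl⟩ := by
  simp only [Cell.items, Cell.seq, ttot_cons, ktot_cons]
  rcases hp.cases with ⟨-, hK, hT⟩ | ⟨-, hK, hK', hT⟩
  · rw [hK, hT, ← Multiset.singleton_add, ← Multiset.singleton_add]
    abel
  · rw [hK, hT, hK', ← Multiset.singleton_add, ← Multiset.singleton_add]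
    abel

theorem Finset.mem_mk_iff_of_cons {V : Type*} {s : Finset V} {x : V} {m : Multiset V}
    (h : s.val = x ::ₘ m) (hm : m.Nodup) (u : V) : u ∈ (⟨m, hm⟩ : Finset V) ↔ u ∈ s ∧ u ≠ x := by
  have hs := s.nodup
  rw [h, Multiset.nodup_cons] at hs
  rw [Finset.mem_mk, ← Finset.mem_val, h, Multiset.mem_cons]
  constructor
  · exact fun hu => ⟨.inr hu, fun hux => hs.1 (hux ▸ hu)⟩
  · rintro ⟨hu | hu, hux⟩
    exacts [absurd hu hux, hu]

theorem extract_live {W : Items V α} {f : Cell V} {L : List (Cell V)} {s : SoftHeapState V α}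
    (h : HeapInv W.key (f :: L) s) {x : V} {b : Val V} {n : Nd V} (hp : Popped f.hd x b n)
    (hT : n.T.ms ≠ 0) (hL : Findable W.key (⟨f.rank, n, f.tl⟩ :: L)) :
    ∃ s', HeapInv W.key (⟨f.rank, n, f.tl⟩ :: L) s' ∧ s.ExtractStep W x [] s' ∧
      (b.truthy = true ↔ s.Corrupt W x) := by
  obtain ⟨h1, h2, h3⟩ := h.popped_corrupt hp
  have hit : s.items.val = x ::ₘ totItems (⟨f.rank, n, f.tl⟩ :: L) := by
    rw [h.items, totItems_cons, totItems_cons, hp.items, Multiset.cons_add]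
  have hnd : (totItems (⟨f.rank, n, f.tl⟩ :: L)).Nodup := by
    have := s.items.nodup
    rw [hit] at this
    exact (Multiset.nodup_cons.1 this).2
  have hmem := Finset.mem_mk_iff_of_cons hit hnd
  refine ⟨⟨⟨_, hnd⟩, s.curKey, s.insertions⟩, ⟨hL, ?_, rfl, h.ins⟩,
    ⟨h1, h2, hmem, fun _ _ => le_rfl, rfl, List.nodup_nil, fun u => ?_⟩, h3⟩
  · refine List.forall_mem_cons.2 ⟨?_, fun c hc => h.cell c (List.mem_cons_of_mem _ hc)⟩
    have hKT : n.T.ms ≤ f.hd.T.ms ∧ n.K.ms ≤ f.hd.K.ms := by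
      rcases hp.cases with ⟨-, hK, hT⟩ | ⟨-, hK, hK', hT⟩
      · rw [hK, hT]
        exact ⟨le_rfl, Multiset.le_cons_self _ _⟩
      · rw [hK, hT, hK']
        exact ⟨Multiset.le_cons_self _ _, le_rfl⟩
    exact (h.cell f (by simp)).shrink hp.c_eq hp.W_eq hKT.1 hKT.2 hp.T_sz hp.K_sz hT
  · simp only [SoftHeapState.Corrupt, List.not_mem_nil, false_iff, hmem]
    exact fun h => h.2 ⟨h.1.1.1, h.1.2⟩

/-- The death of a node is the only event that changes current keys of items in the heap, and only
inside its own sequence. -/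
theorem extract_dead {W : Items V α} {f : Cell V} {L L' : List (Cell V)}
    {s : SoftHeapState V α} (h : HeapInv W.key (f :: L) s) {x : V} {b : Val V} {n : Nd V}
    (hp : Popped f.hd x b n) (hT : n.T.ms = 0) {C : List V} (hC : (C : Multiset V) = f.hd.W.ms)
    (hL' : Findable W.key L') (hperm : L'.Perm (cellsOf f.rank f.tl ++ L)) :
    ∃ s', HeapInv W.key L' s' ∧ s.ExtractStep W x C s' ∧
      (b.truthy = true ↔ s.Corrupt W x) := by
  obtain ⟨h1, h2, h3⟩ := h.popped_corrupt hp
  have hfc := h.cell f (by simp)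
  have hT0 := (hfc.node f.hd (by simp [Cell.seq])).T_ne
  -- A removal from `K` would leave the nonempty `T` unchanged, so the last item came from `T`, and
  -- `K` was empty.
  obtain ⟨hK, hK', hx⟩ : f.hd.K.ms = 0 ∧ n.K.ms = 0 ∧ f.hd.T.ms = x ::ₘ n.T.ms := by
    rcases hp.cases with ⟨-, -, hT'⟩ | ⟨-, h⟩
    · exact absurd (hT' ▸ hT) hT0
    · exact h
  have hfi := hp.items
  simp only [Cell.items, Cell.seq, ttot_cons, ktot_cons, hK', hT, zero_add] at hfi
  have hit : s.items.val = x ::ₘ totItems L' := by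
    rw [h.items, totItems_cons, totItems_perm hperm, totItems, totItems, List.map_append,
      List.sum_append, ← totItems, ← totItems, totItems_cellsOf, ← Multiset.cons_add,
      ← hfi]
    rfl
  have hnd := h.nodup
  rw [totItems_cons, Multiset.nodup_add] at hnd
  obtain ⟨cur, hc1, hc2, hc3, hc4, hc5⟩ := hfc.pop hnd.1 hK
  have hktot : ∀ u ∈ ktot f.tl, u ∈ f.items := fun u hu => by
    simp [Cell.items, Cell.seq, hu]
  have hnd' : (totItems L').Nodup := by
    have := s.items.nodup
    rw [hit] at this
    exact (Multiset.nodup_cons.1 this).2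
  have hmem := Finset.mem_mk_iff_of_cons hit hnd'
  have hWn : f.hd.W.ms.Nodup := by
    have := hfc.wit
    simp only [Cell.seq, wtot_cons] at this
    refine Multiset.nodup_of_le ((Multiset.le_add_right _ _).trans this) ?_
    exact (Multiset.nodup_add.1 hnd.1).2.1
  have hxk : x ∉ ktot f.tl := by
    have := hnd.1
    rw [Cell.items, Cell.seq, ttot_cons, ktot_cons, Multiset.nodup_add,
      Multiset.disjoint_left] at this
    have h4 : x ∈ f.hd.T.ms + ttot f.tl := by simp [hx]
    exact fun hx' => this.2.2 h4 (Multiset.mem_add.2 (.inr hx'))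
  refine ⟨⟨⟨_, hnd'⟩, cur, s.insertions⟩, ⟨hL', fun c hc => ?_, rfl, ?_⟩,
    ⟨h1, h2, hmem, fun u _ => ?_, rfl, ?_, fun u => ?_⟩, h3⟩
  · rcases List.mem_append.1 (hperm.mem_iff.1 hc) with hc | hc
    · exact hc1 c hc
    · refine (h.cell c (List.mem_cons_of_mem _ hc)).congr fun u hu => hc2 u fun hu' => ?_
      exact Multiset.disjoint_left.1 hnd.2.2 (hktot u hu') (mem_totItems.2 ⟨c, hc, hu⟩)
  · rw [(hperm.map _).sum_eq, List.map_append, List.sum_append]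
    have := h.ins
    rw [List.map_cons, List.sum_cons] at this
    refine le_trans ?_ this
    gcongr
    cases f.tl <;> simp [cellsOf]
  · by_cases hu : u ∈ ktot f.tl
    · exact hc3 u hu
    · exact (hc2 u hu).ge
  · rw [← Multiset.coe_nodup, hC]
    exact hWn
  · rw [← Multiset.mem_coe, hC]
    simp only [SoftHeapState.Corrupt, hmem]
    constructor
    · intro hu
      obtain ⟨hu1, hu2, hu3⟩ := hc4 u hu
      have hus : u ∈ s.items := h.mem_items.2 (by simp [hktot u hu1])
      exact ⟨⟨⟨hus, fun hux => hxk (hux ▸ hu1)⟩, hu3⟩, fun h => by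
        rw [hu2] at h
        exact lt_irrefl _ h.2⟩
    · rintro ⟨⟨⟨hus, -⟩, hlt⟩, hn⟩
      by_cases hu : u ∈ ktot f.tl
      · exact (hc5 u hu hlt).resolve_left fun h => hn ⟨hus, h⟩
      · rw [hc2 u hu] at hlt
        exact absurd ⟨hus, hlt⟩ hn

noncomputable def heapCost : ℕ := 400 + ⌈reserve 0⌉₊

theorem extract_spec {W : Items V α} {L : List (Cell V)} {s : SoftHeapState V α}
    (h : HeapInv W.key L s) (hs : s.items.Nonempty) :
    RetQ W extractP (encList Cell.enc L) fun r t => ∃ L' s' e b C,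
      r = .pair (.item e) (.pair b (.pair (.ofList C) (encList Cell.enc L'))) ∧
      HeapInv W.key L' s' ∧ s.ExtractStep W e C s' ∧ (b.truthy = true ↔ s.Corrupt W e) ∧
      t + totPot L' ≤ 400 + totPot L := by
  cases L with
  | nil =>
    obtain ⟨x, hx⟩ := hs
    have := h.mem_items.1 hx
    simp at this
  | cons f L =>
    refine (extractP_spec W h.find ((h.cell f (by simp)).node f.hd (by simp [Cell.seq])).T_ne).mono
      ?_
    rintro r t ⟨x, b, n, C, L', rfl, hp, hL', ⟨hT, rfl, rfl, ht⟩ | ⟨hT, hC, hperm, ht⟩⟩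
    · obtain ⟨s', h1, h2, h3⟩ := extract_live h hp hT hL'
      refine ⟨_, s', x, b, [], rfl, h1, h2, h3, ?_⟩
      rw [totPot_cons, totPot_cons, Cell.pot, Cell.pot, hp.W_eq]
      have ht' : (t : ℝ) + 20 * (n.K.pot + n.T.pot) ≤ 300 + 20 * (f.hd.K.pot + f.hd.T.pot) := by
        exact_mod_cast ht
      simp only [Cell.seq, List.length_cons]
      linarith
    · obtain ⟨s', h1, h2, h3⟩ := extract_dead h hp hT hC hL' hperm
      refine ⟨_, s', x, b, C, rfl, h1, h2, h3, ?_⟩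
      have ht' : (t : ℝ) ≤ 300 + 20 * (f.hd.K.pot + f.hd.T.pot) + 20 * f.hd.W.sz +
          90 * (f.rank + 1) := by
        exact_mod_cast ht
      -- The next node becomes the head; its `K` and `T` are now charged for `pot` only. The dead
      -- node's 100 (rank + 1) pays for the 90 (rank + 1) of `fixP`.
      have h4 : totPot (cellsOf f.rank f.tl) ≤
          reserve f.rank + 100 * (f.rank + 1) * f.tl.length + 20 * fpot f.tl := by
        cases f.tl with
        | nil => simp [cellsOf, totPot, reserve_nonneg]
        | cons m l =>
          have h5 : m.K.pot + m.T.pot + m.W.sz + fpot l ≤ fpot (m :: l) := by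
            have := m.K.pot_le_sz
            have := m.T.pot_le_sz
            rw [fpot_cons]
            omega
          rify at h5
          simp only [cellsOf, totPot, List.map_cons, List.map_nil, List.sum_cons, List.sum_nil,
            Cell.pot, Cell.seq]
          linarith
      have h6 : totPot L' = totPot (cellsOf f.rank f.tl) + totPot L := by
        rw [totPot, (hperm.map _).sum_eq, List.map_append, List.sum_append, totPot, totPot]
      rw [h6, totPot_cons, Cell.pot]
      have h7 : (0 : ℝ) ≤ f.rank := Nat.cast_nonneg _
      simp only [Cell.seq, List.length_cons]
      push_cast
      nlinarith

theorem totPot_nonneg (L : List (Cell V)) : 0 ≤ totPot L :=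
  List.sum_nonneg (by
    intro x hx
    obtain ⟨c, -, rfl⟩ := List.mem_map.1 hx
    exact c.pot_nonneg)

theorem add_ceil_le {t a b : ℕ} {x y : ℝ} (hx : 0 ≤ x) (h : t + x ≤ b + y) (hb : b ≤ a) :
    t + ⌈x⌉₊ ≤ a + ⌈y⌉₊ := by
  have h1 : (t : ℝ) + x ≤ ((b + ⌈y⌉₊ : ℕ) : ℝ) := by
    push_cast
    linarith [Nat.le_ceil y]
  have h2 : t ≤ b + ⌈y⌉₊ := by exact_mod_cast (le_add_of_nonneg_right hx).trans h1
  have h3 : ⌈x⌉₊ ≤ b + ⌈y⌉₊ - t := by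
    rw [Nat.ceil_le, Nat.cast_sub h2]
    linarith
  omega

theorem isSoftHeap (W : Items V α) : IsSoftHeap W softHeap (1 / 4) heapCost := by
  -- The potential must depend on the represented value. Minimizing over all lists with this
  -- encoding avoids proving the encoding injective; rounding up makes it an integer.
  set A : Val V → SoftHeapState V α → Set ℕ := fun q s =>
    {n | ∃ L, q = encList Cell.enc L ∧ HeapInv W.key L s ∧ n = ⌈totPot L⌉₊} with hA
  have hmin : ∀ q s, (∃ L, q = encList Cell.enc L ∧ HeapInv W.key L s) →
      ∃ L, q = encList Cell.enc L ∧ HeapInv W.key L s ∧ sInf (A q s) = ⌈totPot L⌉₊ := by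
    rintro q s ⟨L, hq, hL⟩
    exact Nat.sInf_mem (s := A q s) ⟨_, L, hq, hL, rfl⟩
  have hle : ∀ L s, HeapInv W.key L s → sInf (A (encList Cell.enc L) s) ≤ ⌈totPot L⌉₊ :=
    fun L s hL => Nat.sInf_le ⟨L, rfl, hL, rfl⟩
  refine ⟨fun q s => ∃ L, q = encList Cell.enc L ∧ HeapInv W.key L s, fun q s => sInf (A q s),
    ?_, ?_, ?_, ?_⟩
  · rintro q s ⟨L, rfl, hL⟩
    exact ⟨fun v hv => hL.key_le hv, hL.corrupt_le⟩
  · have hL : HeapInv W.key [] (⟨∅, W.key, 0⟩ : SoftHeapState V α) :=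
      ⟨.nil, by simp, by simp, by simp⟩
    refine ⟨.num 0, ⟨∅, W.key, 0⟩, 1, 0, ⟨_, .skip _ _, rfl⟩, ⟨[], rfl, hL⟩, rfl, rfl, ?_⟩
    have := hle [] _ hL
    simp only [totPot, List.map_nil, List.sum_nil, Nat.ceil_zero] at this
    simp only [encList] at this
    simp only [heapCost]
    omega
  · rintro q s v hq hv
    obtain ⟨L, rfl, hL, hmin⟩ := hmin q s hq
    obtain ⟨r, t, m, hret, L', rfl, s', h1, h2, h3⟩ := insert_spec hL hv
    refine ⟨_, s', t, m, hret, ⟨L', rfl, h1⟩, h2, ?_⟩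
    show t + sInf (A _ s') ≤ heapCost + sInf (A _ s)
    rw [hmin]
    refine (add_le_add_right (hle L' s' h1) t).trans ?_
    refine add_ceil_le (b := 300 + ⌈reserve 0⌉₊) (totPot_nonneg L') ?_ (by unfold heapCost; omega)
    push_cast
    linarith [Nat.le_ceil (reserve 0)]
  · rintro q s hq hs
    obtain ⟨L, rfl, hL, hmin⟩ := hmin q s hq
    obtain ⟨r, t, m, hret, L', s', e, b, C, rfl, h1, h2, h3, h4⟩ := extract_spec hL hs
    refine ⟨_, s', e, b, C, t, m, hret, ⟨L', rfl, h1⟩, h2, h3, ?_⟩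
    show t + sInf (A _ s') ≤ heapCost + sInf (A _ s)
    rw [hmin]
    refine (add_le_add_right (hle L' s' h1) t).trans ?_
    exact add_ceil_le (b := 400) (totPot_nonneg L') h4 (by unfold heapCost; omega)

end

end SoftSeq

/-! ## Selection with a soft heap -/

/-- `Rep` and `Φ` witness that `H` is a soft heap with error parameter `1 / 4` and amortized time at
most `a`. -/
structure HeapSpec {V α : Type*} [LinearOrder α] (W : Items V α) (H : SoftHeapProgs) (a : ℕ)
    (Rep : Val V → SoftHeapState V α → Prop) (Φ : Val V → SoftHeapState V α → ℕ) : Prop where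
  key_le : ∀ {q s}, Rep q s → ∀ v ∈ s.items, W.key v ≤ s.curKey v
  corrupt_le : ∀ {q s}, Rep q s → 4 * {v | s.Corrupt W v}.ncard ≤ s.insertions
  create : RetQ W H.create (.num 0) fun q t => ∃ s, Rep q s ∧ s.items = ∅ ∧ s.insertions = 0 ∧
    t + Φ q s ≤ a
  insert : ∀ {q s v}, Rep q s → v ∉ s.items →
    RetQ W H.insert (.pair q (.item v)) fun q' t => ∃ s', Rep q' s' ∧ s.InsertStep W v s' ∧
      t + Φ q' s' ≤ a + Φ q s
  extract : ∀ {q s}, Rep q s → s.items.Nonempty →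
    RetQ W H.extractMin q fun r t => ∃ q' s' e b C,
      r = .pair (.item e) (.pair b (.pair (.ofList C) q')) ∧ Rep q' s' ∧ s.ExtractStep W e C s' ∧
      (b.truthy = true ↔ s.Corrupt W e) ∧ t + Φ q' s' ≤ a + Φ q s

theorem IsSoftHeap.heapSpec {V α : Type*} [LinearOrder α] {W : Items V α} {H : SoftHeapProgs}
    {a : ℕ} (h : IsSoftHeap W H (1 / 4) a) : ∃ Rep Φ, HeapSpec W H a Rep Φ := by
  obtain ⟨Rep, Φ, h1, h2, h3, h4⟩ := h
  refine ⟨Rep, Φ, fun hq => (h1 _ _ hq).1, fun {q s} hq => ?_, ?_, fun {q s v} hq hv => ?_,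
    fun {q s} hq hs => ?_⟩
  · have := (h1 _ _ hq).2
    have h5 : (4 * {v | s.Corrupt W v}.ncard : ℚ) ≤ s.insertions := by linarith
    exact_mod_cast h5
  · obtain ⟨q, s, t, m, h5, h6⟩ := h2
    exact ⟨q, t, m, h5, s, h6⟩
  · obtain ⟨q', s', t, m, h5, h6⟩ := h3 q s v hq hv
    exact ⟨q', t, m, h5, s', h6⟩
  · obtain ⟨q', s', e, b, C, t, m, h5, h6⟩ := h4 q s hq hs
    exact ⟨_, t, m, h5, q', s', e, b, C, rfl, h6⟩

theorem IsSoftHeap.mono {V α : Type*} [LinearOrder α] {W : Items V α} {H : SoftHeapProgs} {ε : ℚ}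
    {a b : ℕ} (h : IsSoftHeap W H ε a) (hab : a ≤ b) : IsSoftHeap W H ε b := by
  obtain ⟨Rep, Φ, h1, ⟨q, s, t, m, h2, h3, h4, h5, h6⟩, h7, h8⟩ := h
  refine ⟨Rep, Φ, h1, ⟨q, s, t, m, h2, h3, h4, h5, h6.trans hab⟩, fun q s v hq hv => ?_,
    fun q s hq hs => ?_⟩
  · obtain ⟨q', s', t, m, h9, h10, h11, h12⟩ := h7 q s v hq hv
    exact ⟨q', s', t, m, h9, h10, h11, h12.trans (Nat.add_le_add_right hab _)⟩
  · obtain ⟨q', s', e, b, C, t, m, h9, h10, h11, h12, h13⟩ := h8 q s hq hs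
    exact ⟨q', s', e, b, C, t, m, h9, h10, h11, h12, h13.trans (Nat.add_le_add_right hab _)⟩

/-! ### Quickselect with a pivot from a soft heap -/

namespace SoftSeq

/-- Inserts the items of a list into a soft heap. -/
def fillP (H : SoftHeapProgs) : Prog :=
  .block [.assign 1 (.head 0), .assign 0 (.tail 0),
    .cond 1
      (.block [.assign 2 (.head 1), .assign 1 (.tail 1), .assign 2 (.pair 0 2),
        .call 0 H.insert 2, .assign 1 (.pair 1 0), .recur 0 1])
      .skip]

/-- `drainP (l, (p, q))` extracts an item for every four elements of `l` and returns a largest one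
among these items and `p`. -/
def drainP (H : SoftHeapProgs) : Prog :=
  .block [.assign 1 (.head 0), .assign 2 (.tail 0), .assign 0 (.head 2),
    .cond 1
      (.block [.assign 2 (.tail 2), .call 3 H.extractMin 2, .assign 4 (.head 3),
        .assign 3 (.tail 3), .assign 3 (.tail 3), .assign 3 (.tail 3),
        .assign 5 (.compare 4 0), .cond 5 .skip (.assign 0 (.copy 4)),
        .assign 1 (.tail 1), .assign 1 (.tail 1), .assign 1 (.tail 1), .assign 1 (.tail 1),
        .assign 3 (.pair 0 3), .assign 1 (.pair 1 3), .recur 0 1])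
      .skip]

/-- Finds an approximate median of a list. -/
def pivotP (H : SoftHeapProgs) : Prog :=
  .block [.assign 1 .zero, .call 1 H.create 1, .assign 1 (.pair 0 1), .call 1 (fillP H) 1,
    .call 2 H.extractMin 1, .assign 3 (.head 2), .assign 2 (.tail 2), .assign 2 (.tail 2),
    .assign 2 (.tail 2), .assign 0 (.tail 0), .assign 0 (.tail 0), .assign 0 (.tail 0),
    .assign 0 (.tail 0), .assign 3 (.pair 3 2), .assign 0 (.pair 0 3), .call 0 (drainP H) 0]

/-- `partP (p, (l, (L, (E, G))))` distributes the items of `l` to the lists `L`, `E` and `G`,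
according to whether their keys are less than, equal to or greater than that of `p`. -/
def partP : Prog :=
  .block [.assign 1 (.head 0), .assign 2 (.tail 0), .assign 3 (.head 2), .assign 2 (.tail 2),
    .cond 3
      (.block [.assign 4 (.head 3), .assign 3 (.tail 3), .assign 5 (.head 2),
        .assign 6 (.tail 2), .assign 7 (.head 6), .assign 6 (.tail 6),
        .assign 8 (.compare 4 1), .assign 9 (.compare 1 4),
        .cond 8 (.cond 9 (.assign 7 (.pair 4 7)) (.assign 5 (.pair 4 5)))
          (.assign 6 (.pair 4 6)),
        .assign 6 (.pair 7 6), .assign 6 (.pair 5 6), .assign 6 (.pair 3 6),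
        .assign 6 (.pair 1 6), .recur 0 6])
      (.assign 0 (.copy 2))]

/-- `moveP (l, (k, acc))` moves items from `l` to `acc`, but at most `k`. -/
def moveP : Prog :=
  .block [.assign 1 (.head 0), .assign 0 (.tail 0), .assign 2 (.head 0),
    .cond 1
      (.cond 2
        (.block [.assign 3 (.tail 0), .assign 4 (.head 1), .assign 1 (.tail 1),
          .assign 3 (.pair 4 3), .assign 2 (.pred 2), .assign 2 (.pair 2 3),
          .assign 1 (.pair 1 2), .recur 0 1])
        .skip)
      .skip]

/-- `selP (l, (k, acc))` puts `k` smallest items of `l` in front of `acc`. -/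
def selP (H : SoftHeapProgs) : Prog :=
  .block [.assign 1 (.head 0), .assign 0 (.tail 0), .call 2 (pivotP H) 1, .assign 3 .zero,
    .assign 4 (.pair 3 3), .assign 4 (.pair 3 4), .assign 4 (.pair 1 4), .assign 4 (.pair 2 4),
    .call 1 partP 4, .assign 2 (.head 1), .assign 1 (.tail 1), .assign 3 (.head 1),
    .assign 4 (.tail 1), .assign 5 (.pair 2 0), .call 5 moveP 5, .assign 6 (.head 5),
    .cond 6
      (.block [.assign 5 (.pair 3 5), .call 5 moveP 5, .assign 6 (.head 5),
        .cond 6 (.block [.assign 5 (.pair 4 5), .recur 0 5]) (.assign 0 (.tail 5))])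
      (.block [.assign 5 (.pair 2 0), .recur 0 5])]

/-- Selection of the `k` smallest items of a list. -/
def selectP (H : SoftHeapProgs) : Prog :=
  .block [.assign 1 (.head 0), .assign 2 (.tail 0), .assign 3 .zero, .assign 2 (.pair 2 3),
    .assign 1 (.pair 1 2), .call 0 (selP H) 1]

section

variable {V α : Type*} [LinearOrder α] {W : Items V α} {H : SoftHeapProgs} {a : ℕ}
  {Rep : Val V → SoftHeapState V α → Prop} {Φ : Val V → SoftHeapState V α → ℕ}

theorem moveP_spec (l : List V) (k : ℕ) (acc : List V) :
    RetQ W moveP (.pair (.ofList l) (.pair (.num k) (.ofList acc))) fun r t =>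
      r = .pair (.num (k - l.length)) (.ofList ((l.take k).reverse ++ acc)) ∧
      t ≤ 20 * (l.length + 1) := by
  induction l generalizing k acc with
  | nil =>
    refine RetQ.of_body moveP.eq_1 ?_
    simp
    exact Post.intro ⟨by simp, by simp⟩
  | cons x l ih =>
    refine RetQ.of_body moveP.eq_1 ?_
    cases k with
    | zero =>
      simp
      exact Post.intro ⟨by simp, by omega⟩
    | succ k =>
      simp
      refine (ih k (x :: acc)).mono ?_
      rintro r t ⟨rfl, ht⟩
      exact Post.intro ⟨by simp, by omega⟩

theorem partP_spec (p : V) (l L E G : List V) :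
    RetQ W partP (.pair (.item p)
      (.pair (.ofList l) (.pair (.ofList L) (.pair (.ofList E) (.ofList G))))) fun r t =>
      ∃ L' E' G' : List V,
      r = .pair (.ofList (L' ++ L)) (.pair (.ofList (E' ++ E)) (.ofList (G' ++ G))) ∧
      (L' ++ E' ++ G').Perm l ∧ (∀ x ∈ L', W.key x < W.key p) ∧ (∀ x ∈ E', W.key x = W.key p) ∧
      (∀ x ∈ G', W.key p < W.key x) ∧ t ≤ 30 * (l.length + 1) := by
  induction l generalizing L E G with
  | nil =>
    refine RetQ.of_body partP.eq_1 ?_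
    simp
    exact Post.intro (by simp)
  | cons x l ih =>
    refine RetQ.of_body partP.eq_1 ?_
    rcases lt_trichotomy (W.key x) (W.key p) with h | h | h
    · simp [h.le, h.not_ge]
      refine (ih (x :: L) E G).mono ?_
      rintro r t ⟨L', E', G', rfl, h1, h2, h3, h4, ht⟩
      refine Post.intro ⟨L' ++ [x], E', G', by simp, ?_, ?_, h3, h4, by omega⟩
      · refine List.Perm.trans ?_ (h1.cons x)
        simp only [List.append_assoc, List.singleton_append]
        exact List.perm_middle
      · simpa [or_imp, forall_and, h] using h2
    · simp [h]
      refine (ih L (x :: E) G).mono ?_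
      rintro r t ⟨L', E', G', rfl, h1, h2, h3, h4, ht⟩
      refine Post.intro ⟨L', E' ++ [x], G', by simp, ?_, h2, ?_, h4, by omega⟩
      · refine List.Perm.trans ?_ (h1.cons x)
        simp only [List.append_assoc, List.singleton_append]
        rw [← List.append_assoc, ← List.append_assoc L' E' G']
        exact List.perm_middle
      · simpa [or_imp, forall_and, h] using h3
    · simp [h.le, h.not_ge]
      refine (ih L E (x :: G)).mono ?_
      rintro r t ⟨L', E', G', rfl, h1, h2, h3, h4, ht⟩
      refine Post.intro ⟨L', E', G' ++ [x], by simp, ?_, h2, h3, ?_, by omega⟩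
      · refine List.Perm.trans ?_ (h1.cons x)
        rw [← List.append_assoc, ← List.append_assoc]
        exact List.perm_append_singleton _ _
      · simpa [or_imp, forall_and, h] using h4

theorem fillP_spec (h : HeapSpec W H a Rep Φ) (l : List V) {q : Val V} {s : SoftHeapState V α}
    (hq : Rep q s) (hl : l.Nodup) (hs : ∀ v ∈ l, v ∉ s.items)
    (hc : ∀ v ∈ s.items, s.curKey v = W.key v) :
    RetQ W (fillP H) (.pair (.ofList l) q) fun q' t => ∃ s', Rep q' s' ∧
      (∀ v, v ∈ s'.items ↔ v ∈ l ∨ v ∈ s.items) ∧ (∀ v ∈ s'.items, s'.curKey v = W.key v) ∧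
      s'.insertions = s.insertions + l.length ∧
      t + Φ q' s' ≤ (a + 20) * (l.length) + 20 + Φ q s := by
  induction l generalizing q s with
  | nil =>
    refine RetQ.of_body (fillP.eq_1 H) ?_
    simp
    exact Post.intro ⟨s, hq, by simp, hc, rfl, by omega⟩
  | cons x l ih =>
    refine RetQ.of_body (fillP.eq_1 H) ?_
    simp
    refine (h.insert hq (hs x (by simp))).mono ?_
    rintro q₁ t₁ ⟨s₁, hq₁, ⟨i1, i2, i3, i4⟩, ht₁⟩
    refine (ih hq₁ hl.of_cons (fun v hv => ?_) fun v hv => ?_).mono ?_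
    · rw [i1]
      rintro (rfl | hv')
      · exact (List.nodup_cons.1 hl).1 hv
      · exact hs v (by simp [hv]) hv'
    · rcases (i1 v).1 hv with rfl | hv
      · exact i2
      · rw [i3 v hv, hc v hv]
    · rintro q₂ t₂ ⟨s₂, hq₂, j1, j2, j3, ht₂⟩
      refine Post.intro ⟨s₂, hq₂, fun v => ?_, j2, ?_, ?_⟩
      · rw [j1, i1]
        tauto
      · rw [j3, i4]
        omega
      · rw [mul_add]
        omega

end

section

variable {V α : Type*} [LinearOrder α] {W : Items V α} {H : SoftHeapProgs} {a : ℕ}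
  {Rep : Val V → SoftHeapState V α → Prop} {Φ : Val V → SoftHeapState V α → ℕ}

/-- Throughout, `p` is at least every extracted original key and at most every remaining current
key: an original key is at most the current key, which was minimal at extraction, and current keys
never decrease. -/
theorem drainP_spec (h : HeapSpec W H a Rep Φ) (l : List V) {p : V} {q : Val V}
    {s : SoftHeapState V α} (hq : Rep q s) (hl : (l.length + 3) / 4 ≤ s.items.card)
    (hp : ∀ u ∈ s.items, W.key p ≤ s.curKey u) :
    RetQ W (drainP H) (.pair (.ofList l) (.pair (.item p) q)) fun r t => ∃ p',
      r = .item p' ∧ ∃ q' s', Rep q' s' ∧ s'.items ⊆ s.items ∧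
      s.items.card = s'.items.card + (l.length + 3) / 4 ∧
      (p' = p ∨ p' ∈ s.items ∧ p' ∉ s'.items) ∧ W.key p ≤ W.key p' ∧
      (∀ u ∈ s.items, u ∉ s'.items → W.key u ≤ W.key p') ∧
      (∀ u ∈ s'.items, W.key p' ≤ s'.curKey u) ∧ s'.insertions = s.insertions ∧
      t + Φ q' s' ≤ (a + 30) * ((l.length + 3) / 4) + 10 + Φ q s := by
  -- An opaque coefficient keeps the products atomic for linear arithmetic.
  obtain ⟨A, hA⟩ : ∃ A, A = a + 30 := ⟨_, rfl⟩
  rw [← hA]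
  induction hn : l.length using Nat.strong_induction_on generalizing l p q s with
  | _ n ih =>
  subst hn
  cases l with
  | nil =>
    refine RetQ.of_body (drainP.eq_1 H) ?_
    simp
    exact Post.intro ⟨p, rfl, q, s, hq, subset_rfl, by simp, .inl rfl, le_rfl,
      fun u hu hu' => absurd hu hu', hp, rfl, by simp⟩
  | cons x l =>
    have hl' : ((x :: l).length + 3) / 4 = (l.tail.tail.tail.length + 3) / 4 + 1 := by
      simp only [List.length_cons, List.length_tail]
      omega
    rw [hl'] at hl ⊢
    have htail : ∀ l : List V, Rhs.eval W (fun _ => Val.ofList l) (.tail 0) = .ofList l.tail := by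
      intro l
      cases l <;> rfl
    simp only [Rhs.eval] at htail
    refine RetQ.of_body (drainP.eq_1 H) ?_
    simp
    refine (h.extract hq (Finset.card_pos.1 (by omega))).mono ?_
    rintro _ t₁ ⟨q₁, s₁, e, b, C, rfl, hq₁, ⟨i1, i2, i3, i4, i5, -, -⟩, -, ht₁⟩
    have hsub : s₁.items ⊆ s.items := fun u hu => ((i3 u).1 hu).1
    have hcard : s.items.card = s₁.items.card + 1 := by
      classical
      have : s₁.items = s.items.erase e := by
        ext u
        rw [i3, Finset.mem_erase, and_comm]
      rw [this, Finset.card_erase_of_mem i1]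
      have := Finset.card_pos.2 ⟨e, i1⟩
      omega
    have hes : ∀ u ∈ s₁.items, W.key e ≤ s₁.curKey u := fun u hu =>
      (h.key_le hq e i1).trans ((i2 u (hsub hu)).trans (i4 u hu))
    have hps : ∀ u ∈ s₁.items, W.key p ≤ s₁.curKey u := fun u hu =>
      (hp u (hsub hu)).trans (i4 u hu)
    by_cases hep : W.key e ≤ W.key p
    · simp [hep, htail]
      refine (ih _ (by simp; omega) l.tail.tail.tail hq₁ (by omega) hps rfl).mono ?_
      rintro r t ⟨p', rfl, q', s', j1, j2, j3, j4, j5, j6, j7, j8, ht⟩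
      simp only [List.length_tail] at j3 ht
      refine Post.intro ⟨p', rfl, q', s', j1, j2.trans hsub, by omega, ?_, j5, fun u hu hu' => ?_,
        j7, j8.trans i5, ?_⟩
      · exact j4.imp_right fun h => ⟨hsub h.1, h.2⟩
      · by_cases hue : u = e
        · exact hue ▸ hep.trans j5
        · exact j6 u ((i3 u).2 ⟨hu, hue⟩) hu'
      · have hh : t₁ + t + 25 + Φ q' s' ≤
            A * ((l.length - 1 - 1 - 1 + 3) / 4) + A + 10 + Φ q s := by omega
        rw [mul_add]
        linarith
    · simp [hep, htail]
      refine (ih _ (by simp; omega) l.tail.tail.tail hq₁ (by omega) hes rfl).mono ?_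
      rintro r t ⟨p', rfl, q', s', j1, j2, j3, j4, j5, j6, j7, j8, ht⟩
      simp only [List.length_tail] at j3 ht
      refine Post.intro ⟨p', rfl, q', s', j1, j2.trans hsub, by omega, .inr ?_,
        (not_le.1 hep).le.trans j5, fun u hu hu' => ?_, j7, j8.trans i5, ?_⟩
      · rcases j4 with rfl | h
        · exact ⟨i1, fun h => ((i3 _).1 (j2 h)).2 rfl⟩
        · exact ⟨hsub h.1, h.2⟩
      · by_cases hue : u = e
        · exact hue ▸ j5
        · exact j6 u ((i3 u).2 ⟨hu, hue⟩) hu'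
      · have hh : t₁ + t + 25 + Φ q' s' ≤
            A * ((l.length - 1 - 1 - 1 + 3) / 4) + A + 10 + Φ q s := by omega
        rw [mul_add]
        linarith

-- In total ⌈n/4⌉ items are extracted, the first before `drainP` and one per four elements of what
-- remains after dropping four. Items above the pivot were not extracted, so there are at most 3n/4.
-- Items below it were extracted, or remain with a current key at least that of the pivot and are
-- corrupt, at most n/4 of them.
set_option maxHeartbeats 1000000 in
theorem pivotP_spec (h : HeapSpec W H a Rep Φ) {l : List V} (hl : l.Nodup) (hne : l ≠ []) :
    RetQ W (pivotP H) (.ofList l) fun r t => ∃ p, r = .item p ∧ p ∈ l ∧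
      4 * l.countP (W.key · < W.key p) ≤ 3 * l.length ∧
      4 * l.countP (W.key p < W.key ·) ≤ 3 * l.length ∧
      t ≤ (4 * a + 100) * l.length := by
  classical
  have htail : ∀ l : List V, Rhs.eval W (fun _ => Val.ofList l) (.tail 0) = .ofList l.tail := by
    intro l
    cases l <;> rfl
  simp only [Rhs.eval] at htail
  have hpos : 0 < l.length := List.length_pos_iff.2 hne
  refine RetQ.of_body (pivotP.eq_1 H) ?_
  simp
  refine h.create.mono ?_
  rintro q₀ t₀ ⟨s₀, hq₀, c1, c2, ht₀⟩
  refine (fillP_spec h l hq₀ hl (by simp [c1]) (by simp [c1])).mono ?_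
  rintro q t₁ ⟨s, hq, f1, f2, f3, ht₁⟩
  have hsl : s.items = l.toFinset := by
    ext v
    simp [f1, c1]
  have hcard : s.items.card = l.length := by
    rw [hsl, List.toFinset_card_of_nodup hl]
  refine (h.extract hq (Finset.card_pos.1 (by omega))).mono ?_
  rintro _ t₂ ⟨q₁, s₁, e, b, C, rfl, hq₁, ⟨i1, i2, i3, i4, i5, -, -⟩, -, ht₂⟩
  have hsub : s₁.items ⊆ s.items := fun u hu => ((i3 u).1 hu).1
  have hcard₁ : s.items.card = s₁.items.card + 1 := by
    have : s₁.items = s.items.erase e := by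
      ext u
      rw [i3, Finset.mem_erase, and_comm]
    rw [this, Finset.card_erase_of_mem i1]
    omega
  have hes : ∀ u ∈ s₁.items, W.key e ≤ s₁.curKey u := fun u hu =>
    (h.key_le hq e i1).trans ((i2 u (hsub hu)).trans (i4 u hu))
  simp [htail]
  refine (drainP_spec h (l.tail.tail.tail.tail) hq₁ (by simp; omega) hes).mono ?_
  rintro r t₃ ⟨p, rfl, q', s', j1, j2, j3, j4, j5, j6, j7, j8, ht₃⟩
  simp only [List.length_tail] at j3 ht₃
  have hps : p ∈ s.items ∧ p ∉ s'.items := by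
    rcases j4 with rfl | h
    · exact ⟨i1, fun h => ((i3 _).1 (j2 h)).2 rfl⟩
    · exact ⟨hsub h.1, h.2⟩
  have hle : ∀ u ∈ s.items, u ∉ s'.items → W.key u ≤ W.key p := fun u hu hu' => by
    by_cases hue : u = e
    · exact hue ▸ j5
    · exact j6 u ((i3 u).2 ⟨hu, hue⟩) hu'
  have hcount : ∀ (P : V → Prop) [DecidablePred P] (B : Finset V),
      (∀ u ∈ s.items, P u → u ∈ B) → l.countP P ≤ B.card := fun P _ B hB => by
    rw [List.countP_eq_length_filter, ← List.toFinset_card_of_nodup (hl.filter _)]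
    refine Finset.card_le_card fun u hu => ?_
    simp only [List.mem_toFinset, List.mem_filter, decide_eq_true_eq] at hu
    exact hB u (by simpa [hsl] using hu.1) hu.2
  have hcor := h.corrupt_le j1
  have hfin : {v | s'.Corrupt W v}.Finite :=
    s'.items.finite_toSet.subset fun v hv => hv.1
  rw [Set.ncard_eq_toFinset_card _ hfin] at hcor
  have h1 := hcount (fun u => W.key u < W.key p)
    (((s.items \ s'.items).erase p) ∪ hfin.toFinset) fun u hu hup => by
      rw [Finset.mem_union, Finset.mem_erase, Finset.mem_sdiff]
      by_cases hu' : u ∈ s'.items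
      · right
        simp only [Set.Finite.mem_toFinset, Set.mem_ofPred_eq]
        exact ⟨hu', hup.trans_le (j7 u hu')⟩
      · exact .inl ⟨fun h => by simp [h] at hup, hu, hu'⟩
  have h2 := hcount (fun u => W.key p < W.key u) s'.items fun u hu hup => by
    by_contra hu'
    exact (hle u hu hu').not_gt hup
  have h3 := h1.trans (Finset.card_union_le _ _)
  rw [Finset.card_erase_of_mem (Finset.mem_sdiff.2 hps),
    Finset.card_sdiff_of_subset (j2.trans hsub)] at h3
  refine Post.intro ⟨p, rfl, by simpa [hsl] using hps.1, ?_, ?_, ?_⟩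
  · omega
  · omega
  · have h5 : a * ((l.length - 1 - 1 - 1 - 1 + 3) / 4) ≤ a * l.length :=
      Nat.mul_le_mul_left _ (by omega)
    have h6 : a ≤ a * l.length := Nat.le_mul_of_pos_right _ hpos
    rw [add_mul] at ht₁ ht₃ ⊢
    rw [mul_assoc]
    generalize a * ((l.length - 1 - 1 - 1 - 1 + 3) / 4) = x at *
    generalize a * l.length = y at *
    have hh : t₀ + t₁ + t₂ + t₃ + 50 ≤ 4 * y + 100 * l.length := by omega
    linarith

set_option maxHeartbeats 400000 in
theorem selP_spec (h : HeapSpec W H a Rep Φ) {l : List V} (hl : l.Nodup) {k : ℕ} (hk : 1 ≤ k)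
    (hkl : k ≤ l.length) (acc : List V) :
    RetQ W (selP H) (.pair (.ofList l) (.pair (.num k) (.ofList acc))) fun r t => ∃ out,
      r = .ofList (out ++ acc) ∧ ∃ rest, (out ++ rest).Perm l ∧ out.length = k ∧
      (∀ x ∈ out, ∀ y ∈ rest, W.key x ≤ W.key y) ∧ t ≤ (16 * a + 1600) * l.length := by
  classical
  obtain ⟨B, hB⟩ : ∃ B, B = 4 * a + 100 := ⟨_, rfl⟩
  -- The recursion is on at most 3/4 of the list, so a quarter of `A`, namely `B + 300`, must cover
  -- the pivot, the partition and the moves.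
  obtain ⟨A, hA⟩ : ∃ A, A = 4 * B + 1200 := ⟨_, rfl⟩
  have hAa : 16 * a + 1600 = A := by omega
  rw [hAa]
  induction hn : l.length using Nat.strong_induction_on generalizing l k acc with
  | _ n ih =>
  subst hn
  have hpos : 0 < l.length := by omega
  have hne : l ≠ [] := List.length_pos_iff.1 hpos
  obtain ⟨k, rfl⟩ : ∃ j, k = j + 1 := ⟨k - 1, by omega⟩
  refine RetQ.of_body (selP.eq_1 H) ?_
  simp
  refine (pivotP_spec h hl hne).mono ?_
  rintro _ t₀ ⟨p, rfl, hp, hlt, hgt, ht₀⟩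
  rw [← hB] at ht₀
  refine (partP_spec p l [] [] []).mono ?_
  rintro _ t₁ ⟨L, E, G, rfl, hperm, hL, hE, hG, ht₁⟩
  simp
  have hLc : L.length ≤ l.countP (W.key · < W.key p) := by
    have : L.countP (W.key · < W.key p) = L.length :=
      List.countP_eq_length.2 (by simpa using hL)
    rw [← hperm.countP_eq, List.append_assoc, List.countP_append]
    omega
  have hGc : G.length ≤ l.countP (W.key p < W.key ·) := by
    have : G.countP (W.key p < W.key ·) = G.length :=
      List.countP_eq_length.2 (by simpa using hG)
    rw [← hperm.countP_eq, List.countP_append]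
    omega
  have hlen := hperm.length_eq
  simp only [List.length_append] at hlen
  have hnd := hperm.nodup_iff.2 hl
  refine (moveP_spec L (k + 1) acc).mono ?_
  rintro _ t₂ ⟨rfl, ht₂⟩
  have ht₀' : A * l.length = 4 * (B * l.length) + 1200 * l.length := by
    rw [hA]
    ring
  have hrec : ∀ n, 4 * n ≤ 3 * l.length → 4 * (A * n) ≤ 3 * (A * l.length) := fun n hn => by
    calc 4 * (A * n) = A * (4 * n) := by ring
      _ ≤ A * (3 * l.length) := Nat.mul_le_mul_left _ hn
      _ = _ := by ring
  have hLl : 4 * L.length ≤ 3 * l.length := by omega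
  have hGl : 4 * G.length ≤ 3 * l.length := by omega
  clear hA hAa hB hLc hGc hlt hgt
  by_cases hkL : k + 1 ≤ L.length
  · have h0 : k + 1 - L.length = 0 := by omega
    simp [h0]
    refine (ih L.length (by omega) (hnd.of_append_left.of_append_left) hk hkL acc rfl).mono ?_
    rintro r t ⟨out, rfl, rest, h1, h2, h3, ht⟩
    have := hrec L.length hLl
    have hh : t₀ + t₁ + t₂ + t + 40 ≤ A * l.length := by omega
    refine Post.intro ⟨out, rfl, rest ++ (E ++ G), ?_, h2, ?_, by linarith⟩
    · refine List.Perm.trans ?_ hperm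
      rw [← List.append_assoc, List.append_assoc L]
      exact h1.append_right _
    · intro x hx y hy
      rcases List.mem_append.1 hy with hy | hy
      · exact h3 x hx y hy
      · have hxp : W.key x < W.key p := hL x (h1.mem_iff.1 (by simp [hx]))
        rcases List.mem_append.1 hy with hy | hy
        · exact (hxp.trans_eq (hE y hy).symm).le
        · exact (hxp.trans (hG y hy)).le
  · have h0 : k + 1 - L.length = (k - L.length) + 1 := by omega
    have hLk : L.take (k + 1) = L := List.take_of_length_le (by omega)
    simp [h0, hLk]
    refine (moveP_spec E (k - L.length + 1) (L.reverse ++ acc)).mono ?_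
    rintro _ t₃ ⟨rfl, ht₃⟩
    by_cases hkE : k + 1 ≤ L.length + E.length
    · have h0' : k - L.length + 1 - E.length = 0 := by omega
      simp [h0']
      refine Post.intro ⟨(E.take (k - L.length + 1)).reverse ++ L.reverse, by simp,
        E.drop (k - L.length + 1) ++ G, ?_, ?_, ?_, ?_⟩
      · refine List.Perm.trans ?_ hperm
        refine (((List.reverse_perm _).append (List.reverse_perm _)).append_right _).trans ?_
        rw [← List.append_assoc]
        refine List.Perm.append_right _ ?_
        refine (List.perm_append_comm.append_right _).trans ?_
        rw [List.append_assoc, List.take_append_drop]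
      · simp only [List.length_append, List.length_reverse, List.length_take]
        omega
      · have hx' : ∀ x ∈ (E.take (k - L.length + 1)).reverse ++ L.reverse,
            W.key x ≤ W.key p := by
          intro x hx
          simp only [List.mem_append, List.mem_reverse] at hx
          rcases hx with hx | hx
          · exact (hE x (List.mem_of_mem_take hx)).le
          · exact (hL x hx).le
        intro x hx y hy
        refine (hx' x hx).trans ?_
        rcases List.mem_append.1 hy with hy | hy
        · exact (hE y (List.mem_of_mem_drop hy)).ge
        · exact (hG y hy).le
      · have hh : t₀ + t₁ + t₂ + t₃ + 60 ≤ A * l.length := by omega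
        linarith
    · have h0' : k - L.length + 1 - E.length = (k - L.length - E.length) + 1 := by omega
      have hEk : E.take (k - L.length + 1) = E := List.take_of_length_le (by omega)
      simp [h0', hEk]
      have hGn : G.Nodup := hnd.of_append_right
      have hEl : 0 < L.length + E.length := by
        by_contra h0
        have hLn : L = [] := List.length_eq_zero_iff.1 (by omega)
        have hEn : E = [] := List.length_eq_zero_iff.1 (by omega)
        have := hperm.mem_iff.2 hp
        simp only [hLn, hEn, List.nil_append] at this
        exact lt_irrefl _ (hG p this)
      refine (ih G.length (by omega) hGn (k := k - L.length - E.length + 1) (by omega) (by omega)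
        (E.reverse ++ (L.reverse ++ acc)) rfl).mono ?_
      rintro r t ⟨out, rfl, rest, h1, h2, h3, ht⟩
      have := hrec G.length hGl
      have hh : t₀ + t₁ + t₂ + t₃ + t + 60 ≤ A * l.length := by omega
      refine Post.intro ⟨out ++ (E.reverse ++ L.reverse), by simp, rest, ?_, ?_, ?_, by linarith⟩
      · refine List.Perm.trans ?_ hperm
        rw [List.append_assoc]
        refine (List.perm_append_comm_assoc _ _ _).trans ?_
        refine List.Perm.append ?_ h1
        exact ((List.reverse_perm _).append (List.reverse_perm _)).trans List.perm_append_comm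
      · simp only [List.length_append, List.length_reverse, h2]
        omega
      · intro x hx y hy
        rcases List.mem_append.1 hx with hx | hx
        · exact h3 x hx y hy
        · have hy' := hG y (h1.mem_iff.1 (by simp [hy]))
          simp only [List.mem_append, List.mem_reverse] at hx
          rcases hx with hx | hx
          · exact (hE x hx).trans_le hy'.le
          · exact ((hL x hx).trans hy').le

theorem selectP_spec (h : HeapSpec W H a Rep Φ) {l : List V} (hl : l.Nodup) {k : ℕ} (hk : 1 ≤ k)
    (hkl : k ≤ l.length) :
    RetQ W (selectP H) (.pair (.ofList l) (.num k)) fun r t => ∃ out,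
      r = .ofList out ∧ ∃ rest, (out ++ rest).Perm l ∧ out.length = k ∧
      (∀ x ∈ out, ∀ y ∈ rest, W.key x ≤ W.key y) ∧ t ≤ (16 * a + 1700) * l.length := by
  refine RetQ.of_body (selectP.eq_1 H) ?_
  simp
  refine (selP_spec h hl hk hkl []).mono ?_
  rintro r t ⟨out, rfl, rest, h1, h2, h3, ht⟩
  refine Post.intro ⟨out, by simp, rest, h1, h2, h3, ?_⟩
  have : (16 * a + 1700) * l.length = (16 * a + 1600) * l.length + 100 * l.length := by ring
  omega

end

end SoftSeq

/-! ## Programs do not see the identity of items -/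

/-- Renaming of the items in a value. -/
@[simp] def Val.map {V V' : Type*} (f : V' → V) : Val V' → Val V
  | .num n => .num n
  | .item v => .item (f v)
  | .pair a b => .pair (map f a) (map f b)

theorem Val.truthy_map {V V' : Type*} (f : V' → V) (x : Val V') : (x.map f).truthy = x.truthy := by
  rcases x with (_ | n) | v | ⟨a, b⟩ <;> rfl

theorem Val.map_ofList {V V' : Type*} (f : V' → V) (l : List V') :
    (Val.ofList l).map f = .ofList (l.map f) := by
  induction l with
  | nil => rfl
  | cons v l ih => simp [ih]

section Map

variable {V V' α : Type*} [LinearOrder α] {W' : Items V' α} {W : Items V α} {f : V' → V}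

theorem Rhs.eval_map (hk : ∀ v, W.key (f v) = W'.key v) (hl : ∀ v, f (W'.left v) = W.left (f v))
    (hr : ∀ v, f (W'.right v) = W.right (f v)) (σ : ℕ → Val V') (e : Rhs) :
    e.eval W (fun n => (σ n).map f) = (e.eval W' σ).map f := by
  cases e with
  | copy y => rfl
  | zero => rfl
  | succ y => cases h : σ y <;> simp [h]
  | pred y => cases h : σ y <;> simp [h]
  | lt y z =>
    cases h : σ y <;> cases h' : σ z <;> simp [h, h']
    split_ifs <;> rfl
  | pair y z => rfl
  | head y => cases h : σ y <;> simp [h]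
  | tail y => cases h : σ y <;> simp [h]
  | left y => cases h : σ y <;> simp [h, hl]
  | right y => cases h : σ y <;> simp [h, hr]
  | compare y z =>
    cases h : σ y <;> cases h' : σ z <;> simp [h, h', hk]
    split_ifs <;> rfl

/-- Items are seen only through key comparisons and child pointers, so a run is carried along any
map compatible with these, injective or not. -/
theorem Exec.map (hk : ∀ v, W.key (f v) = W'.key v) (hl : ∀ v, f (W'.left v) = W.left (f v))
    (hr : ∀ v, f (W'.right v) = W.right (f v)) {g p : Prog} {σ σ' : ℕ → Val V'} {t m : ℕ}
    (h : Exec W' g p σ σ' t m) :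
    Exec W g p (fun n => (σ n).map f) (fun n => (σ' n).map f) t m := by
  have hupd : ∀ (σ : ℕ → Val V') (x : ℕ) (b : Val V'),
      (fun n => (Function.update σ x b n).map f) =
        Function.update (fun n => (σ n).map f) x (b.map f) := by
    intro σ x b
    ext n
    by_cases hn : n = x
    · subst hn
      simp
    · simp [hn]
  have hinit : ∀ a : Val V', (fun n => (initRegs a n).map f) = initRegs (a.map f) := by
    intro a
    ext n
    cases n <;> rfl
  induction h with
  | skip => exact .skip _ _
  | assign _ σ x e =>
    rw [hupd, ← Rhs.eval_map hk hl hr]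
    exact .assign _ _ _ _
  | seq _ _ h₁ h₂ => exact .seq h₁ h₂
  | cond_true hx _ h => exact .cond_true (by rwa [Val.truthy_map]) h
  | cond_false hx _ h => exact .cond_false (by rwa [Val.truthy_map]) h
  | loop_done hx => exact .loop_done (by rwa [Val.truthy_map])
  | loop_step hx _ _ h₁ h₂ => exact .loop_step (by rwa [Val.truthy_map]) h₁ h₂
  | @call _ _ _ _ σ _ _ _ _ h =>
    rw [hupd]
    rw [hinit] at h
    exact .call (σ := fun n => (σ n).map f) h
  | @recur _ _ _ σ _ _ _ _ h =>
    rw [hupd]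
    rw [hinit] at h
    exact .recur (σ := fun n => (σ n).map f) h

theorem Returns.map (hk : ∀ v, W.key (f v) = W'.key v) (hl : ∀ v, f (W'.left v) = W.left (f v))
    (hr : ∀ v, f (W'.right v) = W.right (f v)) {g : Prog} {a b : Val V'} {t m : ℕ}
    (h : Returns W' g a b t m) : Returns W g (a.map f) (b.map f) t m := by
  obtain ⟨σ, h, rfl⟩ := h
  refine ⟨fun n => (σ n).map f, ?_, rfl⟩
  convert h.map hk hl hr using 1
  ext n
  cases n <;> rfl

end Map

/-! ### Selection from lists with repetitions -/

namespace SoftSeq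

theorem isLinearTimeSelection {V α : Type*} [LinearOrder α] (W : Items V α) :
    IsLinearTimeSelection W (selectP softHeap) (16 * heapCost + 1700) := by
  intro l k hk hkl
  -- The list may repeat items, but a soft heap holds each item once. Tagging with positions makes
  -- the entries distinct, and the run is then projected back.
  set W' : Items (V × ℕ) α := ⟨fun v => W.key v.1, fun v => (W.left v.1, 0),
    fun v => (W.right v.1, 0)⟩ with hW'
  obtain ⟨Rep, Φ, h⟩ := (isSoftHeap W').heapSpec
  have hnd : l.zipIdx.Nodup := by
    refine List.Nodup.of_map Prod.snd ?_
    rw [List.zipIdx_map_snd]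
    exact List.nodup_range'
  have hlen : l.zipIdx.length = l.length := List.length_zipIdx
  obtain ⟨r, t, m, hret, out, rfl, rest, h1, h2, h3, ht⟩ :=
    selectP_spec h hnd hk (hlen.symm ▸ hkl)
  have := hret.map (W := W) (f := Prod.fst) (fun _ => rfl) (fun _ => rfl) fun _ => rfl
  simp only [Val.map, Val.map_ofList, List.zipIdx_map_fst] at this
  refine ⟨out.map Prod.fst, rest.map Prod.fst, t, m, this, ?_, by simpa using h2, ?_, hlen ▸ ht⟩
  · rw [← List.map_append]
    simpa only [List.zipIdx_map_fst] using h1.map Prod.fst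
  · intro x hx y hy
    obtain ⟨x', hx', rfl⟩ := List.mem_map.1 hx
    obtain ⟨y', hy', rfl⟩ := List.mem_map.1 hy
    exact h3 x' hx' y' hy'

end SoftSeq

/-! ## Soft-Select -/

namespace SoftSelect

section

variable {α : Type*} {key : Node → α} {s s' : SoftHeapState Node α}

@[simp] theorem heapItems_left (v : Node) : (heapItems key).left v = false :: v := rfl

@[simp] theorem heapItems_right (v : Node) : (heapItems key).right v = true :: v := rfl

variable [LinearOrder α]

/-- The items that have been put on the list `S` are the root and the children of the items that
have been extracted (they form the set `X`) or are corrupt, except for the items of `C`. -/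
structure Inv (key : Node → α) (s : SoftHeapState Node α) (S : List Node) (X : Finset Node)
    (C : List Node) : Prop where
  nodup : S.Nodup
  mem_iff : ∀ v, v ∈ S ↔ v = [] ∨ ∃ b u, v = b :: u ∧
    (u ∈ X ∨ s.Corrupt (heapItems key) u) ∧ u ∉ C
  items : ∀ v, v ∈ s.items ↔ v ∈ S ∧ v ∉ X
  X_sub : ∀ v ∈ X, v ∈ S
  C_nodup : C.Nodup
  C_sub : ∀ c ∈ C, c ∈ X ∨ s.Corrupt (heapItems key) c
  key_C : ∀ x ∈ X, ∀ c ∈ C, key x ≤ key c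
  key_items : ∀ x ∈ X, ∀ v ∈ s.items, key x ≤ s.curKey v
  ins : s.insertions = S.length

theorem _root_.SoftHeapState.InsertStep.corrupt_iff {V α : Type*} [LinearOrder α] {W : Items V α}
    {s s' : SoftHeapState V α} {v : V} (h : s.InsertStep W v s') (hv : v ∉ s.items) (u : V) :
    s'.Corrupt W u ↔ s.Corrupt W u := by
  obtain ⟨h1, h2, h3, -⟩ := h
  simp only [SoftHeapState.Corrupt, h1]
  constructor
  · rintro ⟨rfl | hu, hlt⟩
    · rw [h2] at hlt
      exact absurd hlt (lt_irrefl _)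
    · exact ⟨hu, h3 u hu ▸ hlt⟩
  · rintro ⟨hu, hlt⟩
    exact ⟨.inr hu, (h3 u hu).symm ▸ hlt⟩

theorem Inv.start (h0 : s.items = ∅) (h0' : s.insertions = 0)
    (h : s.InsertStep (heapItems key) [] s') : Inv key s' [[]] ∅ [] := by
  have hc : ∀ u, ¬ s'.Corrupt (heapItems key) u := fun u => by
    rw [h.corrupt_iff (by simp [h0])]
    simp [SoftHeapState.Corrupt, h0]
  refine ⟨by simp, by simp [hc], fun v => ?_, by simp, by simp, by simp, by simp, by simp, ?_⟩
  · rw [h.1]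
    simp [h0]
  · rw [h.2.2.2, h0']
    rfl

theorem Inv.child_notMem {S : List Node} {X : Finset Node} {C : List Node} {c : Node}
    (h : Inv key s S X (c :: C)) (b : Bool) : b :: c ∉ S := by
  rw [h.mem_iff]
  rintro (h | ⟨b, u, h, -, hu⟩)
  · cases h
  · cases h
    simp at hu

/-- `key_C` is what admits the new items: a child is at least its parent `c`, which is at least
every extracted item. -/
theorem Inv.children {S : List Node} {X : Finset Node} {C : List Node} {c : Node}
    {s₁ s₂ : SoftHeapState Node α} (h : Inv key s S X (c :: C)) (hk : IsMinHeap key)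
    (h₁ : s.InsertStep (heapItems key) (false :: c) s₁)
    (h₂ : s₁.InsertStep (heapItems key) (true :: c) s₂) :
    true :: c ∉ s₁.items ∧ Inv key s₂ ((true :: c) :: (false :: c) :: S) X C := by
  have hn := h.child_notMem
  have hni : ∀ b, b :: c ∉ s.items := fun b hb => hn b ((h.items _).1 hb).1
  have hn' : true :: c ∉ s₁.items := fun h' => by
    rcases (h₁.1 _).1 h' with h' | h'
    · simp at h'
    · exact hni _ h'
  have hcor : ∀ u, s₂.Corrupt (heapItems key) u ↔ s.Corrupt (heapItems key) u := fun u =>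
    (h₂.corrupt_iff hn' u).trans (h₁.corrupt_iff (hni _) u)
  have hcX : ∀ b, b :: c ∉ X := fun b hb => hn b (h.X_sub _ hb)
  have hC := List.nodup_cons.1 h.C_nodup
  have hchild : ∀ b, key c ≤ key (b :: c) → ∀ x ∈ X, key x ≤ key (b :: c) := fun b hb x hx =>
    (h.key_C x hx c (by simp)).trans hb
  refine ⟨hn', ?_, fun v => ?_, fun v => ?_, fun v hv => ?_, hC.2, fun d hd => ?_,
    fun x hx d hd => h.key_C x hx d (by simp [hd]), fun x hx v hv => ?_, ?_⟩
  · simp [h.nodup, hn]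
  · rw [List.mem_cons, List.mem_cons, h.mem_iff]
    simp only [hcor, List.mem_cons, not_or]
    constructor
    · rintro (rfl | rfl | rfl | ⟨b, u, rfl, hu, -, hu'⟩)
      · exact .inr ⟨_, _, rfl, h.C_sub c (by simp), hC.1⟩
      · exact .inr ⟨_, _, rfl, h.C_sub c (by simp), hC.1⟩
      · exact .inl rfl
      · exact .inr ⟨_, _, rfl, hu, hu'⟩
    · rintro (rfl | ⟨b, u, rfl, hu, hu'⟩)
      · exact .inr (.inr (.inl rfl))
      · by_cases huc : u = c
        · subst huc
          cases b
          · exact .inr (.inl rfl)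
          · exact .inl rfl
        · exact .inr (.inr (.inr ⟨_, _, rfl, hu, huc, hu'⟩))
  · rw [h₂.1, h₁.1, h.items, List.mem_cons, List.mem_cons]
    constructor
    · rintro (rfl | rfl | ⟨hv, hv'⟩)
      · exact ⟨.inl rfl, hcX _⟩
      · exact ⟨.inr (.inl rfl), hcX _⟩
      · exact ⟨.inr (.inr hv), hv'⟩
    · rintro ⟨hv | hv | hv, hv'⟩
      · exact .inl hv
      · exact .inr (.inl hv)
      · exact .inr (.inr ⟨hv, hv'⟩)
  · exact List.mem_cons_of_mem _ (List.mem_cons_of_mem _ (h.X_sub v hv))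
  · rw [hcor]
    exact h.C_sub d (by simp [hd])
  · rcases (h₂.1 v).1 hv with rfl | hv
    · rw [h₂.2.1]
      exact hchild _ (hk c).2 x hx
    · rw [h₂.2.2.1 v hv]
      rcases (h₁.1 v).1 hv with rfl | hv
      · rw [h₁.2.1]
        exact hchild _ (hk c).1 x hx
      · rw [h₁.2.2.1 v hv]
        exact h.key_items x hx v hv
  · rw [h₂.2.2.2, h₁.2.2.2, h.ins]
    rfl

/-- A newly corrupt item still had its original key when `e` was minimal, which yields `key_C`. If
`e` is corrupt, its children were already inserted when it became so; hence only an uncorrupted `e`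
joins the list. -/
theorem Inv.extract {S : List Node} {X : Finset Node} {e : Node} {C C' : List Node}
    (h : Inv key s S X []) (hkey : ∀ v ∈ s.items, key v ≤ s.curKey v)
    (hs : s.ExtractStep (heapItems key) e C s')
    (hC' : ∀ c, c ∈ C' ↔ c ∈ C ∨ c = e ∧ ¬ s.Corrupt (heapItems key) e) (hn : C'.Nodup) :
    Inv key s' S (insert e X) C' ∧ e ∉ X := by
  obtain ⟨i1, i2, i3, i4, i5, i6, i7⟩ := hs
  have heX : e ∉ X := ((h.items e).1 i1).2
  have hC : ∀ c ∈ C', c ∈ s.items ∧ ¬ s.Corrupt (heapItems key) c := fun c hc => by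
    rcases (hC' c).1 hc with hc | ⟨rfl, hc⟩
    · have := (i7 c).1 hc
      exact ⟨((i3 c).1 this.1.1).1, this.2⟩
    · exact ⟨i1, hc⟩
  have hcur : ∀ c ∈ C', s.curKey c = key c := fun c hc =>
    le_antisymm (not_lt.1 fun hlt => (hC c hc).2 ⟨(hC c hc).1, hlt⟩) (hkey c (hC c hc).1)
  have hX : ∀ x ∈ insert e X, ∀ v ∈ s.items, key x ≤ s.curKey v := fun x hx v hv => by
    rcases Finset.mem_insert.1 hx with rfl | hx
    · exact (hkey x i1).trans (i2 v hv)
    · exact h.key_items x hx v hv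
  refine ⟨⟨h.nodup, fun v => ?_, fun v => ?_, fun v hv => ?_, hn, fun c hc => ?_,
    fun x hx c hc => ?_, fun x hx v hv => ?_, i5.trans h.ins⟩, heX⟩
  · rw [h.mem_iff]
    refine or_congr_right (exists_congr fun b => exists_congr fun u => and_congr_right fun _ => ?_)
    rw [hC', Finset.mem_insert, i7]
    simp only [List.not_mem_nil, not_false_eq_true, and_true]
    constructor
    · rintro (hu | hu)
      · have hus : u ∉ s.items := fun hu' => ((h.items u).1 hu').2 hu
        refine ⟨.inl (.inr hu), ?_⟩
        rintro (⟨hc, -⟩ | ⟨rfl, -⟩)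
        · exact hus ((i3 u).1 hc.1).1
        · exact heX hu
      · refine ⟨?_, ?_⟩
        · by_cases hue : u = e
          · exact .inl (.inl hue)
          · have hu' := (i3 u).2 ⟨hu.1, hue⟩
            exact .inr ⟨hu', hu.2.trans_le (i4 u hu')⟩
        · rintro (⟨-, hc⟩ | ⟨rfl, hc⟩)
          · exact hc hu
          · exact hc hu
    · rintro ⟨(rfl | hu) | hu, hn⟩
      · right
        by_contra hc
        exact hn (.inr ⟨rfl, hc⟩)
      · exact .inl hu
      · right
        by_contra hc
        exact hn (.inl ⟨hu, hc⟩)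
  · rw [i3, h.items, Finset.mem_insert]
    tauto
  · rcases Finset.mem_insert.1 hv with rfl | hv
    · exact ((h.items v).1 i1).1
    · exact h.X_sub v hv
  · rcases (hC' c).1 hc with hc | ⟨rfl, -⟩
    · exact .inr ((i7 c).1 hc).1
    · exact .inl (Finset.mem_insert_self _ _)
  · exact (hX x hx c (hC c hc).1).trans_eq (hcur c hc)
  · exact (hX x hx v ((i3 v).1 hv).1).trans (i4 v hv)

/-! ### Size of the list `S` and correctness of the selection -/

theorem Inv.card_X_lt {S : List Node} {X : Finset Node} (h : Inv key s S X []) :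
    X.card + 1 ≤ S.length := by
  -- The root and the right children of the extracted items are all on `S`.
  rw [← List.toFinset_card_of_nodup h.nodup, ← Finset.card_image_of_injective X
    (List.cons_injective (a := true)), ← Finset.card_insert_of_notMem (a := [])]
  · refine Finset.card_le_card fun v hv => ?_
    rw [List.mem_toFinset, h.mem_iff]
    rcases Finset.mem_insert.1 hv with rfl | hv
    · exact .inl rfl
    · obtain ⟨u, hu, rfl⟩ := Finset.mem_image.1 hv
      exact .inr ⟨_, _, rfl, .inl hu, by simp⟩
  · simp

theorem Inv.items_nonempty {S : List Node} {X : Finset Node} (h : Inv key s S X []) :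
    s.items.Nonempty := by
  by_contra hne
  rw [Finset.not_nonempty_iff_eq_empty] at hne
  have hsub : S.toFinset ⊆ X := fun v hv => by
    by_contra hX
    have := (h.items v).2 ⟨List.mem_toFinset.1 hv, hX⟩
    simp [hne] at this
  have := Finset.card_le_card hsub
  rw [List.toFinset_card_of_nodup h.nodup] at this
  have := h.card_X_lt
  omega

theorem Inv.length_le {S : List Node} {X : Finset Node} (h : Inv key s S X [])
    (hc : 4 * {v | s.Corrupt (heapItems key) v}.ncard ≤ s.insertions) :
    S.length ≤ 4 * X.card + 2 := by
  have hfin : {v | s.Corrupt (heapItems key) v}.Finite :=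
    s.items.finite_toSet.subset fun v hv => hv.1
  rw [Set.ncard_eq_toFinset_card _ hfin, h.ins] at hc
  -- Counting gives |S| ≤ 1 + 2 (|X| + number of corrupt items), and four times that number is at
  -- most |S|.
  have h1 : S.toFinset ⊆ insert [] ((X ∪ hfin.toFinset).image (List.cons true) ∪
      (X ∪ hfin.toFinset).image (List.cons false)) := fun v hv => by
    rcases (h.mem_iff v).1 (List.mem_toFinset.1 hv) with rfl | ⟨b, u, rfl, hu, -⟩
    · simp
    · cases b <;> simpa using hu
  have h2 := (Finset.card_le_card h1).trans ((Finset.card_insert_le _ _).trans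
    (Nat.add_le_add_right (Finset.card_union_le _ _) 1))
  rw [List.toFinset_card_of_nodup h.nodup, Finset.card_image_of_injective _ List.cons_injective,
    Finset.card_image_of_injective _ List.cons_injective] at h2
  have h3 := Finset.card_union_le X hfin.toFinset
  omega

/-- An item that is not on the list `S` has an ancestor in the heap that is not corrupt. -/
theorem Inv.exists_le {S : List Node} {X : Finset Node} (h : Inv key s S X [])
    (hk : IsMinHeap key) {w : Node} (hw : w ∉ S) :
    ∃ u ∈ S, u ∉ X ∧ key u ≤ key w ∧ ∀ x ∈ X, key x ≤ key u := by
  induction w with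
  | nil => exact absurd ((h.mem_iff _).2 (.inl rfl)) hw
  | cons b u ih =>
    have hle : key u ≤ key (b :: u) := by
      cases b
      · exact (hk u).1
      · exact (hk u).2
    have hu : ¬ (u ∈ X ∨ s.Corrupt (heapItems key) u) := fun hu =>
      hw ((h.mem_iff _).2 (.inr ⟨_, _, rfl, hu, by simp⟩))
    rw [not_or] at hu
    by_cases huS : u ∈ S
    · have hui := (h.items u).2 ⟨huS, hu.1⟩
      refine ⟨u, huS, hu.1, hle, fun x hx => (h.key_items x hx u hui).trans ?_⟩
      exact not_lt.1 fun hlt => hu.2 ⟨hui, hlt⟩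
    · obtain ⟨u', h1, h2, h3, h4⟩ := ih huS
      exact ⟨u', h1, h2, h3.trans hle, h4⟩

theorem Inv.select {S : List Node} {X : Finset Node} (h : Inv key s S X [])
    (hk : IsMinHeap key) {out rest : List Node}
    (hp : (out ++ rest).Perm S) (hout : out.length = X.card + 1)
    (hle : ∀ x ∈ out, ∀ y ∈ rest, key x ≤ key y) {v w : Node} (hv : v ∈ out) (hw : w ∉ out) :
    key v ≤ key w := by
  by_cases hwS : w ∈ S
  · exact hle v hv w ((List.mem_append.1 (hp.mem_iff.2 hwS)).resolve_left hw)
  · obtain ⟨u, huS, huX, huw, hXu⟩ := h.exists_le hk hwS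
    refine le_trans ?_ huw
    by_contra hlt
    rw [not_le] at hlt
    have hmem : ∀ y ∈ insert u X, key y ≤ key u ∧ y ∈ S := fun y hy => by
      rcases Finset.mem_insert.1 hy with rfl | hy
      · exact ⟨le_rfl, huS⟩
      · exact ⟨hXu y hy, h.X_sub y hy⟩
    -- If `v` exceeded `u`, then `u` and all of `X`, being smaller than the selected `v`, would be
    -- selected too: one item too many.
    have hsub : insert v (insert u X) ⊆ out.toFinset := fun y hy => by
      rw [List.mem_toFinset]
      rcases Finset.mem_insert.1 hy with rfl | hy
      · exact hv
      · refine (List.mem_append.1 (hp.mem_iff.2 (hmem y hy).2)).resolve_right fun hr => ?_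
        exact ((hle v hv y hr).trans (hmem y hy).1).not_gt hlt
    have hcard := (Finset.card_le_card hsub).trans (List.toFinset_card_le _)
    rw [Finset.card_insert_of_notMem fun hv' => ((hmem v hv').1).not_gt hlt,
      Finset.card_insert_of_notMem huX] at hcard
    omega

end

/-! ### Running time of Soft-Select -/

section

variable {α : Type*} [LinearOrder α] {key : Node → α} {H : SoftHeapProgs} {a : ℕ}
  {Rep : Val Node → SoftHeapState Node α → Prop} {Φ : Val Node → SoftHeapState Node α → ℕ}

/-- Time is charged to the growth of `S`: `A` units for each new entry cover one insertion and the
surrounding instructions. -/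
theorem insertChildren_spec (h : HeapSpec (heapItems key) H a Rep Φ) (hk : IsMinHeap key)
    {f : Prog} {A : ℕ} (hA : a + 40 ≤ A) {X : Finset Node} {q : Val Node}
    {s : SoftHeapState Node α} {S C : List Node} {σ : ℕ → Val Node}
    {Q : (ℕ → Val Node) → ℕ → Prop} (hq : Rep q s) (hi : Inv key s S X C)
    (hσC : σ 8 = .ofList C) (hσQ : σ 4 = q) (hσS : σ 3 = .ofList S)
    (hQ : ∀ σ' t q' s' S', Rep q' s' → Inv key s' S' X [] → σ' 4 = q' → σ' 3 = .ofList S' →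
      σ' 2 = σ 2 → σ' 5 = σ 5 → t + Φ q' s' + A * S.length ≤ Φ q s + A * S'.length + 1 → Q σ' t) :
    Tri (heapItems key) f (insertChildren H) σ Q := by
  unfold insertChildren
  induction C generalizing q s S σ Q with
  | nil =>
    exact Tri.loop_done (by simp [hσC]) (hQ _ _ _ _ _ hq hi hσQ hσS rfl rfl (by omega))
  | cons c C ih =>
    refine Tri.loop_step (by simp [hσC]) ?_
    have hn : ∀ b, b :: c ∉ s.items := fun b hb => hi.child_notMem b ((hi.items _).1 hb).1
    simp [SoftSelect.C, SoftSelect.e, SoftSelect.x, SoftSelect.y, SoftSelect.Q, SoftSelect.tmp,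
      SoftSelect.S, hσC, hσQ, hσS]
    refine (h.insert hq (hn false)).mono ?_
    rintro q₁ t₁ ⟨s₁, hq₁, h₁, ht₁⟩
    have hn₁ : true :: c ∉ s₁.items := fun h' => by
      rcases (h₁.1 _).1 h' with h' | h'
      · simp at h'
      · exact hn _ h'
    refine (h.insert hq₁ hn₁).mono ?_
    rintro q₂ t₂ ⟨s₂, hq₂, h₂, ht₂⟩
    have hi₂ := (hi.children hk h₁ h₂).2
    refine ih hq₂ hi₂ (by simp) (by simp) (by simp) ?_
    intro σ' t q' s' S' hq' hi' h3 h4 h5 h6 ht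
    refine hQ _ _ _ _ _ hq' hi' h3 h4 (by simpa using h5) (by simpa using h6) ?_
    simp only [List.length_cons, mul_add] at ht
    have hh : t₁ + t₂ + t + 30 + Φ q' s' + A * S.length ≤ Φ q s + A * S'.length + 1 := by omega
    linarith

/-- Besides the charge per entry of `S`, each iteration is charged `A` for its extraction. The soft
heap cannot run empty, by `Inv.items_nonempty`. -/
theorem loop_spec (h : HeapSpec (heapItems key) H a Rep Φ) (hk : IsMinHeap key)
    {f : Prog} {A : ℕ} (hA : a + 40 ≤ A) {n : ℕ} {X : Finset Node} {q : Val Node}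
    {s : SoftHeapState Node α} {S : List Node} {σ : ℕ → Val Node}
    {Q : (ℕ → Val Node) → ℕ → Prop} (hq : Rep q s) (hi : Inv key s S X [])
    (hσi : σ 5 = .num n) (hσQ : σ 4 = q) (hσS : σ 3 = .ofList S)
    (hQ : ∀ σ' t q' s' S' X', Rep q' s' → Inv key s' S' X' [] → X'.card = X.card + n →
      σ' 3 = .ofList S' → σ' 2 = σ 2 →
      t + A * S.length ≤ Φ q s + A * S'.length + A * n + 1 → Q σ' t) :
    Tri (heapItems key) f
      (.loop i (.block [iteration H, .assign i (.pred i)])) σ Q := by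
  induction n generalizing X q s S σ Q with
  | zero =>
    exact Tri.loop_done (by simp [hσi]) (hQ _ _ _ _ _ _ hq hi rfl hσS rfl (by omega))
  | succ n ih =>
    refine Tri.loop_step (by simp [hσi]) ?_
    simp [iteration, SoftSelect.i, SoftSelect.C, SoftSelect.e, SoftSelect.b, SoftSelect.Q,
      SoftSelect.tmp, hσQ]
    refine (h.extract hq hi.items_nonempty).mono ?_
    rintro _ t₁ ⟨q₁, s₁, e, b, C, rfl, hq₁, hs, hb, ht₁⟩
    have hC := hs.2.2.2.2.2
    by_cases hc : s.Corrupt (heapItems key) e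
    · have hb' := hb.2 hc
      obtain ⟨hi₁, heX⟩ := hi.extract (h.key_le hq) hs (C' := C) (by simp [hc]) hC.1
      simp [hb']
      refine insertChildren_spec h hk hA hq₁ hi₁ (by simp) (by simp) (by simp [hσS]) ?_
      intro σ₂ t₂ q₂ s₂ S₂ hq₂ hi₂ h3 h4 h5 h6 ht₂
      simp [hσi] at h5 h6
      simp [h6]
      refine ih hq₂ hi₂ (by simp) (by simp [h3]) (by simp [h4]) ?_
      intro σ' t q' s' S' X' hq' hi' h7 h8 h9 ht
      rw [Finset.card_insert_of_notMem heX] at h7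
      refine hQ _ _ _ _ _ _ hq' hi' (by omega) h8 (by simpa [h5] using h9) ?_
      have hh : t₁ + t₂ + t + 30 + A * S.length ≤ Φ q s + A * S'.length + A * n + A := by omega
      rw [mul_add]
      linarith
    · have hb' : b.truthy = false := by
        rw [← Bool.not_eq_true, hb]
        exact hc
      have heC : e ∉ C := fun he => ((hs.2.2.1 e).1 ((hC.2 e).1 he).1.1).2 rfl
      obtain ⟨hi₁, heX⟩ := hi.extract (h.key_le hq) hs (C' := e :: C) (by simp [hc, or_comm])
        (List.nodup_cons.2 ⟨heC, hC.1⟩)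
      simp [hb']
      refine insertChildren_spec h hk hA hq₁ hi₁ (by simp) (by simp) (by simp [hσS]) ?_
      intro σ₂ t₂ q₂ s₂ S₂ hq₂ hi₂ h3 h4 h5 h6 ht₂
      simp [hσi] at h5 h6
      simp [h6]
      refine ih hq₂ hi₂ (by simp) (by simp [h3]) (by simp [h4]) ?_
      intro σ' t q' s' S' X' hq' hi' h7 h8 h9 ht
      rw [Finset.card_insert_of_notMem heX] at h7
      refine hQ _ _ _ _ _ _ hq' hi' (by omega) h8 (by simpa [h5] using h9) ?_
      have hh : t₁ + t₂ + t + 30 + A * S.length ≤ Φ q s + A * S'.length + A * n + A := by omega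
      rw [mul_add]
      linarith

theorem program_spec {select : Prog} (h : HeapSpec (heapItems key) H a Rep Φ)
    (hk : IsMinHeap key) (hsel : IsLinearTimeSelection (heapItems key) select a) {k : ℕ}
    (hk1 : 1 ≤ k) :
    RetQ (heapItems key) (program H select) (.pair (.item []) (.num k)) fun r t => ∃ out,
      r = .ofList out ∧ out.Nodup ∧ out.length = k ∧ (∀ v ∈ out, ∀ w ∉ out, key v ≤ key w) ∧
      t ≤ (10 * a + 300) * k := by
  obtain ⟨n, rfl⟩ : ∃ n, k = n + 1 := ⟨k - 1, by omega⟩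
  refine RetQ.of_body (program.eq_1 H select) ?_
  simp [SoftSelect.r, SoftSelect.k, SoftSelect.i, SoftSelect.arg, SoftSelect.Q, SoftSelect.tmp,
    SoftSelect.S]
  refine h.create.mono ?_
  rintro q₀ t₀ ⟨s₀, hq₀, h0, h0', ht₀⟩
  refine (h.insert (v := []) hq₀ (by simp [h0])).mono ?_
  rintro q₁ t₁ ⟨s₁, hq₁, h₁, ht₁⟩
  refine loop_spec h hk (A := a + 40) le_rfl (n := n) hq₁ (Inv.start h0 h0' h₁) (by simp)
    (by simp) (by simp) ?_
  intro σ t q s S X hq hi hX hS hkσ ht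
  simp at hkσ
  simp [hkσ, hS]
  simp only [Finset.card_empty, zero_add] at hX
  have hlen := hi.length_le (h.corrupt_le hq)
  obtain ⟨out, rest, t', m, hret, h2, h3, h4, h5⟩ := hsel S (n + 1) (by omega)
    (hX ▸ hi.card_X_lt)
  refine ⟨_, t', m, hret, ?_⟩
  refine Post.intro ⟨out, by simp, ?_, h3, fun v hv w hw => ?_, ?_⟩
  · exact (h2.nodup_iff.2 hi.nodup).of_append_left
  · exact hi.select hk h2 (h3.trans (by rw [hX])) h4 hv hw
  · have hS4 : S.length ≤ 4 * n + 2 := hX ▸ hlen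
    have h6 : a * S.length ≤ a * (4 * n + 2) := Nat.mul_le_mul_left _ hS4
    simp only [List.length_cons, List.length_nil, zero_add, mul_one, mul_add, add_mul] at ht h6 ⊢
    -- To leading order the insertions cost 4 a n, the extractions a n, and the selection from at
    -- most 4 n + 2 items another 4 a n.
    have hh : t₀ + t₁ + t + t' + 60 ≤ 10 * a * n + 300 * n + (10 * a + 300) := by
      nlinarith
    linarith

end

theorem softSelectsWithin {α : Type*} [LinearOrder α] {key : Node → α} {H : SoftHeapProgs}
    {select : Prog} {a k : ℕ} (hk : IsMinHeap key) (hH : IsSoftHeap (heapItems key) H (1 / 4) a)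
    (hsel : IsLinearTimeSelection (heapItems key) select a) (hk1 : 1 ≤ k) :
    SoftSelectsWithin key H select k (10 * a + 300) := by
  obtain ⟨Rep, Φ, h⟩ := hH.heapSpec
  obtain ⟨_, t, m, hret, out, rfl, h1, h2, h3, h4⟩ := program_spec h hk hsel hk1
  obtain ⟨σ, hex, -⟩ := id hret
  exact ⟨out, t, m, hret, h1, h2, h3, h4, hex.comparisons_le.trans h4⟩

end SoftSelect

theorem mainTheorem1 :
    -- there are a soft heap and a selection procedure with which Soft-Select runs in time `O(k)`
    (∃ (H : SoftHeapProgs) (select : Prog) (a c : ℕ),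
      (∀ (V : Type v) (α : Type u) [LinearOrder α] (W : Items V α),
        IsSoftHeap W H (1 / 4) a ∧ IsLinearTimeSelection W select a) ∧
      (∀ (α : Type u) [LinearOrder α] (key : Node → α), IsMinHeap key →
        ∀ k : ℕ, 1 ≤ k → SoftSelectsWithin key H select k c)) ∧
    -- and this holds for every soft heap with constant amortized time and every linear-time
    -- selection procedure
    (∀ a : ℕ, ∃ c : ℕ, ∀ (H : SoftHeapProgs) (select : Prog)
      (α : Type u) [LinearOrder α] (key : Node → α), IsMinHeap key →
        IsSoftHeap (heapItems key) H (1 / 4) a →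
        IsLinearTimeSelection (heapItems key) select a →
        ∀ k : ℕ, 1 ≤ k → SoftSelectsWithin key H select k c) := by
  refine ⟨⟨SoftSeq.softHeap, SoftSeq.selectP SoftSeq.softHeap, 16 * SoftSeq.heapCost + 1700, _,
    fun V α _ W => ⟨(SoftSeq.isSoftHeap W).mono (by omega), SoftSeq.isLinearTimeSelection W⟩,
    fun α _ key hk k hk1 => SoftSelect.softSelectsWithin hk
      ((SoftSeq.isSoftHeap _).mono (by omega)) (SoftSeq.isLinearTimeSelection _) hk1⟩,
    fun a => ⟨_, fun H select α _ key hk hH hsel k hk1 =>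
      SoftSelect.softSelectsWithin hk hH hsel hk1⟩⟩
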